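/- Let $\mathbb K$ be a field, $\mathbb N_0=\{0,1,2,\dots\}$, $[k]=\{1,\dots,k\}$ and $\mathfrak S_k$ the symmetric group of $[k]$. **TraPs.** For $\sigma\in\mathfrak S_m$, $\sigma'\in\mathfrak S_n$ let $\sigma\otimes\sigma'\in\mathfrak S_{m+n}$ act as $\sigma$ on the first $m$ elements and as $\sigma'$ on the last $n$; let $c_{m,n}\in\mathfrak S_{m+n}$ send $i$ to $i+n$ if $i\le m$ and to $i-m$ if $i>m$; for $\alpha\in\mathfrak S_n$ and $p\in[n]$ let $\alpha_p\in\mathfrak S_{n-1}$ be the permutation whose word is obtained from the word $\alpha(1)\dots\alpha(n)$ by deleting the letter $p$ and subtracting $1$ from all letters $>p$. A *TraP* is a family $(P(k,l))_{k,l\in\mathbb N_0}$ of $\mathbb K$-vector spaces with: 1. commuting linear actions of $\mathfrak S_l$ on the left and of $\mathfrak S_k$ on the right of $P(k,l)$; 2. bilinear maps $*:P(k,l)\times P(k',l')\to P(k+k',l+l')$ that are associative, have a unit $I_0\in P(0,0)$, and satisfy $(\sigma\cdot p\cdot\tau)*(\sigma'\cdot p'\cdot\tau')=(\sigma\otimes\sigma')\cdot(p*p')\cdot(\tau\otimes\tau')$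 and $c_{l,l'}\cdot(p*p')=(p'*p)\cdot c_{k,k'}$ for all $p\in P(k,l)$, $p'\in P(k',l')$; 3. linear maps $t_{i,j}:P(k,l)\to P(k-1,l-1)$ for $k,l\ge1$, $i\in[k]$, $j\in[l]$ (partial traces), such that (a) for $k,l\ge 2$, $i\in[k]$, $j\in[l]$, $i'\in[k-1]$, $j'\in[l-1]$: $t_{i',j'}\circ t_{i,j}$ equals $t_{i-1,j-1}\circ t_{i',j'}$ if $i'<i,\ j'<j$; $t_{i,j-1}\circ t_{i'+1,j'}$ if $i'\ge i,\ j'<j$; $t_{i-1,j}\circ t_{i',j'+1}$ if $i'<i,\ j'\ge j$; and $t_{i,j}\circ t_{i'+1,j'+1}$ if $i'\ge i,\ j'\ge j$; (b) $t_{i,j}(\sigma\cdot p\cdot\tau)=\sigma_j\cdot t_{\tau(i),\sigma^{-1}(j)}(p)\cdot\tau_{\tau(i)}$; (c) for all $k,l,k',l'\in\mathbb N_0$, $p\in P(k,l)$, $p'\in P(k',l')$: $t_{i,j}(p*p')=t_{i,j}(p)*p'$ if $i\in[k]$, $j\in[l]$, and $t_{k+i,l+j}(p*p')=p*t_{i,j}(p')$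 if $i\in[k']$, $j\in[l']$; (d) there is $I\in P(1,1)$ such that for all $k,l\in\mathbb N_0$ and $p\in P(k,l)$: $t_{1,j}(I*p)=(1,2,\dots,j-1)\cdot p$ for $2\le j\le l+1$; $t_{i,1}(I*p)=p\cdot(1,2,\dots,i-1)^{-1}$ for $2\le i\le k+1$; $t_{k+1,j}(p*I)=(j,j+1,\dots,l)^{-1}\cdot p$ for $1\le j\le l$; $t_{i,l+1}(p*I)=p\cdot(i,i+1,\dots,k)$ for $1\le i\le k$. The units $I_0$ and $I$ are unique. A *morphism of TraPs* $\Phi:P\to Q$ is a family of linear maps $\Phi_{k,l}:P(k,l)\to Q(k,l)$ compatible with $*$, with the actions of the symmetric groups and with the partial traces, and sending the units $I_0$ and $I$ of $P$ to those of $Q$. **Graphs.** A *graph* with $k$ inputs and $l$ outputs consists of finite sets $V$ (vertices), $E$ (internal edges), $\mathcal I$ (input edges), $\mathcal O$ (output edges), $\mathcal{IO}$ (input-output edges), $L$ (loops without endpoints), maps $s:E\sqcup\mathcal O\to V$ (source) and $t:E\sqcup\mathcal I\to V$ (target), and bijections $\alpha:\mathcal I\sqcup\mathcal{IO}\to[k]$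 and $\beta:\mathcal O\sqcup\mathcal{IO}\to[l]$. Isomorphisms are families of six bijections compatible with $s,t,\alpha,\beta$. Let $\mathbf{Gr}^{\circlearrowright}(k,l)$ be the vector space with basis the isomorphism classes of graphs with $k$ inputs and $l$ outputs, with the following operations, extended linearly. $\sigma\cdot G\cdot\tau$ is $G$ with $\alpha,\beta$ replaced by $\tau^{-1}\circ\alpha$, $\sigma\circ\beta$. $G*G'$ is the disjoint union, the inputs and outputs of $G'$ being indexed after those of $G$. $t_{i,j}(G)$ is obtained by gluing the beginning of $e=\alpha^{-1}(i)$ to the end of $f=\beta^{-1}(j)$ and reindexing increasingly the remaining inputs and outputs: $e$ and $f$ are replaced by a new edge, which is internal, from $s(f)$ to $t(e)$, if $e\in\mathcal I$, $f\in\mathcal O$; an output edge with source $s(f)$ and the output index of $e$ if $e\in\mathcal{IO}$, $f\in\mathcal O$; an input edge with target $t(e)$ and the input index of $f$ if $e\in\mathcal I$, $f\in\mathcal{IO}$; an input-output edge with the input index of $f$ and the output index of $e$ if $e\ne f$ are both in $\mathcal{IO}$; a loop if $e=f\in\mathcal{IO}$. $I_0$ is the empty graph and $I$ the graph reduced to one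 input-output edge. Let $G_{k,l}$ be the graph with one vertex, $k$ input edges, $l$ output edges and no other edge. **Theorem.** $\mathbf{Gr}^{\circlearrowright}$ is a TraP, and $\sigma\cdot G_{k,l}\cdot\tau=G_{k,l}$ for all $k,l\in\mathbb N_0$, $\sigma\in\mathfrak S_l$, $\tau\in\mathfrak S_k$. Let $P$ be a TraP and, for all $k,l\in\mathbb N_0$, let $x_{k,l}\in P(k,l)$ be such that $\sigma\cdot x_{k,l}\cdot\tau=x_{k,l}$ for all $\sigma\in\mathfrak S_l$, $\tau\in\mathfrak S_k$. Then there is a unique TraP morphism $\Phi:\mathbf{Gr}^{\circlearrowright}\to P$ with $\Phi(G_{k,l})=x_{k,l}$ for all $k,l\in\mathbb N_0$. In this sense, $\mathbf{Gr}^{\circlearrowright}$ is the free TraP generated by the invariant elements $G_{k,l}$. -/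

import Mathlib

universe u v w

/-! ### Permutations

The set `{1, …, n}` is `Fin n`, whose elements are numbered from `0`: the index `i` of the usual
one-based notation is the element `i - 1`. -/

namespace TraPs

/-- `σ ⊗ σ'`: the permutation `σ` on the first `m` elements, `σ'` on the last `n`. -/
def permTensor {m n : ℕ} (σ : Equiv.Perm (Fin m)) (σ' : Equiv.Perm (Fin n)) :
    Equiv.Perm (Fin (m + n)) :=
  (finSumFinEquiv.symm.trans (Equiv.sumCongr σ σ')).trans finSumFinEquiv

/-- `c_{m,n}`: sends `i` to `i + n` if `i` is among the first `m` elements, and to `i - m`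
otherwise. -/
def blockSwap (m n : ℕ) : Equiv.Perm (Fin (m + n)) :=
  finAddFlip.trans (finCongr (Nat.add_comm n m))

theorem blockSwap_val (m n : ℕ) (i : Fin (m + n)) :
    (blockSwap m n i : ℕ) = if (i : ℕ) < m then (i : ℕ) + n else (i : ℕ) - m := by
  refine Fin.addCases (fun a => ?_) (fun a => ?_) i
  · simp [blockSwap, Nat.add_comm]
  · simp [blockSwap]

/-- An injection of `X'` in `X` whose image is the complement of `x`. -/
structure ComplMap {X : Type u} (X' : Type v) (x : X) where
  ι : X' → X
  injective : Function.Injective ι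
  range : ∀ y, (∃ z, ι z = y) ↔ y ≠ x

/-- Remove `x` from the left summand. -/
def ComplMap.eraseLeft {A : Type u} {B : Type v} (x : A) :
    ComplMap ({a : A // a ≠ x} ⊕ B) (Sum.inl x : A ⊕ B) where
  ι := Sum.elim (fun a => Sum.inl a.1) Sum.inr
  injective := by rintro (⟨a, ha⟩ | a) (⟨b, hb⟩ | b) <;> simp
  range := by rintro (a | a) <;> simp

/-- Remove `x` from the right summand. -/
def ComplMap.eraseRight {A : Type u} {B : Type v} (x : B) :
    ComplMap (A ⊕ {b : B // b ≠ x}) (Sum.inr x : A ⊕ B) where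
  ι := Sum.elim Sum.inl fun b => Sum.inr b.1
  injective := by rintro (a | ⟨a, ha⟩) (b | ⟨b, hb⟩) <;> simp
  range := by rintro (a | a) <;> simp

/-- Remove `x` from the left summand, and move `y` from the right to the left summand, under the
name `none`. -/
def ComplMap.mergeLeft {A : Type u} {B : Type v} (x : A) (y : B) :
    ComplMap (Option {a : A // a ≠ x} ⊕ {b : B // b ≠ y}) (Sum.inl x : A ⊕ B) where
  ι := Sum.elim (fun a => a.elim (Sum.inr y) fun a => Sum.inl a.1) fun b => Sum.inr b.1
  injective := by
    rintro ((_ | ⟨a, ha⟩) | ⟨a, ha⟩) ((_ | ⟨b, hb⟩) | ⟨b, hb⟩) <;> simp <;> grind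
  range := by rintro (a | a) <;> simp [Option.exists]; grind

/-- Remove `x` from the right summand, and rename `y` in the right summand as `none`. -/
def ComplMap.mergeRight {A : Type u} {B : Type v} (x y : B) (hxy : y ≠ x) {p : B → Prop}
    (hp : ∀ b, p b ↔ b ≠ x ∧ b ≠ y) :
    ComplMap (A ⊕ Option {b : B // p b}) (Sum.inr x : A ⊕ B) where
  ι := Sum.elim Sum.inl fun b => b.elim (Sum.inr y) fun b => Sum.inr b.1
  injective := by
    rintro (a | (_ | ⟨a, ha⟩)) (b | (_ | ⟨b, hb⟩)) <;> simp <;> grind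
  range := by rintro (a | a) <;> simp [Option.exists]; grind

/-- Let `α` be an indexation of the set `X` by `Fin (n + 1)`, and let `X'` be identified with the
complement of `x`.  This is the indexation of `X'` by `Fin n` obtained by reindexing increasingly
(the indices greater than `α x` decrease by `1`). -/
noncomputable def removeIndex {X : Type u} {X' : Type v} {n : ℕ} (α : X ≃ Fin (n + 1)) (x : X)
    (m : ComplMap X' x) : X' ≃ Fin n :=
  (Equiv.ofBijective (fun z => (⟨m.ι z, (m.range _).1 ⟨z, rfl⟩⟩ : {y : X // y ≠ x}))
    ⟨fun _ _ h => m.injective (congrArg Subtype.val h),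
      fun y => ((m.range y.1).2 y.2).imp fun _ h => Subtype.ext h⟩).trans
    ((α.subtypeEquiv (q := fun i => i ≠ α x) fun _ => α.injective.ne_iff.symm).trans
      (finSuccAboveEquiv (α x)).symm)

theorem succAbove_removeIndex {X : Type u} {X' : Type v} {n : ℕ} (α : X ≃ Fin (n + 1)) (x : X)
    (m : ComplMap X' x) (z : X') :
    (α x).succAbove (removeIndex α x m z) = α (m.ι z) :=
  congrArg Subtype.val ((finSuccAboveEquiv (α x)).apply_symm_apply
    ⟨α (m.ι z), fun h => (m.range _).1 ⟨z, rfl⟩ (α.injective h)⟩)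

theorem removeIndex_eq {X Y : Type u} {X' Y' : Type v} {n : ℕ}
    {α : X ≃ Fin (n + 1)} {x : X} {m : ComplMap X' x}
    {β : Y ≃ Fin (n + 1)} {y : Y} {m' : ComplMap Y' y} {z : X'} {z' : Y'}
    (h₁ : β y = α x) (h₂ : β (m'.ι z') = α (m.ι z)) :
    removeIndex β y m' z' = removeIndex α x m z := by
  apply Fin.succAbove_right_injective (p := α x)
  rw [succAbove_removeIndex, ← h₁, succAbove_removeIndex, h₂]

/-- The permutation `σ_p` of `n` elements: in the word `σ(1) … σ(n+1)`, the letter `p` is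
suppressed, and `1` is subtracted from all letters greater than `p`. -/
noncomputable def permRemove {n : ℕ} (σ : Equiv.Perm (Fin (n + 1))) (p : Fin (n + 1)) :
    Equiv.Perm (Fin n) :=
  removeIndex σ (σ.symm p) ⟨(σ.symm p).succAbove, Fin.succAbove_right_injective,
    fun _ => Fin.exists_succAbove_eq_iff⟩

theorem succAbove_permRemove {n : ℕ} (σ : Equiv.Perm (Fin (n + 1))) (p : Fin (n + 1)) (a : Fin n) :
    p.succAbove (permRemove σ p a) = σ ((σ.symm p).succAbove a) := by
  have h := succAbove_removeIndex σ (σ.symm p) ⟨(σ.symm p).succAbove,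
    Fin.succAbove_right_injective, fun _ => Fin.exists_succAbove_eq_iff⟩ a
  rwa [Equiv.apply_symm_apply] at h

end TraPs

/-! ### TraPs -/

/-- The operations of a TraP over `𝕂` (without their axioms, which are in `TraPData.IsTraP`). -/
structure TraPData (𝕂 : Type u) [Field 𝕂] where
  /-- the space `P(k,l)` -/
  carrier : ℕ → ℕ → Type v
  [addCommGroup : ∀ k l, AddCommGroup (carrier k l)]
  [module : ∀ k l, Module 𝕂 (carrier k l)]
  /-- the left action `σ · p` -/
  lact : ∀ {k l : ℕ}, Equiv.Perm (Fin l) → carrier k l →ₗ[𝕂] carrier k l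
  /-- the right action; `ract τ p` is `p · τ` -/
  ract : ∀ {k l : ℕ}, Equiv.Perm (Fin k) → carrier k l →ₗ[𝕂] carrier k l
  /-- the horizontal concatenation `p * p'` -/
  hcomp : ∀ {k l k' l' : ℕ},
    carrier k l →ₗ[𝕂] carrier k' l' →ₗ[𝕂] carrier (k + k') (l + l')
  /-- the partial trace `t_{i,j}` -/
  tr : ∀ {k l : ℕ}, Fin (k + 1) → Fin (l + 1) → carrier (k + 1) (l + 1) →ₗ[𝕂] carrier k l
  /-- the unit `I₀` of `*` -/
  unit₀ : carrier 0 0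
  /-- the unit `I` of the partial traces -/
  unit₁ : carrier 1 1

attribute [instance] TraPData.addCommGroup TraPData.module

namespace TraPData

open TraPs

variable {𝕂 : Type u} [Field 𝕂]

/-- The identification of `P(k,l)` with `P(k',l')` when `k = k'` and `l = l'`. -/
def reindex (P : TraPData.{u, v} 𝕂) {k l k' l' : ℕ} (hk : k = k') (hl : l = l')
    (p : P.carrier k l) : P.carrier k' l' :=
  cast (congrArg₂ P.carrier hk hl) p

/-- The axioms of a TraP. -/
structure IsTraP (P : TraPData.{u, v} 𝕂) : Prop where
  -- `P(k,l)` is a bimodule over the symmetric groups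
  one_lact : ∀ {k l : ℕ} (p : P.carrier k l), P.lact 1 p = p
  ract_one : ∀ {k l : ℕ} (p : P.carrier k l), P.ract 1 p = p
  mul_lact : ∀ {k l : ℕ} (σ σ' : Equiv.Perm (Fin l)) (p : P.carrier k l),
    P.lact σ (P.lact σ' p) = P.lact (σ * σ') p
  ract_mul : ∀ {k l : ℕ} (τ τ' : Equiv.Perm (Fin k)) (p : P.carrier k l),
    P.ract τ' (P.ract τ p) = P.ract (τ * τ') p
  lact_ract : ∀ {k l : ℕ} (σ : Equiv.Perm (Fin l)) (τ : Equiv.Perm (Fin k)) (p : P.carrier k l),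
    P.lact σ (P.ract τ p) = P.ract τ (P.lact σ p)
  -- associativity and unit of the horizontal concatenation
  hcomp_assoc : ∀ {k l k' l' k'' l'' : ℕ} (p : P.carrier k l) (p' : P.carrier k' l')
    (p'' : P.carrier k'' l''),
    P.reindex (Nat.add_assoc k k' k'') (Nat.add_assoc l l' l'') (P.hcomp (P.hcomp p p') p'')
      = P.hcomp p (P.hcomp p' p'')
  unit₀_hcomp : ∀ {k l : ℕ} (p : P.carrier k l),
    P.reindex (Nat.zero_add k) (Nat.zero_add l) (P.hcomp P.unit₀ p) = p
  hcomp_unit₀ : ∀ {k l : ℕ} (p : P.carrier k l), P.hcomp p P.unit₀ = p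
  -- compatibility of the horizontal concatenation with the actions
  hcomp_act : ∀ {k l k' l' : ℕ} (p : P.carrier k l) (p' : P.carrier k' l')
    (σ : Equiv.Perm (Fin l)) (τ : Equiv.Perm (Fin k))
    (σ' : Equiv.Perm (Fin l')) (τ' : Equiv.Perm (Fin k')),
    P.hcomp (P.ract τ (P.lact σ p)) (P.ract τ' (P.lact σ' p'))
      = P.ract (permTensor τ τ') (P.lact (permTensor σ σ') (P.hcomp p p'))
  -- commutativity of the horizontal concatenation
  hcomp_comm : ∀ {k l k' l' : ℕ} (p : P.carrier k l) (p' : P.carrier k' l'),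
    P.lact (blockSwap l l') (P.hcomp p p')
      = P.ract (blockSwap k k')
          (P.reindex (Nat.add_comm k' k) (Nat.add_comm l' l) (P.hcomp p' p))
  /- Commutativity of the partial traces.  If `i' < i`, then `i.succAbove i' = i'` and
  `i'.predAbove i = i - 1`; if `i' ≥ i`, then `i.succAbove i' = i' + 1` and `i'.predAbove i = i`. -/
  tr_tr : ∀ {k l : ℕ} (i : Fin (k + 2)) (j : Fin (l + 2)) (i' : Fin (k + 1)) (j' : Fin (l + 1))
    (p : P.carrier (k + 2) (l + 2)),
    P.tr i' j' (P.tr i j p)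
      = P.tr (i'.predAbove i) (j'.predAbove j) (P.tr (i.succAbove i') (j.succAbove j') p)
  /- Compatibility of the partial traces with the actions.  The word of `permRemove σ j` is that of
  `σ` without the letter `j`; the word of `permRemove τ (τ i)` is that of `τ` without its letter
  in position `i`. -/
  tr_act : ∀ {k l : ℕ} (i : Fin (k + 1)) (j : Fin (l + 1)) (σ : Equiv.Perm (Fin (l + 1)))
    (τ : Equiv.Perm (Fin (k + 1))) (p : P.carrier (k + 1) (l + 1)),
    P.tr i j (P.ract τ (P.lact σ p))
      = P.ract (permRemove τ (τ i)) (P.lact (permRemove σ j) (P.tr (τ i) (σ⁻¹ j) p))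
  -- compatibility of the partial traces with the horizontal concatenation
  tr_hcomp_left : ∀ {k l k' l' : ℕ} (i : Fin (k + 1)) (j : Fin (l + 1))
    (p : P.carrier (k + 1) (l + 1)) (p' : P.carrier k' l'),
    P.tr ⟨i, by omega⟩ ⟨j, by omega⟩
        (P.reindex (Nat.add_right_comm k 1 k') (Nat.add_right_comm l 1 l') (P.hcomp p p'))
      = P.hcomp (P.tr i j p) p'
  tr_hcomp_right : ∀ {k l k' l' : ℕ} (i : Fin (k' + 1)) (j : Fin (l' + 1))
    (p : P.carrier k l) (p' : P.carrier (k' + 1) (l' + 1)),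
    P.tr (k := k + k') (l := l + l') (Fin.natAdd k i) (Fin.natAdd l j) (P.hcomp p p')
      = P.hcomp p (P.tr i j p')
  /- The unit of the partial traces.  `Fin.cycleRange j` is the cycle `(0, 1, …, j)` and
  `Fin.cycleIcc j (Fin.last l)` is the cycle `(j, j + 1, …, l)`. -/
  tr_zero_succ_unit₁_hcomp : ∀ {k l : ℕ} (j : Fin l) (p : P.carrier k l),
    P.tr 0 j.succ (P.reindex (Nat.add_comm 1 k) (Nat.add_comm 1 l) (P.hcomp P.unit₁ p))
      = P.lact j.cycleRange p
  tr_succ_zero_unit₁_hcomp : ∀ {k l : ℕ} (i : Fin k) (p : P.carrier k l),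
    P.tr i.succ 0 (P.reindex (Nat.add_comm 1 k) (Nat.add_comm 1 l) (P.hcomp P.unit₁ p))
      = P.ract (i.cycleRange)⁻¹ p
  tr_last_castSucc_hcomp_unit₁ : ∀ {k l : ℕ} (j : Fin (l + 1)) (p : P.carrier k (l + 1)),
    P.tr (Fin.last k) j.castSucc (P.hcomp p P.unit₁)
      = P.lact (Fin.cycleIcc j (Fin.last l))⁻¹ p
  tr_castSucc_last_hcomp_unit₁ : ∀ {k l : ℕ} (i : Fin (k + 1)) (p : P.carrier (k + 1) l),
    P.tr i.castSucc (Fin.last l) (P.hcomp p P.unit₁)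
      = P.ract (Fin.cycleIcc i (Fin.last k)) p

end TraPData

/-- Morphisms of TraPs. -/
@[ext]
structure TraPHom {𝕂 : Type u} [Field 𝕂] (P : TraPData.{u, v} 𝕂) (Q : TraPData.{u, w} 𝕂) where
  toFun : ∀ k l : ℕ, P.carrier k l →ₗ[𝕂] Q.carrier k l
  map_hcomp : ∀ {k l k' l' : ℕ} (p : P.carrier k l) (p' : P.carrier k' l'),
    toFun (k + k') (l + l') (P.hcomp p p') = Q.hcomp (toFun k l p) (toFun k' l' p')
  map_lact : ∀ {k l : ℕ} (σ : Equiv.Perm (Fin l)) (p : P.carrier k l),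
    toFun k l (P.lact σ p) = Q.lact σ (toFun k l p)
  map_ract : ∀ {k l : ℕ} (τ : Equiv.Perm (Fin k)) (p : P.carrier k l),
    toFun k l (P.ract τ p) = Q.ract τ (toFun k l p)
  map_tr : ∀ {k l : ℕ} (i : Fin (k + 1)) (j : Fin (l + 1)) (p : P.carrier (k + 1) (l + 1)),
    toFun k l (P.tr i j p) = Q.tr i j (toFun (k + 1) (l + 1) p)
  map_unit₀ : toFun 0 0 P.unit₀ = Q.unit₀
  map_unit₁ : toFun 1 1 P.unit₁ = Q.unit₁

/-! ### Graphs -/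

/-- Graphs with `k` inputs and `l` outputs. -/
structure InOutGraph (k l : ℕ) where
  /-- vertices -/
  V : Type
  /-- internal edges -/
  E : Type
  /-- input edges -/
  I : Type
  /-- output edges -/
  O : Type
  /-- input-output edges -/
  InOut : Type
  /-- loops (edges without endpoints) -/
  L : Type
  finite_V : Finite V
  finite_E : Finite E
  finite_I : Finite I
  finite_O : Finite O
  finite_InOut : Finite InOut
  finite_L : Finite L
  /-- source map -/
  s : E ⊕ O → V
  /-- target map -/
  t : E ⊕ I → V
  /-- indexation of the inputs -/
  α : I ⊕ InOut ≃ Fin k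
  /-- indexation of the outputs -/
  β : O ⊕ InOut ≃ Fin l

namespace InOutGraph

open TraPs Function

attribute [instance] finite_V finite_E finite_I finite_O finite_InOut finite_L

variable {k l k' l' : ℕ}

/-- Isomorphisms of graphs. -/
structure Iso (G H : InOutGraph k l) where
  V : G.V ≃ H.V
  E : G.E ≃ H.E
  I : G.I ≃ H.I
  O : G.O ≃ H.O
  InOut : G.InOut ≃ H.InOut
  L : G.L ≃ H.L
  s_E : ∀ e, H.s (Sum.inl (E e)) = V (G.s (Sum.inl e))
  s_O : ∀ e, H.s (Sum.inr (O e)) = V (G.s (Sum.inr e))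
  t_E : ∀ e, H.t (Sum.inl (E e)) = V (G.t (Sum.inl e))
  t_I : ∀ e, H.t (Sum.inr (I e)) = V (G.t (Sum.inr e))
  α_I : ∀ e, H.α (Sum.inl (I e)) = G.α (Sum.inl e)
  α_InOut : ∀ e, H.α (Sum.inr (InOut e)) = G.α (Sum.inr e)
  β_O : ∀ e, H.β (Sum.inl (O e)) = G.β (Sum.inl e)
  β_InOut : ∀ e, H.β (Sum.inr (InOut e)) = G.β (Sum.inr e)

/-- The identity. -/
def Iso.refl (G : InOutGraph k l) : Iso G G where
  V := .refl _
  E := .refl _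
  I := .refl _
  O := .refl _
  InOut := .refl _
  L := .refl _
  s_E _ := rfl
  s_O _ := rfl
  t_E _ := rfl
  t_I _ := rfl
  α_I _ := rfl
  α_InOut _ := rfl
  β_O _ := rfl
  β_InOut _ := rfl

/-- The inverse of an isomorphism. -/
def Iso.symm {G H : InOutGraph k l} (f : Iso G H) : Iso H G where
  V := f.V.symm
  E := f.E.symm
  I := f.I.symm
  O := f.O.symm
  InOut := f.InOut.symm
  L := f.L.symm
  s_E e := by rw [Equiv.eq_symm_apply, ← f.s_E, Equiv.apply_symm_apply]
  s_O e := by rw [Equiv.eq_symm_apply, ← f.s_O, Equiv.apply_symm_apply]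
  t_E e := by rw [Equiv.eq_symm_apply, ← f.t_E, Equiv.apply_symm_apply]
  t_I e := by rw [Equiv.eq_symm_apply, ← f.t_I, Equiv.apply_symm_apply]
  α_I e := by rw [← f.α_I, Equiv.apply_symm_apply]
  α_InOut e := by rw [← f.α_InOut, Equiv.apply_symm_apply]
  β_O e := by rw [← f.β_O, Equiv.apply_symm_apply]
  β_InOut e := by rw [← f.β_InOut, Equiv.apply_symm_apply]

/-- The composite of two isomorphisms. -/
def Iso.trans {G H K : InOutGraph k l} (f : Iso G H) (g : Iso H K) : Iso G K where
  V := f.V.trans g.V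
  E := f.E.trans g.E
  I := f.I.trans g.I
  O := f.O.trans g.O
  InOut := f.InOut.trans g.InOut
  L := f.L.trans g.L
  s_E e := by simp [g.s_E, f.s_E]
  s_O e := by simp [g.s_O, f.s_O]
  t_E e := by simp [g.t_E, f.t_E]
  t_I e := by simp [g.t_I, f.t_I]
  α_I e := by simp [g.α_I, f.α_I]
  α_InOut e := by simp [g.α_InOut, f.α_InOut]
  β_O e := by simp [g.β_O, f.β_O]
  β_InOut e := by simp [g.β_InOut, f.β_InOut]

instance setoid (k l : ℕ) : Setoid (InOutGraph k l) where
  r G H := Nonempty (Iso G H)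
  iseqv := ⟨fun G => ⟨Iso.refl G⟩, fun ⟨f⟩ => ⟨f.symm⟩, fun ⟨f⟩ ⟨g⟩ => ⟨f.trans g⟩⟩

/-- The graph `σ · G`. -/
def lact (σ : Equiv.Perm (Fin l)) (G : InOutGraph k l) : InOutGraph k l :=
  { G with β := G.β.trans σ }

/-- The graph `G · τ`. -/
def ract (τ : Equiv.Perm (Fin k)) (G : InOutGraph k l) : InOutGraph k l :=
  { G with α := G.α.trans τ.symm }

/-- The horizontal concatenation `G * H`: the disjoint union, where the inputs and outputs of `H`
are indexed after those of `G`. -/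
def hcomp (G : InOutGraph k l) (H : InOutGraph k' l') : InOutGraph (k + k') (l + l') where
  V := G.V ⊕ H.V
  E := G.E ⊕ H.E
  I := G.I ⊕ H.I
  O := G.O ⊕ H.O
  InOut := G.InOut ⊕ H.InOut
  L := G.L ⊕ H.L
  finite_V := inferInstance
  finite_E := inferInstance
  finite_I := inferInstance
  finite_O := inferInstance
  finite_InOut := inferInstance
  finite_L := inferInstance
  s := Sum.elim (Sum.map (fun e => G.s (Sum.inl e)) fun e => H.s (Sum.inl e))
    (Sum.map (fun e => G.s (Sum.inr e)) fun e => H.s (Sum.inr e))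
  t := Sum.elim (Sum.map (fun e => G.t (Sum.inl e)) fun e => H.t (Sum.inl e))
    (Sum.map (fun e => G.t (Sum.inr e)) fun e => H.t (Sum.inr e))
  α := (Equiv.sumSumSumComm G.I H.I G.InOut H.InOut).trans
    ((Equiv.sumCongr G.α H.α).trans finSumFinEquiv)
  β := (Equiv.sumSumSumComm G.O H.O G.InOut H.InOut).trans
    ((Equiv.sumCongr G.β H.β).trans finSumFinEquiv)

/-- The graph without vertices and edges. -/
def unit₀ : InOutGraph 0 0 where
  V := Empty
  E := Empty
  I := Empty
  O := Empty
  InOut := Empty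
  L := Empty
  finite_V := inferInstance
  finite_E := inferInstance
  finite_I := inferInstance
  finite_O := inferInstance
  finite_InOut := inferInstance
  finite_L := inferInstance
  s := Sum.elim Empty.elim Empty.elim
  t := Sum.elim Empty.elim Empty.elim
  α := Equiv.equivOfIsEmpty _ _
  β := Equiv.equivOfIsEmpty _ _

/-- The graph reduced to a single input-output edge. -/
def unit₁ : InOutGraph 1 1 where
  V := Empty
  E := Empty
  I := Empty
  O := Empty
  InOut := Fin 1
  L := Empty
  finite_V := inferInstance
  finite_E := inferInstance
  finite_I := inferInstance
  finite_O := inferInstance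
  finite_InOut := inferInstance
  finite_L := inferInstance
  s := Sum.elim Empty.elim Empty.elim
  t := Sum.elim Empty.elim Empty.elim
  α := Equiv.emptySum _ _
  β := Equiv.emptySum _ _

/-- The graph `G_{k,l}`: one vertex, `k` input edges, `l` output edges, and no other edge. -/
def corolla (k l : ℕ) : InOutGraph k l where
  V := Unit
  E := Empty
  I := Fin k
  O := Fin l
  InOut := Empty
  L := Empty
  finite_V := inferInstance
  finite_E := inferInstance
  finite_I := inferInstance
  finite_O := inferInstance
  finite_InOut := inferInstance
  finite_L := inferInstance
  s := fun _ => ()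
  t := fun _ => ()
  α := Equiv.sumEmpty _ _
  β := Equiv.sumEmpty _ _

/-! Gluing the beginning of an edge `e`, which has an input, to the end of an edge `f`, which has an
output.  The remaining inputs and outputs are reindexed increasingly. -/

/-- Case of an input edge `e` and an output edge `f`: the new edge `none` is an internal edge, from
the source of `f` to the target of `e`. -/
noncomputable def glueEdge (G : InOutGraph (k + 1) (l + 1)) (e : G.I) (f : G.O) :
    InOutGraph k l where
  V := G.V
  E := Option G.E
  I := {a : G.I // a ≠ e}
  O := {a : G.O // a ≠ f}
  InOut := G.InOut
  L := G.L
  finite_V := inferInstance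
  finite_E := inferInstance
  finite_I := inferInstance
  finite_O := inferInstance
  finite_InOut := inferInstance
  finite_L := inferInstance
  s := Sum.elim
    (fun a => a.elim (G.s (Sum.inr f)) fun b => G.s (Sum.inl b)) fun a => G.s (Sum.inr a.1)
  t := Sum.elim
    (fun a => a.elim (G.t (Sum.inr e)) fun b => G.t (Sum.inl b)) fun a => G.t (Sum.inr a.1)
  α := removeIndex G.α (Sum.inl e) (.eraseLeft e)
  β := removeIndex G.β (Sum.inl f) (.eraseLeft f)

/-- Case of an input-output edge `e` and an output edge `f`: the new edge `none` is an output edge,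
with the source of `f` and the output index of `e`. -/
noncomputable def glueOutput (G : InOutGraph (k + 1) (l + 1)) (e : G.InOut) (f : G.O) :
    InOutGraph k l where
  V := G.V
  E := G.E
  I := G.I
  O := Option {a : G.O // a ≠ f}
  InOut := {a : G.InOut // a ≠ e}
  L := G.L
  finite_V := inferInstance
  finite_E := inferInstance
  finite_I := inferInstance
  finite_O := inferInstance
  finite_InOut := inferInstance
  finite_L := inferInstance
  s := Sum.elim (fun a => G.s (Sum.inl a))
    fun a => a.elim (G.s (Sum.inr f)) fun b => G.s (Sum.inr b.1)
  t := G.t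
  α := removeIndex G.α (Sum.inr e) (.eraseRight e)
  β := removeIndex G.β (Sum.inl f) (.mergeLeft f e)

/-- Case of an input edge `e` and an input-output edge `f`: the new edge `none` is an input edge,
with the target of `e` and the input index of `f`. -/
noncomputable def glueInput (G : InOutGraph (k + 1) (l + 1)) (e : G.I) (f : G.InOut) :
    InOutGraph k l where
  V := G.V
  E := G.E
  I := Option {a : G.I // a ≠ e}
  O := G.O
  InOut := {a : G.InOut // a ≠ f}
  L := G.L
  finite_V := inferInstance
  finite_E := inferInstance
  finite_I := inferInstance
  finite_O := inferInstance
  finite_InOut := inferInstance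
  finite_L := inferInstance
  s := G.s
  t := Sum.elim (fun a => G.t (Sum.inl a))
    fun a => a.elim (G.t (Sum.inr e)) fun b => G.t (Sum.inr b.1)
  α := removeIndex G.α (Sum.inl e) (.mergeLeft e f)
  β := removeIndex G.β (Sum.inr f) (.eraseRight f)

/-- Case of a single input-output edge `e`: the new edge `none` is a loop. -/
noncomputable def glueLoop (G : InOutGraph (k + 1) (l + 1)) (e : G.InOut) :
    InOutGraph k l where
  V := G.V
  E := G.E
  I := G.I
  O := G.O
  InOut := {a : G.InOut // a ≠ e}
  L := Option G.L
  finite_V := inferInstance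
  finite_E := inferInstance
  finite_I := inferInstance
  finite_O := inferInstance
  finite_InOut := inferInstance
  finite_L := inferInstance
  s := G.s
  t := G.t
  α := removeIndex G.α (Sum.inr e) (.eraseRight e)
  β := removeIndex G.β (Sum.inr e) (.eraseRight e)

/-- Case of two distinct input-output edges `e` and `f`: the new edge `none` is an input-output edge,
with the input index of `f` and the output index of `e`. -/
noncomputable def glueInOut (G : InOutGraph (k + 1) (l + 1)) (e f : G.InOut) (h : e ≠ f) :
    InOutGraph k l where
  V := G.V
  E := G.E
  I := G.I
  O := G.O
  InOut := Option {a : G.InOut // a ≠ e ∧ a ≠ f}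
  L := G.L
  finite_V := inferInstance
  finite_E := inferInstance
  finite_I := inferInstance
  finite_O := inferInstance
  finite_InOut := inferInstance
  finite_L := inferInstance
  s := G.s
  t := G.t
  α := removeIndex G.α (Sum.inr e) (.mergeRight e f (Ne.symm h) fun _ => Iff.rfl)
  β := removeIndex G.β (Sum.inr f) (.mergeRight f e h fun _ => and_comm)

open Classical in
/-- The graph obtained from `G` by gluing the beginning of the edge `e` to the end of the edge
`f`. -/
noncomputable def glue (G : InOutGraph (k + 1) (l + 1)) :
    G.I ⊕ G.InOut → G.O ⊕ G.InOut → InOutGraph k l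
  | Sum.inl e, Sum.inl f => G.glueEdge e f
  | Sum.inr e, Sum.inl f => G.glueOutput e f
  | Sum.inl e, Sum.inr f => G.glueInput e f
  | Sum.inr e, Sum.inr f => if h : e = f then G.glueLoop e else G.glueInOut e f h

/-- The partial trace `t_{i,j}(G)`. -/
noncomputable def tr (i : Fin (k + 1)) (j : Fin (l + 1)) (G : InOutGraph (k + 1) (l + 1)) :
    InOutGraph k l :=
  G.glue (G.α.symm i) (G.β.symm j)

/-! The operations are compatible with isomorphisms. -/

theorem lact_congr (σ : Equiv.Perm (Fin l)) {G H : InOutGraph k l} (h : G ≈ H) :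
    G.lact σ ≈ H.lact σ := by
  obtain ⟨f⟩ := h
  exact ⟨{ f with
    β_O := fun e => congrArg σ (f.β_O e)
    β_InOut := fun e => congrArg σ (f.β_InOut e) }⟩

theorem ract_congr (τ : Equiv.Perm (Fin k)) {G H : InOutGraph k l} (h : G ≈ H) :
    G.ract τ ≈ H.ract τ := by
  obtain ⟨f⟩ := h
  exact ⟨{ f with
    α_I := fun e => congrArg τ.symm (f.α_I e)
    α_InOut := fun e => congrArg τ.symm (f.α_InOut e) }⟩

theorem hcomp_congr {G H : InOutGraph k l} {G' H' : InOutGraph k' l'} (h : G ≈ H) (h' : G' ≈ H') :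
    G.hcomp G' ≈ H.hcomp H' := by
  obtain ⟨f⟩ := h
  obtain ⟨f'⟩ := h'
  refine ⟨{
    V := Equiv.sumCongr f.V f'.V
    E := Equiv.sumCongr f.E f'.E
    I := Equiv.sumCongr f.I f'.I
    O := Equiv.sumCongr f.O f'.O
    InOut := Equiv.sumCongr f.InOut f'.InOut
    L := Equiv.sumCongr f.L f'.L
    s_E := ?_
    s_O := ?_
    t_E := ?_
    t_I := ?_
    α_I := ?_
    α_InOut := ?_
    β_O := ?_
    β_InOut := ?_ }⟩
  · rintro (e | e)
    · exact congrArg Sum.inl (f.s_E e)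
    · exact congrArg Sum.inr (f'.s_E e)
  · rintro (e | e)
    · exact congrArg Sum.inl (f.s_O e)
    · exact congrArg Sum.inr (f'.s_O e)
  · rintro (e | e)
    · exact congrArg Sum.inl (f.t_E e)
    · exact congrArg Sum.inr (f'.t_E e)
  · rintro (e | e)
    · exact congrArg Sum.inl (f.t_I e)
    · exact congrArg Sum.inr (f'.t_I e)
  · rintro (e | e)
    · exact congrArg (Fin.castAdd k') (f.α_I e)
    · exact congrArg (Fin.natAdd k) (f'.α_I e)
  · rintro (e | e)
    · exact congrArg (Fin.castAdd k') (f.α_InOut e)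
    · exact congrArg (Fin.natAdd k) (f'.α_InOut e)
  · rintro (e | e)
    · exact congrArg (Fin.castAdd l') (f.β_O e)
    · exact congrArg (Fin.natAdd l) (f'.β_O e)
  · rintro (e | e)
    · exact congrArg (Fin.castAdd l') (f.β_InOut e)
    · exact congrArg (Fin.natAdd l) (f'.β_InOut e)

theorem glue_congr {G H : InOutGraph (k + 1) (l + 1)} (f : Iso G H) (x : G.I ⊕ G.InOut)
    (y : G.O ⊕ G.InOut) :
    G.glue x y ≈ H.glue (Sum.map f.I f.InOut x) (Sum.map f.O f.InOut y) := by
  rcases x with e | e <;> rcases y with g | g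
  · simp only [Sum.map, glue, glueEdge]
    refine ⟨{
      V := f.V
      E := f.E.optionCongr
      I := f.I.subtypeEquiv fun a => by simp
      O := f.O.subtypeEquiv fun a => by simp
      InOut := f.InOut
      L := f.L
      s_E := ?_
      s_O := fun a => f.s_O a.1
      t_E := ?_
      t_I := fun a => f.t_I a.1
      α_I := fun a => removeIndex_eq (f.α_I e) (f.α_I a.1)
      α_InOut := fun a => removeIndex_eq (f.α_I e) (f.α_InOut a)
      β_O := fun a => removeIndex_eq (f.β_O g) (f.β_O a.1)
      β_InOut := fun a => removeIndex_eq (f.β_O g) (f.β_InOut a) }⟩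
    · rintro (_ | a)
      · exact f.s_O g
      · exact f.s_E a
    · rintro (_ | a)
      · exact f.t_I e
      · exact f.t_E a
  · simp only [Sum.map, glue, glueInput]
    refine ⟨{
      V := f.V
      E := f.E
      I := (f.I.subtypeEquiv fun a => by simp).optionCongr
      O := f.O
      InOut := f.InOut.subtypeEquiv fun a => by simp
      L := f.L
      s_E := f.s_E
      s_O := f.s_O
      t_E := f.t_E
      t_I := ?_
      α_I := ?_
      α_InOut := fun a => removeIndex_eq (f.α_I e) (f.α_InOut a.1)
      β_O := fun a => removeIndex_eq (f.β_InOut g) (f.β_O a)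
      β_InOut := fun a => removeIndex_eq (f.β_InOut g) (f.β_InOut a.1) }⟩
    · rintro (_ | a)
      · exact f.t_I e
      · exact f.t_I a.1
    · rintro (_ | a)
      · exact removeIndex_eq (f.α_I e) (f.α_InOut g)
      · exact removeIndex_eq (f.α_I e) (f.α_I a.1)
  · simp only [Sum.map, glue, glueOutput]
    refine ⟨{
      V := f.V
      E := f.E
      I := f.I
      O := (f.O.subtypeEquiv fun a => by simp).optionCongr
      InOut := f.InOut.subtypeEquiv fun a => by simp
      L := f.L
      s_E := f.s_E
      s_O := ?_
      t_E := f.t_E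
      t_I := f.t_I
      α_I := fun a => removeIndex_eq (f.α_InOut e) (f.α_I a)
      α_InOut := fun a => removeIndex_eq (f.α_InOut e) (f.α_InOut a.1)
      β_O := ?_
      β_InOut := fun a => removeIndex_eq (f.β_O g) (f.β_InOut a.1) }⟩
    · rintro (_ | a)
      · exact f.s_O g
      · exact f.s_O a.1
    · rintro (_ | a)
      · exact removeIndex_eq (f.β_O g) (f.β_InOut e)
      · exact removeIndex_eq (f.β_O g) (f.β_O a.1)
  · by_cases h : e = g
    · subst h
      simp only [Sum.map_inr, glue, dite_true, glueLoop]
      exact ⟨{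
        V := f.V
        E := f.E
        I := f.I
        O := f.O
        InOut := f.InOut.subtypeEquiv fun a => by simp
        L := f.L.optionCongr
        s_E := f.s_E
        s_O := f.s_O
        t_E := f.t_E
        t_I := f.t_I
        α_I := fun a => removeIndex_eq (f.α_InOut e) (f.α_I a)
        α_InOut := fun a => removeIndex_eq (f.α_InOut e) (f.α_InOut a.1)
        β_O := fun a => removeIndex_eq (f.β_InOut e) (f.β_O a)
        β_InOut := fun a => removeIndex_eq (f.β_InOut e) (f.β_InOut a.1) }⟩
    · have h' : f.InOut e ≠ f.InOut g := f.InOut.injective.ne h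
      simp only [Sum.map_inr, glue, dif_neg h, dif_neg h', glueInOut]
      refine ⟨{
        V := f.V
        E := f.E
        I := f.I
        O := f.O
        InOut := (f.InOut.subtypeEquiv fun a => by simp).optionCongr
        L := f.L
        s_E := f.s_E
        s_O := f.s_O
        t_E := f.t_E
        t_I := f.t_I
        α_I := fun a => removeIndex_eq (f.α_InOut e) (f.α_I a)
        α_InOut := ?_
        β_O := fun a => removeIndex_eq (f.β_InOut g) (f.β_O a)
        β_InOut := ?_ }⟩
      · rintro (_ | a)
        · exact removeIndex_eq (f.α_InOut e) (f.α_InOut g)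
        · exact removeIndex_eq (f.α_InOut e) (f.α_InOut a.1)
      · rintro (_ | a)
        · exact removeIndex_eq (f.β_InOut g) (f.β_InOut e)
        · exact removeIndex_eq (f.β_InOut g) (f.β_InOut a.1)

theorem tr_congr (i : Fin (k + 1)) (j : Fin (l + 1)) {G H : InOutGraph (k + 1) (l + 1)}
    (h : G ≈ H) : G.tr i j ≈ H.tr i j := by
  obtain ⟨f⟩ := h
  have h₁ : Sum.map f.I f.InOut (G.α.symm i) = H.α.symm i := by
    rw [Equiv.eq_symm_apply]
    conv_rhs => rw [← G.α.apply_symm_apply i]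
    rcases G.α.symm i with e | e
    · exact f.α_I e
    · exact f.α_InOut e
  have h₂ : Sum.map f.O f.InOut (G.β.symm j) = H.β.symm j := by
    rw [Equiv.eq_symm_apply]
    conv_rhs => rw [← G.β.apply_symm_apply j]
    rcases G.β.symm j with e | e
    · exact f.β_O e
    · exact f.β_InOut e
  have := glue_congr f (G.α.symm i) (G.β.symm j)
  rwa [h₁, h₂] at this

end InOutGraph

/-- Isomorphism classes of graphs with `k` inputs and `l` outputs. -/
abbrev InOutGraphClass (k l : ℕ) : Type 1 := Quotient (InOutGraph.setoid k l)

namespace InOutGraphClass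

variable {k l k' l' : ℕ}

/-- The action `σ · G` on isomorphism classes. -/
def lact (σ : Equiv.Perm (Fin l)) : InOutGraphClass k l → InOutGraphClass k l :=
  Quotient.map (InOutGraph.lact σ) fun _ _ h => InOutGraph.lact_congr σ h

/-- The action `G · τ` on isomorphism classes. -/
def ract (τ : Equiv.Perm (Fin k)) : InOutGraphClass k l → InOutGraphClass k l :=
  Quotient.map (InOutGraph.ract τ) fun _ _ h => InOutGraph.ract_congr τ h

/-- The horizontal concatenation on isomorphism classes. -/
def hcomp : InOutGraphClass k l → InOutGraphClass k' l' → InOutGraphClass (k + k') (l + l') :=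
  Quotient.map₂ InOutGraph.hcomp fun _ _ h _ _ h' => InOutGraph.hcomp_congr h h'

/-- The partial trace on isomorphism classes. -/
noncomputable def tr (i : Fin (k + 1)) (j : Fin (l + 1)) :
    InOutGraphClass (k + 1) (l + 1) → InOutGraphClass k l :=
  Quotient.map (InOutGraph.tr i j) fun _ _ h => InOutGraph.tr_congr i j h

end InOutGraphClass

/-- `Gr^↻`: the space `Gr^↻(k,l)` has the isomorphism classes of graphs with `k` inputs and `l`
outputs as a basis, and all operations are extended linearly. -/
noncomputable def graphTraP (𝕂 : Type u) [Field 𝕂] : TraPData.{u, max 1 u} 𝕂 where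
  carrier k l := InOutGraphClass k l →₀ 𝕂
  lact σ := Finsupp.lmapDomain 𝕂 𝕂 (InOutGraphClass.lact σ)
  ract τ := Finsupp.lmapDomain 𝕂 𝕂 (InOutGraphClass.ract τ)
  hcomp := Finsupp.linearCombination 𝕂
    fun G => Finsupp.lmapDomain 𝕂 𝕂 (InOutGraphClass.hcomp G)
  tr i j := Finsupp.lmapDomain 𝕂 𝕂 (InOutGraphClass.tr i j)
  unit₀ := Finsupp.single (Quotient.mk _ InOutGraph.unit₀) 1
  unit₁ := Finsupp.single (Quotient.mk _ InOutGraph.unit₁) 1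

/-- The class of `G_{k,l}` as an element of `Gr^↻(k,l)`. -/
noncomputable def graphTraP.corolla (𝕂 : Type u) [Field 𝕂] (k l : ℕ) :
    (graphTraP 𝕂).carrier k l :=
  Finsupp.single (Quotient.mk _ (InOutGraph.corolla k l)) (1 : 𝕂)

/-! A graph amounts to vertices with input and output ports, a bijection (the wiring) from vertex
outputs and graph inputs to vertex inputs and graph outputs, and a number of loops. In this form
(`PortGraph`) the five cases of the partial trace are a single operation: the start `i` and the end
`j` are removed and wires are composed through them (`traceWire`), while a wire from `i` to `j`
closes into a loop (`traceLoop`). The translation `toPort` reflects isomorphisms (`equiv_of_toPort`)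
and commutes with gluing (`toPort_tr`), so the axioms on partial traces become statements about
bijections; the main ones are `traceWire_traceWire` and `traceLoop_traceWire`. The other axioms come
from evident isomorphisms of graphs.

Existence of the morphism: the image of a graph has to be the product of the elements `x k l`
attached to its vertices, contracted along its edges, and it must not depend on the order in which
vertices and edges are taken. To get rid of the orders, inputs and outputs are labelled and elements
are taken up to renumbering (`Labelled`). The product is then commutative, the contraction of a pair
of labels that occur once each is well defined (`Contract.unique`, from `tr_act`), and contractions
commute (`Contract.commute`, from `tr_tr`). A graph gives an uncontracted product `unwired`, with
one isolated edge for each graph input and one factor for each vertex, in which every output bears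
the name of the point it is wired to. Contracting every vertex input with the output of the same
name leaves an element labelled by the inputs and outputs of the graph, that is, an element of
`P(k,l)`: the value `val`. Invariance of `x k l` is what makes the factor of a vertex independent of
an enumeration of its ports (`star_eq`). Compatibility with traces (`val_tr`) rests on
`contract_assemble`: gluing in the graph is one more contraction in the product.

Uniqueness: every graph is generated by the corollas (`generated`). Cut the internal edges, which
are partial traces; what remains is, up to renumbering, a disjoint union of corollas, loops and
input-output edges, and a loop is the trace of `I`. -/

namespace TraPs

/-! ### Wirings and the gluing of a start to an end. -/

variable {X Y : Type*} {k l : ℕ}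

/-- The inclusion of `X ⊔ [k]` in `X ⊔ [k + 1]` which avoids `i`. -/
def skip (i : Fin (k + 1)) : X ⊕ Fin k → X ⊕ Fin (k + 1) := Sum.map id i.succAbove

@[simp] theorem skip_inl (i : Fin (k + 1)) (x : X) : skip i (Sum.inl x) = Sum.inl x := rfl

@[simp] theorem skip_inr (i : Fin (k + 1)) (a : Fin k) :
    skip (X := X) i (Sum.inr a) = Sum.inr (i.succAbove a) := rfl

theorem skip_injective (i : Fin (k + 1)) : Function.Injective (skip (X := X) i) :=
  Sum.map_injective.2 ⟨Function.injective_id, Fin.succAbove_right_injective⟩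

theorem skip_ne (i : Fin (k + 1)) (x : X ⊕ Fin k) : skip i x ≠ Sum.inr i := by
  rcases x with x | x <;> simp [Fin.succAbove_ne]

theorem skip_removeIndex {X' : Type*} {Z : Type u} {Z' : Type v} (α : Z ≃ Fin (k + 1)) (x : Z)
    (m : ComplMap Z' x) (z : Z') :
    skip (X := X') (α x) (Sum.inr (removeIndex α x m z)) = Sum.inr (α (m.ι z)) := by
  rw [skip_inr, succAbove_removeIndex]

/-- The elements of `X ⊔ [k + 1]` are `i` and those of the image of `skip i`. -/
noncomputable def skipEquiv (i : Fin (k + 1)) : Option (X ⊕ Fin k) ≃ X ⊕ Fin (k + 1) :=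
  Equiv.ofBijective (fun x => x.elim (Sum.inr i) (skip i)) <| by
    constructor
    · rintro (_ | x) (_ | y) h
      · rfl
      · exact (skip_ne i y h.symm).elim
      · exact (skip_ne i x h).elim
      · exact congrArg some (skip_injective i h)
    · rintro (x | x)
      · exact ⟨some (Sum.inl x), rfl⟩
      · rcases eq_or_ne x i with rfl | h
        · exact ⟨none, rfl⟩
        · obtain ⟨z, rfl⟩ := Fin.exists_succAbove_eq h
          exact ⟨some (Sum.inr z), rfl⟩

theorem skipEquiv_none (i : Fin (k + 1)) : skipEquiv (X := X) i none = Sum.inr i := rfl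

theorem skipEquiv_some (i : Fin (k + 1)) (x : X ⊕ Fin k) : skipEquiv i (some x) = skip i x := rfl

theorem exists_skip_eq {i : Fin (k + 1)} {y : X ⊕ Fin (k + 1)} (h : y ≠ Sum.inr i) :
    ∃ x, skip i x = y := by
  obtain ⟨_ | x, rfl⟩ := (skipEquiv i).surjective y
  · exact (h rfl).elim
  · exact ⟨x, rfl⟩

/-- The start `i` is glued to the end `j`. -/
noncomputable def traceWire (i : Fin (k + 1)) (j : Fin (l + 1)) (φ : X ⊕ Fin (k + 1) ≃ Y ⊕ Fin (l + 1)) :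
    X ⊕ Fin k ≃ Y ⊕ Fin l :=
  Equiv.removeNone (((skipEquiv i).trans φ).trans (skipEquiv j).symm)

/-- `Equiv.removeNone` bypasses the removed point: a wire that arrives at `j` continues along the
wire leaving `i`. A wire from `i` to `j` never meets this case, as `φ` is injective and `skip`
avoids `i`; it disappears from the wiring and is only counted by `traceLoop`. -/
theorem skip_traceWire_of_eq {i : Fin (k + 1)} {j : Fin (l + 1)}
    {φ : X ⊕ Fin (k + 1) ≃ Y ⊕ Fin (l + 1)} {x : X ⊕ Fin k} (h : φ (skip i x) = Sum.inr j) :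
    skip j (traceWire i j φ x) = φ (Sum.inr i) := by
  have := Equiv.removeNone_none (((skipEquiv i).trans φ).trans (skipEquiv j).symm) (x := x)
    (by simp [Equiv.symm_apply_eq, skipEquiv_none, skipEquiv_some, h])
  rw [← skipEquiv_some, traceWire, this]
  simp [skipEquiv_none]

theorem skip_traceWire_of_ne {i : Fin (k + 1)} {j : Fin (l + 1)}
    {φ : X ⊕ Fin (k + 1) ≃ Y ⊕ Fin (l + 1)} {x : X ⊕ Fin k} (h : φ (skip i x) ≠ Sum.inr j) :
    skip j (traceWire i j φ x) = φ (skip i x) := by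
  obtain ⟨y, hy⟩ := exists_skip_eq h
  have := Equiv.removeNone_some (((skipEquiv i).trans φ).trans (skipEquiv j).symm) (x := x)
    ⟨y, by simpa [Equiv.symm_apply_eq, skipEquiv_some] using hy.symm⟩
  rw [← skipEquiv_some, traceWire, this]
  simp [skipEquiv_some]

theorem traceWire_eq_of_eq {i : Fin (k + 1)} {j : Fin (l + 1)}
    {φ : X ⊕ Fin (k + 1) ≃ Y ⊕ Fin (l + 1)} {x : X ⊕ Fin k} {y : Y ⊕ Fin l}
    (h : φ (skip i x) = Sum.inr j) (h' : φ (Sum.inr i) = skip j y) : traceWire i j φ x = y :=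
  skip_injective j (by rw [skip_traceWire_of_eq h, h'])

theorem traceWire_eq_of_skip {i : Fin (k + 1)} {j : Fin (l + 1)}
    {φ : X ⊕ Fin (k + 1) ≃ Y ⊕ Fin (l + 1)} {x : X ⊕ Fin k} {y : Y ⊕ Fin l}
    (h : φ (skip i x) = skip j y) : traceWire i j φ x = y :=
  skip_injective j (by rw [skip_traceWire_of_ne (h ▸ skip_ne j y), h])

theorem skip_map (f : X → Y) (i : Fin (k + 1)) (x : X ⊕ Fin k) :
    skip i (Sum.map f id x) = Sum.map f id (skip i x) := by
  rcases x with x | x <;> rfl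

theorem traceWire_map {X' Y' : Type*} {φ : X ⊕ Fin (k + 1) ≃ Y ⊕ Fin (l + 1)}
    {ψ : X' ⊕ Fin (k + 1) ≃ Y' ⊕ Fin (l + 1)} {f : X → X'} {g : Y → Y'}
    (h : ∀ x, ψ (Sum.map f id x) = Sum.map g id (φ x)) (i : Fin (k + 1)) (j : Fin (l + 1))
    (x : X ⊕ Fin k) :
    traceWire i j ψ (Sum.map f id x) = Sum.map g id (traceWire i j φ x) := by
  by_cases h' : φ (skip i x) = Sum.inr j
  · apply traceWire_eq_of_eq
    · rw [skip_map, h, h']; rfl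
    · rw [skip_map, skip_traceWire_of_eq h', ← h]; rfl
  · apply traceWire_eq_of_skip
    rw [skip_map, h, skip_map, skip_traceWire_of_ne h']

/-- The disjoint union of two sets of ends. -/
def sumEquiv (X Y : Type*) (m n : ℕ) : (X ⊕ Fin m) ⊕ (Y ⊕ Fin n) ≃ (X ⊕ Y) ⊕ Fin (m + n) :=
  (Equiv.sumSumSumComm X (Fin m) Y (Fin n)).trans (Equiv.sumCongr (Equiv.refl _) finSumFinEquiv)

theorem sumEquiv_inl {m n : ℕ} (x : X ⊕ Fin m) :
    sumEquiv X Y m n (Sum.inl x) = Sum.map Sum.inl (Fin.castAdd n) x := by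
  rcases x with x | x <;> rfl

theorem sumEquiv_inr {m n : ℕ} (x : Y ⊕ Fin n) :
    sumEquiv X Y m n (Sum.inr x) = Sum.map Sum.inr (Fin.natAdd m) x := by
  rcases x with x | x <;> rfl

/-- The two cases have the shape of the arguments in `sumWire_inl` and `sumWire_inr`, so that a
vertex port and a numbered end of the same summand are treated together. -/
theorem sum_ind {m n : ℕ} {p : (X ⊕ Y) ⊕ Fin (m + n) → Prop}
    (h : ∀ x, p (Sum.map Sum.inl (Fin.castAdd n) x))
    (h' : ∀ x, p (Sum.map Sum.inr (Fin.natAdd m) x)) (x) : p x := by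
  obtain ⟨x | x, rfl⟩ := (sumEquiv X Y m n).surjective x
  · rw [sumEquiv_inl]; exact h x
  · rw [sumEquiv_inr]; exact h' x

/-- The disjoint union of two wirings. -/
def sumWire {X' Y' : Type*} {k' l' : ℕ} (φ : X ⊕ Fin k ≃ Y ⊕ Fin l)
    (ψ : X' ⊕ Fin k' ≃ Y' ⊕ Fin l') : (X ⊕ X') ⊕ Fin (k + k') ≃ (Y ⊕ Y') ⊕ Fin (l + l') :=
  ((sumEquiv _ _ k k').symm.trans (Equiv.sumCongr φ ψ)).trans (sumEquiv _ _ l l')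

theorem sumWire_inl {X' Y' : Type*} {k' l' : ℕ} (φ : X ⊕ Fin k ≃ Y ⊕ Fin l)
    (ψ : X' ⊕ Fin k' ≃ Y' ⊕ Fin l') (x : X ⊕ Fin k) :
    sumWire φ ψ (Sum.map Sum.inl (Fin.castAdd k') x)
      = Sum.map Sum.inl (Fin.castAdd l') (φ x) := by
  rw [← sumEquiv_inl, ← sumEquiv_inl]
  simp [sumWire]

theorem sumWire_inr {X' Y' : Type*} {k' l' : ℕ} (φ : X ⊕ Fin k ≃ Y ⊕ Fin l)
    (ψ : X' ⊕ Fin k' ≃ Y' ⊕ Fin l') (x : X' ⊕ Fin k') :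
    sumWire φ ψ (Sum.map Sum.inr (Fin.natAdd k) x)
      = Sum.map Sum.inr (Fin.natAdd l) (ψ x) := by
  rw [← sumEquiv_inr, ← sumEquiv_inr]
  simp [sumWire]

theorem sumWire_map {X' Y' X₁ Y₁ X₁' Y₁' : Type*} {k' l' : ℕ} {φ : X ⊕ Fin k ≃ Y ⊕ Fin l}
    {ψ : X' ⊕ Fin k' ≃ Y' ⊕ Fin l'} {φ₁ : X₁ ⊕ Fin k ≃ Y₁ ⊕ Fin l}
    {ψ₁ : X₁' ⊕ Fin k' ≃ Y₁' ⊕ Fin l'} {f : X → X₁} {g : Y → Y₁} {f' : X' → X₁'} {g' : Y' → Y₁'}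
    (h : ∀ x, φ₁ (Sum.map f id x) = Sum.map g id (φ x))
    (h' : ∀ x, ψ₁ (Sum.map f' id x) = Sum.map g' id (ψ x)) (x : (X ⊕ X') ⊕ Fin (k + k')) :
    sumWire φ₁ ψ₁ (Sum.map (Sum.map f f') id x)
      = Sum.map (Sum.map g g') id (sumWire φ ψ x) := by
  induction x using sum_ind with
  | h x =>
    have h₁ := sumWire_inl φ₁ ψ₁ (Sum.map f id x)
    rw [sumWire_inl]
    rw [h] at h₁
    simpa [Sum.map_map, Function.comp_def] using h₁
  | h' x =>
    have h₁ := sumWire_inr φ₁ ψ₁ (Sum.map f' id x)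
    rw [sumWire_inr]
    rw [h'] at h₁
    simpa [Sum.map_map, Function.comp_def] using h₁

/-- The number of loops which appear when the start `i` is glued to the end `j`. -/
noncomputable def traceLoop (i : Fin (k + 1)) (j : Fin (l + 1))
    (φ : X ⊕ Fin (k + 1) ≃ Y ⊕ Fin (l + 1)) : ℕ :=
  (φ (Sum.inr i)).elim (fun _ => 0) fun j' => if j' = j then 1 else 0

theorem traceLoop_of_eq {i : Fin (k + 1)} {j : Fin (l + 1)}
    {φ : X ⊕ Fin (k + 1) ≃ Y ⊕ Fin (l + 1)} (h : φ (Sum.inr i) = Sum.inr j) :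
    traceLoop i j φ = 1 := by
  simp [traceLoop, h]

theorem traceLoop_of_ne {i : Fin (k + 1)} {j : Fin (l + 1)}
    {φ : X ⊕ Fin (k + 1) ≃ Y ⊕ Fin (l + 1)} (h : φ (Sum.inr i) ≠ Sum.inr j) :
    traceLoop i j φ = 0 := by
  unfold traceLoop
  rcases h' : φ (Sum.inr i) with y | y
  · rfl
  · rw [h'] at h
    simpa using h

theorem traceLoop_map {X' Y' : Type*} {φ : X ⊕ Fin (k + 1) ≃ Y ⊕ Fin (l + 1)}
    {ψ : X' ⊕ Fin (k + 1) ≃ Y' ⊕ Fin (l + 1)} {f : X → X'} {g : Y → Y'}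
    (h : ∀ x, ψ (Sum.map f id x) = Sum.map g id (φ x)) (i : Fin (k + 1)) (j : Fin (l + 1)) :
    traceLoop i j ψ = traceLoop i j φ := by
  have h' := h (Sum.inr i)
  simp only [Sum.map_inr, id_eq] at h'
  rw [traceLoop, h', traceLoop]
  rcases φ (Sum.inr i) with y | y <;> rfl

end TraPs

/-! ### Graphs described by ports. -/

/-- A graph with `k` inputs and `l` outputs, described by the inputs `A` and the outputs `B` of its
vertices: each output of a vertex or input of the graph is linked by `wire` to an input of a vertex
or an output of the graph. -/
structure PortGraph (k l : ℕ) where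
  V : Type
  A : Type
  B : Type
  [fintypeV : Fintype V]
  [fintypeA : Fintype A]
  [fintypeB : Fintype B]
  target : A → V
  source : B → V
  wire : B ⊕ Fin k ≃ A ⊕ Fin l
  loops : ℕ

namespace PortGraph

open TraPs

attribute [instance] fintypeV fintypeA fintypeB

variable {k l k' l' : ℕ}

/-- Isomorphisms. -/
structure Iso (G H : PortGraph k l) where
  V : G.V ≃ H.V
  A : G.A ≃ H.A
  B : G.B ≃ H.B
  target : ∀ a, H.target (A a) = V (G.target a)
  source : ∀ b, H.source (B b) = V (G.source b)
  wire : ∀ x, H.wire (Sum.map B id x) = Sum.map A id (G.wire x)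
  loops : H.loops = G.loops

def Iso.symm {G H : PortGraph k l} (f : Iso G H) : Iso H G where
  V := f.V.symm
  A := f.A.symm
  B := f.B.symm
  target a := by rw [Equiv.eq_symm_apply, ← f.target, Equiv.apply_symm_apply]
  source a := by rw [Equiv.eq_symm_apply, ← f.source, Equiv.apply_symm_apply]
  wire x := by
    have h := f.wire (Sum.map f.B.symm id x)
    simp only [Sum.map_map, Equiv.self_comp_symm, Function.comp_id, Sum.map_id_id, id_eq] at h
    rw [h, Sum.map_map]
    simp
  loops := f.loops.symm

def Iso.trans {G H K : PortGraph k l} (f : Iso G H) (g : Iso H K) : Iso G K where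
  V := f.V.trans g.V
  A := f.A.trans g.A
  B := f.B.trans g.B
  target a := by simp [g.target, f.target]
  source a := by simp [g.source, f.source]
  wire x := by
    have h := g.wire (Sum.map f.B id x)
    rw [f.wire, Sum.map_map, Sum.map_map] at h
    simpa using h
  loops := g.loops.trans f.loops

def lact (σ : Equiv.Perm (Fin l)) (G : PortGraph k l) : PortGraph k l :=
  { G with wire := G.wire.trans (Equiv.sumCongr (Equiv.refl _) σ) }

def ract (τ : Equiv.Perm (Fin k)) (G : PortGraph k l) : PortGraph k l :=
  { G with wire := (Equiv.sumCongr (Equiv.refl _) τ).trans G.wire }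

/-- Renumbering along equalities. -/
def cast (hk : k = k') (hl : l = l') (G : PortGraph k l) : PortGraph k' l' :=
  { G with
    wire := ((Equiv.sumCongr (Equiv.refl _) (finCongr hk.symm)).trans G.wire).trans
      (Equiv.sumCongr (Equiv.refl _) (finCongr hl)) }

/-- The disjoint union. -/
def hcomp (G : PortGraph k l) (H : PortGraph k' l') : PortGraph (k + k') (l + l') where
  V := G.V ⊕ H.V
  A := G.A ⊕ H.A
  B := G.B ⊕ H.B
  target := Sum.map G.target H.target
  source := Sum.map G.source H.source
  wire := sumWire G.wire H.wire
  loops := G.loops + H.loops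

/-- The start `i` is glued to the end `j`. -/
noncomputable def tr (i : Fin (k + 1)) (j : Fin (l + 1)) (G : PortGraph (k + 1) (l + 1)) :
    PortGraph k l :=
  { G with
    wire := traceWire i j G.wire
    loops := G.loops + traceLoop i j G.wire }

def Iso.tr {G H : PortGraph (k + 1) (l + 1)} (f : Iso G H) (i : Fin (k + 1)) (j : Fin (l + 1)) :
    Iso (G.tr i j) (H.tr i j) where
  V := f.V
  A := f.A
  B := f.B
  target := f.target
  source := f.source
  wire := traceWire_map f.wire i j
  loops := congrArg₂ (· + ·) f.loops (traceLoop_map f.wire i j)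

def Iso.hcomp {G H : PortGraph k l} (f : Iso G H) {G' H' : PortGraph k' l'} (f' : Iso G' H') :
    Iso (G.hcomp G') (H.hcomp H') where
  V := Equiv.sumCongr f.V f'.V
  A := Equiv.sumCongr f.A f'.A
  B := Equiv.sumCongr f.B f'.B
  target := by
    rintro (a | a)
    exacts [congrArg Sum.inl (f.target a), congrArg Sum.inr (f'.target a)]
  source := by
    rintro (a | a)
    exacts [congrArg Sum.inl (f.source a), congrArg Sum.inr (f'.source a)]
  wire := sumWire_map f.wire f'.wire
  loops := congrArg₂ (· + ·) f.loops f'.loops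

def Iso.cast (hk : k = k') (hl : l = l') {G H : PortGraph k l} (f : Iso G H) :
    Iso (G.cast hk hl) (H.cast hk hl) where
  V := f.V
  A := f.A
  B := f.B
  target := f.target
  source := f.source
  wire x := by
    subst hk hl
    have h := f.wire x
    rcases x with x | x <;> simp [PortGraph.cast] <;> exact h
  loops := f.loops

end PortGraph

/-- A bijection between disjoint unions which respects the summands. -/
theorem Equiv.exists_sumCongr {X Y X' Y' : Type*} (f : X ⊕ Y ≃ X' ⊕ Y')
    (h : ∀ x, ∃ x', f (Sum.inl x) = Sum.inl x') (h' : ∀ y, ∃ y', f (Sum.inr y) = Sum.inr y') :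
    ∃ (g : X ≃ X') (g' : Y ≃ Y'), (∀ x, f (Sum.inl x) = Sum.inl (g x)) ∧
      ∀ y, f (Sum.inr y) = Sum.inr (g' y) := by
  choose g hg using h
  choose g' hg' using h'
  refine ⟨Equiv.ofBijective g ⟨fun a b hab => ?_, fun x' => ?_⟩,
    Equiv.ofBijective g' ⟨fun a b hab => ?_, fun x' => ?_⟩, hg, hg'⟩
  · exact Sum.inl_injective (f.injective (by rw [hg, hg, hab]))
  · obtain ⟨x | x, hx⟩ := f.surjective (Sum.inl x')
    · exact ⟨x, Sum.inl_injective (by rw [← hg, hx])⟩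
    · rw [hg'] at hx; cases hx
  · exact Sum.inr_injective (f.injective (by rw [hg', hg', hab]))
  · obtain ⟨x | x, hx⟩ := f.surjective (Sum.inr x')
    · rw [hg] at hx; cases hx
    · exact ⟨x, Sum.inr_injective (by rw [← hg', hx])⟩

/-! ### From graphs to port graphs. -/

namespace InOutGraph

open TraPs

variable {k l k' l' : ℕ}

/-- The wiring of a graph. -/
def wire (G : InOutGraph k l) : (G.E ⊕ G.O) ⊕ Fin k ≃ (G.E ⊕ G.I) ⊕ Fin l :=
  ((Equiv.sumCongr (Equiv.refl _) G.α.symm).trans (Equiv.sumSumSumComm G.E G.O G.I G.InOut)).trans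
    (Equiv.sumCongr (Equiv.refl _) G.β)

/-- An internal edge is a port twice, as an output and as an input of vertices, and the wiring joins
these two occurrences. The four kinds of edges thus correspond to the four combinations of
extremities: vertex or numbered point at the start, vertex or numbered point at the end. -/
theorem wire_E (G : InOutGraph k l) (e : G.E) :
    G.wire (Sum.inl (Sum.inl e)) = Sum.inl (Sum.inl e) := rfl

theorem wire_O (G : InOutGraph k l) (e : G.O) :
    G.wire (Sum.inl (Sum.inr e)) = Sum.inr (G.β (Sum.inl e)) := rfl

theorem wire_I (G : InOutGraph k l) (e : G.I) :
    G.wire (Sum.inr (G.α (Sum.inl e))) = Sum.inl (Sum.inr e) := by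
  simp [wire]

theorem wire_InOut (G : InOutGraph k l) (e : G.InOut) :
    G.wire (Sum.inr (G.α (Sum.inr e))) = Sum.inr (G.β (Sum.inr e)) := by
  simp [wire]

theorem start_ind {G : InOutGraph k l} {p : (G.E ⊕ G.O) ⊕ Fin k → Prop}
    (hE : ∀ e, p (Sum.inl (Sum.inl e))) (hO : ∀ e, p (Sum.inl (Sum.inr e)))
    (hI : ∀ e, p (Sum.inr (G.α (Sum.inl e)))) (hJ : ∀ e, p (Sum.inr (G.α (Sum.inr e)))) (x) :
    p x := by
  rcases x with (e | e) | i
  · exact hE e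
  · exact hO e
  · obtain ⟨e | e, rfl⟩ := G.α.surjective i
    exacts [hI e, hJ e]

/-- The description of a graph by its ports. -/
noncomputable def toPort (G : InOutGraph k l) : PortGraph k l :=
  letI := Fintype.ofFinite G.V
  letI := Fintype.ofFinite G.E
  letI := Fintype.ofFinite G.I
  letI := Fintype.ofFinite G.O
  { V := G.V
    A := G.E ⊕ G.I
    B := G.E ⊕ G.O
    target := G.t
    source := G.s
    wire := G.wire
    loops := Nat.card G.L }

/-- Isomorphic graphs have isomorphic descriptions. -/
def Iso.toPort {G H : InOutGraph k l} (f : Iso G H) : PortGraph.Iso G.toPort H.toPort where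
  V := f.V
  A := Equiv.sumCongr f.E f.I
  B := Equiv.sumCongr f.E f.O
  target := by
    rintro (e | e)
    exacts [f.t_E e, f.t_I e]
  source := by
    rintro (e | e)
    exacts [f.s_E e, f.s_O e]
  wire x := by
    change H.wire (Sum.map (Equiv.sumCongr f.E f.O) id x)
      = Sum.map (Equiv.sumCongr f.E f.I) id (G.wire x)
    induction x using start_ind with
    | hE e => rfl
    | hO e => exact congrArg Sum.inr (f.β_O e)
    | hI e =>
      rw [wire_I, Sum.map_inr, id, ← f.α_I, wire_I]; rfl
    | hJ e =>
      rw [wire_InOut, Sum.map_inr, id, ← f.α_InOut, wire_InOut, f.β_InOut]; rfl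
  loops := (Nat.card_congr f.L).symm

/-- Graphs with isomorphic descriptions are isomorphic. -/
theorem equiv_of_toPort {G H : InOutGraph k l} (f : PortGraph.Iso G.toPort H.toPort) : G ≈ H := by
  obtain ⟨fV, fA, fB, ht, hs, hw, hL⟩ := f
  change G.E ⊕ G.I ≃ H.E ⊕ H.I at fA
  change G.E ⊕ G.O ≃ H.E ⊕ H.O at fB
  change G.V ≃ H.V at fV
  change ∀ a, H.t (fA a) = fV (G.t a) at ht
  change ∀ a, H.s (fB a) = fV (G.s a) at hs
  change ∀ x : (G.E ⊕ G.O) ⊕ Fin k, H.wire (Sum.map fB id x) = Sum.map fA id (G.wire x) at hw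
  -- Loops carry no structure, so their number determines them up to isomorphism.
  obtain ⟨fL⟩ : Nonempty (G.L ≃ H.L) := Finite.card_eq.1 hL.symm
  -- The kind of an edge can be read off the extremities of its wire, so `fA` and `fB` respect the
  -- decompositions of the ports into internal edges and others.
  have hE : ∀ e, ∃ e', fB (Sum.inl e) = Sum.inl e' ∧ fA (Sum.inl e) = Sum.inl e' := by
    intro e
    have h := hw (Sum.inl (Sum.inl e))
    rw [wire_E, Sum.map_inl] at h
    rcases h' : fB (Sum.inl e) with e' | e' <;> rw [h'] at h
    · exact ⟨e', rfl, (Sum.inl_injective h).symm⟩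
    · cases h
  have hO : ∀ e, ∃ e', fB (Sum.inr e) = Sum.inr e' := by
    intro e
    have h := hw (Sum.inl (Sum.inr e))
    rw [wire_O, Sum.map_inl] at h
    rcases h' : fB (Sum.inr e) with e' | e' <;> rw [h'] at h
    · cases h
    · exact ⟨e', rfl⟩
  have hI : ∀ e, ∃ e', H.α (Sum.inl e') = G.α (Sum.inl e) ∧ fA (Sum.inr e) = Sum.inr e' := by
    intro e
    have h := hw (Sum.inr (G.α (Sum.inl e)))
    rw [wire_I, Sum.map_inr] at h
    obtain ⟨e' | e', h'⟩ := H.α.surjective (G.α (Sum.inl e))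
    · rw [id, ← h', wire_I] at h
      exact ⟨e', h', (Sum.inl_injective h).symm⟩
    · rw [id, ← h', wire_InOut] at h
      cases h
  have hJ : ∀ e, ∃ e', H.α (Sum.inr e') = G.α (Sum.inr e) ∧
      H.β (Sum.inr e') = G.β (Sum.inr e) := by
    intro e
    have h := hw (Sum.inr (G.α (Sum.inr e)))
    rw [wire_InOut, Sum.map_inr] at h
    obtain ⟨e' | e', h'⟩ := H.α.surjective (G.α (Sum.inr e))
    · rw [id, ← h', wire_I] at h
      cases h
    · rw [id, ← h', wire_InOut] at h
      exact ⟨e', h', Sum.inr_injective h⟩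
  obtain ⟨gE, gO, hgE, hgO⟩ := fB.exists_sumCongr (fun e => (hE e).imp fun _ h => h.1) hO
  obtain ⟨gE', gI, hgE', hgI⟩ := fA.exists_sumCongr (fun e => (hE e).imp fun _ h => h.2)
    fun e => (hI e).imp fun _ h => h.2
  -- Both `fA` and `fB` induce a bijection of the internal edges; the two agree because a wire joins
  -- the two occurrences of the same edge.
  have hEE : ∀ e, gE' e = gE e := fun e => by
    obtain ⟨e', h₁, h₂⟩ := hE e
    rw [hgE] at h₁
    rw [hgE'] at h₂
    rw [Sum.inl_injective h₁, Sum.inl_injective h₂]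
  -- Input-output edges are not ports of vertices: their bijection is recovered from the numbering
  -- of the inputs.
  obtain ⟨_, gJ, -, hgJ⟩ := (G.α.trans H.α.symm).exists_sumCongr
    (fun e => (hI e).imp fun e' h => by simp [← h.1]) (fun e => (hJ e).imp fun e' h => by simp [← h.1])
  have hgJ' : ∀ e, H.α (Sum.inr (gJ e)) = G.α (Sum.inr e) := fun e => by simp [← hgJ]
  exact ⟨{
    V := fV
    E := gE
    I := gI
    O := gO
    InOut := gJ
    L := fL
    s_E := fun e => by rw [← hgE, hs]
    s_O := fun e => by rw [← hgO, hs]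
    t_E := fun e => by rw [← hEE, ← hgE', ht]
    t_I := fun e => by rw [← hgI, ht]
    α_I := fun e => by
      obtain ⟨e', h₁, h₂⟩ := hI e
      rw [hgI] at h₂
      rw [Sum.inr_injective h₂, h₁]
    α_InOut := hgJ'
    β_O := fun e => by
      have h := hw (Sum.inl (Sum.inr e))
      rw [wire_O, Sum.map_inl, hgO, wire_O] at h
      exact Sum.inr_injective h
    β_InOut := fun e => by
      obtain ⟨e', h₁, h₂⟩ := hJ e
      rw [← hgJ'] at h₁
      rw [← Sum.inr_injective (H.α.injective h₁), h₂] }⟩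

/-- Renumbering along equalities. -/
def cast (hk : k = k') (hl : l = l') (G : InOutGraph k l) : InOutGraph k' l' :=
  { G with
    α := G.α.trans (finCongr hk)
    β := G.β.trans (finCongr hl) }

def toPort_cast (hk : k = k') (hl : l = l') (G : InOutGraph k l) :
    PortGraph.Iso (G.cast hk hl).toPort (G.toPort.cast hk hl) where
  V := Equiv.refl _
  A := Equiv.refl _
  B := Equiv.refl _
  target _ := rfl
  source _ := rfl
  wire x := by
    subst hk hl
    rcases x with (x | x) | x <;> rfl
  loops := rfl

def toPort_lact (σ : Equiv.Perm (Fin l)) (G : InOutGraph k l) :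
    PortGraph.Iso (G.lact σ).toPort (G.toPort.lact σ) where
  V := Equiv.refl _
  A := Equiv.refl _
  B := Equiv.refl _
  target _ := rfl
  source _ := rfl
  wire := by
    suffices h : ∀ x : (G.E ⊕ G.O) ⊕ Fin k,
        Sum.map id σ (G.wire (Sum.map id id x)) = Sum.map id id ((G.lact σ).wire x) from h
    intro x
    rw [Sum.map_id_id, id_eq, Sum.map_id_id, id_eq]
    induction x using start_ind (G := G) with
    | hE e => rfl
    | hO e => rfl
    | hI e => rw [wire_I]; exact ((G.lact σ).wire_I e).symm
    | hJ e => rw [wire_InOut]; exact ((G.lact σ).wire_InOut e).symm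
  loops := rfl

def toPort_ract (τ : Equiv.Perm (Fin k)) (G : InOutGraph k l) :
    PortGraph.Iso (G.ract τ).toPort (G.toPort.ract τ) where
  V := Equiv.refl _
  A := Equiv.refl _
  B := Equiv.refl _
  target _ := rfl
  source _ := rfl
  wire := by
    suffices h : ∀ x : (G.E ⊕ G.O) ⊕ Fin k,
        G.wire (Sum.map id τ (Sum.map id id x)) = Sum.map id id ((G.ract τ).wire x) from h
    intro x
    rw [Sum.map_id_id, id_eq, Sum.map_id_id, id_eq]
    rcases x with x | x <;> rfl
  loops := rfl

/-- The ports of the disjoint union are grouped by kind of edge first, those of the union of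
descriptions by graph first; the isomorphism exchanges the two groupings. -/
noncomputable def toPort_hcomp (G : InOutGraph k l) (H : InOutGraph k' l') :
    PortGraph.Iso (G.hcomp H).toPort (G.toPort.hcomp H.toPort) where
  V := Equiv.refl _
  A := Equiv.sumSumSumComm _ _ _ _
  B := Equiv.sumSumSumComm _ _ _ _
  target := by rintro ((a | a) | (a | a)) <;> rfl
  source := by rintro ((a | a) | (a | a)) <;> rfl
  wire x := by
    change sumWire G.wire H.wire (Sum.map (Equiv.sumSumSumComm _ _ _ _) id x)
      = Sum.map (Equiv.sumSumSumComm _ _ _ _) id ((G.hcomp H).wire x)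
    induction x using start_ind with
    | hE e =>
      rcases e with e | e
      · exact sumWire_inl G.wire H.wire (Sum.inl (Sum.inl e))
      · exact sumWire_inr G.wire H.wire (Sum.inl (Sum.inl e))
    | hO e =>
      rcases e with e | e
      · exact sumWire_inl G.wire H.wire (Sum.inl (Sum.inr e))
      · exact sumWire_inr G.wire H.wire (Sum.inl (Sum.inr e))
    | hI e =>
      rw [wire_I]
      rcases e with e | e
      · refine (sumWire_inl G.wire H.wire (Sum.inr (G.α (Sum.inl e)))).trans ?_
        rw [wire_I]; rfl
      · refine (sumWire_inr G.wire H.wire (Sum.inr (H.α (Sum.inl e)))).trans ?_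
        rw [wire_I]; rfl
    | hJ e =>
      rw [wire_InOut]
      rcases e with e | e
      · refine (sumWire_inl G.wire H.wire (Sum.inr (G.α (Sum.inr e)))).trans ?_
        rw [wire_InOut]; rfl
      · refine (sumWire_inr G.wire H.wire (Sum.inr (H.α (Sum.inr e)))).trans ?_
        rw [wire_InOut]; rfl
  loops := Nat.card_sum.symm

end InOutGraph

/-! ### The five gluings of edges as one gluing of wirings. -/

namespace TraPs

/-- Name an element `y` of `Y` as a new element of `X`. -/
noncomputable def moveNone {X Y : Type*} (y : Y) : Option X ⊕ {b : Y // b ≠ y} ≃ X ⊕ Y :=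
  Equiv.ofBijective (Sum.elim (fun a => a.elim (Sum.inr y) Sum.inl) fun b => Sum.inr b.1) <| by
    constructor
    · rintro ((_ | a) | ⟨a, ha⟩) ((_ | b) | ⟨b, hb⟩) <;> simp <;> grind
    · rintro (a | a)
      · exact ⟨Sum.inl (some a), rfl⟩
      · rcases eq_or_ne a y with rfl | h
        · exact ⟨Sum.inl none, rfl⟩
        · exact ⟨Sum.inr ⟨a, h⟩, rfl⟩

end TraPs

namespace InOutGraph

open TraPs

variable {k l k' l' : ℕ}

/-- No port is created or lost: `e` and `f` become the two occurrences of the new internal edge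
`none`. Only the wire leaving `f` is rerouted; it reached the glued end and now goes to the target
of `e`. -/
theorem toPort_glueEdge (G : InOutGraph (k + 1) (l + 1)) (e : G.I) (f : G.O) :
    Nonempty (PortGraph.Iso (G.glueEdge e f).toPort
      (G.toPort.tr (G.α (Sum.inl e)) (G.β (Sum.inl f)))) := by
  have hw : ∀ x, traceWire (G.α (Sum.inl e)) (G.β (Sum.inl f)) G.wire
      (Sum.map (moveNone f) id x) = Sum.map (moveNone e) id ((G.glueEdge e f).wire x) := by
    intro x
    induction x using start_ind (G := G.glueEdge e f) with
    | hE a =>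
      rw [wire_E]
      rcases a with _ | a
      · exact traceWire_eq_of_eq rfl (G.wire_I e)
      · exact traceWire_eq_of_skip rfl
    | hO a =>
      exact traceWire_eq_of_skip
        (skip_removeIndex G.β (Sum.inl f) (.eraseLeft f) (Sum.inl a)).symm
    | hI a =>
      rw [wire_I]
      exact traceWire_eq_of_skip ((congrArg G.wire (skip_removeIndex G.α (Sum.inl e)
        (.eraseLeft e) (Sum.inl a))).trans (G.wire_I a.1))
    | hJ a =>
      rw [wire_InOut]
      refine traceWire_eq_of_skip ?_
      exact (congrArg G.wire (skip_removeIndex G.α (Sum.inl e) (.eraseLeft e) (Sum.inr a))).trans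
        ((G.wire_InOut a).trans
          (skip_removeIndex G.β (Sum.inl f) (.eraseLeft f) (Sum.inr a)).symm)
  exact ⟨{
    V := Equiv.refl _
    A := moveNone e
    B := moveNone f
    target := by rintro ((_ | a) | a) <;> rfl
    source := by rintro ((_ | a) | a) <;> rfl
    wire := hw
    loops := (congrArg (Nat.card G.L + ·)
      (traceLoop_of_ne fun h =>
      Sum.inl_ne_inr ((G.wire_I e).symm.trans h))) }⟩

open Classical in
-- The new input edge `none` takes over the port of `e`. The rerouted wire is the one starting at
-- the input of `f`.
theorem toPort_glueInput (G : InOutGraph (k + 1) (l + 1)) (e : G.I) (f : G.InOut) :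
    Nonempty (PortGraph.Iso (G.glueInput e f).toPort
      (G.toPort.tr (G.α (Sum.inl e)) (G.β (Sum.inr f)))) := by
  have hw : ∀ x, traceWire (G.α (Sum.inl e)) (G.β (Sum.inr f)) G.wire (Sum.map (Equiv.refl _) id x)
      = Sum.map (Equiv.sumCongr (Equiv.refl _) (Equiv.optionSubtypeNe e)) id
        ((G.glueInput e f).wire x) := by
    intro x
    induction x using start_ind (G := G.glueInput e f) with
    | hE a => exact traceWire_eq_of_skip rfl
    | hO a =>
      exact traceWire_eq_of_skip
        (skip_removeIndex G.β (Sum.inr f) (.eraseRight f) (Sum.inl a)).symm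
    | hI a =>
      rw [wire_I]
      rcases a with _ | a
      · refine traceWire_eq_of_eq ?_ (G.wire_I e)
        · exact (congrArg G.wire (skip_removeIndex G.α (Sum.inl e) (.mergeLeft e f)
            (Sum.inl none))).trans (G.wire_InOut f)
      · refine traceWire_eq_of_skip ?_
        exact (congrArg G.wire (skip_removeIndex G.α (Sum.inl e) (.mergeLeft e f)
            (Sum.inl (some a)))).trans (G.wire_I a.1)
    | hJ a =>
      rw [wire_InOut]
      exact traceWire_eq_of_skip ((congrArg G.wire (skip_removeIndex G.α (Sum.inl e)
        (.mergeLeft e f) (Sum.inr a))).trans ((G.wire_InOut a.1).trans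
          (skip_removeIndex G.β (Sum.inr f) (.eraseRight f) (Sum.inr a)).symm))
  exact ⟨{
    V := Equiv.refl _
    A := Equiv.sumCongr (Equiv.refl _) (Equiv.optionSubtypeNe e)
    B := Equiv.refl _
    target := by rintro (a | _ | a) <;> rfl
    source _ := rfl
    wire := hw
    loops := (congrArg (Nat.card G.L + ·)
      (traceLoop_of_ne fun h =>
      Sum.inl_ne_inr ((G.wire_I e).symm.trans h))) }⟩

open Classical in
-- The new output edge `none` takes over the port of `f`, whose wire continues to the output index
-- of `e`.
theorem toPort_glueOutput (G : InOutGraph (k + 1) (l + 1)) (e : G.InOut) (f : G.O) :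
    Nonempty (PortGraph.Iso (G.glueOutput e f).toPort
      (G.toPort.tr (G.α (Sum.inr e)) (G.β (Sum.inl f)))) := by
  have hw : ∀ x, traceWire (G.α (Sum.inr e)) (G.β (Sum.inl f)) G.wire
      (Sum.map (Equiv.sumCongr (Equiv.refl _) (Equiv.optionSubtypeNe f)) id x)
      = Sum.map (Equiv.refl _) id ((G.glueOutput e f).wire x) := by
    intro x
    induction x using start_ind (G := G.glueOutput e f) with
    | hE a => exact traceWire_eq_of_skip rfl
    | hO a =>
      rcases a with _ | a
      · exact traceWire_eq_of_eq rfl ((G.wire_InOut e).trans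
          (skip_removeIndex G.β (Sum.inl f) (.mergeLeft f e) (Sum.inl none)).symm)
      · exact traceWire_eq_of_skip
          (skip_removeIndex G.β (Sum.inl f) (.mergeLeft f e) (Sum.inl (some a))).symm
    | hI a =>
      rw [wire_I]
      exact traceWire_eq_of_skip ((congrArg G.wire (skip_removeIndex G.α (Sum.inr e)
        (.eraseRight e) (Sum.inl a))).trans (G.wire_I a))
    | hJ a =>
      rw [wire_InOut]
      exact traceWire_eq_of_skip ((congrArg G.wire (skip_removeIndex G.α (Sum.inr e)
        (.eraseRight e) (Sum.inr a))).trans ((G.wire_InOut a.1).trans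
          (skip_removeIndex G.β (Sum.inl f) (.mergeLeft f e) (Sum.inr a)).symm))
  exact ⟨{
    V := Equiv.refl _
    A := Equiv.refl _
    B := Equiv.sumCongr (Equiv.refl _) (Equiv.optionSubtypeNe f)
    target _ := rfl
    source := by rintro (a | _ | a) <;> rfl
    wire := hw
    loops := (congrArg (Nat.card G.L + ·) (traceLoop_of_ne fun h =>
      Sum.inr_ne_inl (G.β.injective (Sum.inr_injective ((G.wire_InOut e).symm.trans h))))) }⟩

/-- No wire is rerouted; the closed wire contributes `1` to the number of loops. -/
theorem toPort_glueLoop (G : InOutGraph (k + 1) (l + 1)) (e : G.InOut) :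
    Nonempty (PortGraph.Iso (G.glueLoop e).toPort
      (G.toPort.tr (G.α (Sum.inr e)) (G.β (Sum.inr e)))) := by
  have hw : ∀ x, traceWire (G.α (Sum.inr e)) (G.β (Sum.inr e)) G.wire
      (Sum.map (Equiv.refl _) id x) = Sum.map (Equiv.refl _) id ((G.glueLoop e).wire x) := by
    intro x
    induction x using start_ind (G := G.glueLoop e) with
    | hE a => exact traceWire_eq_of_skip rfl
    | hO a =>
      exact traceWire_eq_of_skip
        (skip_removeIndex G.β (Sum.inr e) (.eraseRight e) (Sum.inl a)).symm
    | hI a =>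
      rw [wire_I]
      exact traceWire_eq_of_skip ((congrArg G.wire (skip_removeIndex G.α (Sum.inr e)
        (.eraseRight e) (Sum.inl a))).trans (G.wire_I a))
    | hJ a =>
      rw [wire_InOut]
      exact traceWire_eq_of_skip ((congrArg G.wire (skip_removeIndex G.α (Sum.inr e)
        (.eraseRight e) (Sum.inr a))).trans ((G.wire_InOut a.1).trans
          (skip_removeIndex G.β (Sum.inr e) (.eraseRight e) (Sum.inr a)).symm))
  exact ⟨{
    V := Equiv.refl _
    A := Equiv.refl _
    B := Equiv.refl _
    target _ := rfl
    source _ := rfl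
    wire := hw
    loops := (congrArg (Nat.card G.L + ·) (traceLoop_of_eq (G.wire_InOut e))).trans
      Finite.card_option.symm }⟩

/-- No port is involved. The wire from the input of `f` is rerouted to the output of `e`; it is the
new edge `none`. -/
theorem toPort_glueInOut (G : InOutGraph (k + 1) (l + 1)) (e f : G.InOut) (h : e ≠ f) :
    Nonempty (PortGraph.Iso (G.glueInOut e f h).toPort
      (G.toPort.tr (G.α (Sum.inr e)) (G.β (Sum.inr f)))) := by
  have hw : ∀ x, traceWire (G.α (Sum.inr e)) (G.β (Sum.inr f)) G.wire
      (Sum.map (Equiv.refl _) id x) = Sum.map (Equiv.refl _) id ((G.glueInOut e f h).wire x) := by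
    intro x
    induction x using start_ind (G := G.glueInOut e f h) with
    | hE a => exact traceWire_eq_of_skip rfl
    | hO a =>
      exact traceWire_eq_of_skip (skip_removeIndex G.β (Sum.inr f)
        (.mergeRight f e h fun _ => and_comm) (Sum.inl a)).symm
    | hI a =>
      rw [wire_I]
      exact traceWire_eq_of_skip ((congrArg G.wire (skip_removeIndex G.α (Sum.inr e)
        (.mergeRight e f (Ne.symm h) fun _ => Iff.rfl) (Sum.inl a))).trans (G.wire_I a))
    | hJ a =>
      rw [wire_InOut]
      rcases a with _ | a
      · exact traceWire_eq_of_eq ((congrArg G.wire (skip_removeIndex G.α (Sum.inr e)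
          (.mergeRight e f (Ne.symm h) fun _ => Iff.rfl) (Sum.inr none))).trans (G.wire_InOut f))
          ((G.wire_InOut e).trans (skip_removeIndex G.β (Sum.inr f)
            (.mergeRight f e h fun _ => and_comm) (Sum.inr none)).symm)
      · exact traceWire_eq_of_skip ((congrArg G.wire (skip_removeIndex G.α (Sum.inr e)
          (.mergeRight e f (Ne.symm h) fun _ => Iff.rfl) (Sum.inr (some a)))).trans
            ((G.wire_InOut a.1).trans (skip_removeIndex G.β (Sum.inr f)
              (.mergeRight f e h fun _ => and_comm) (Sum.inr (some a))).symm))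
  exact ⟨{
    V := Equiv.refl _
    A := Equiv.refl _
    B := Equiv.refl _
    target _ := rfl
    source _ := rfl
    wire := hw
    loops := (congrArg (Nat.card G.L + ·) (traceLoop_of_ne fun h' => h
      (Sum.inr_injective (G.β.injective (Sum.inr_injective ((G.wire_InOut e).symm.trans h')))))) }⟩

/-- This is the purpose of port graphs: after it, no identity between partial traces requires a
discussion by kinds of edges. -/
theorem toPort_tr (i : Fin (k + 1)) (j : Fin (l + 1)) (G : InOutGraph (k + 1) (l + 1)) :
    Nonempty (PortGraph.Iso (G.tr i j).toPort (G.toPort.tr i j)) := by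
  obtain ⟨x, rfl⟩ := G.α.surjective i
  obtain ⟨y, rfl⟩ := G.β.surjective j
  rw [tr, Equiv.symm_apply_apply, Equiv.symm_apply_apply]
  rcases x with e | e <;> rcases y with f | f
  · exact G.toPort_glueEdge e f
  · exact G.toPort_glueInput e f
  · exact G.toPort_glueOutput e f
  · by_cases h : e = f
    · subst h
      simp only [glue, dite_true]
      exact G.toPort_glueLoop e
    · simp only [glue, dif_neg h]
      exact G.toPort_glueInOut e f h

end InOutGraph

/-! ### Two successive gluings, and gluing after a permutation. -/

namespace TraPs

variable {X Y X' Y' : Type*} {k l k' l' : ℕ}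

/-- Compatibility of the gluing with the maps between wirings. -/
theorem traceWire_comm {φ : X ⊕ Fin (k + 1) ≃ Y ⊕ Fin (l + 1)}
    {ψ : X' ⊕ Fin (k' + 1) ≃ Y' ⊕ Fin (l' + 1)} {i : Fin (k + 1)} {j : Fin (l + 1)}
    {i' : Fin (k' + 1)} {j' : Fin (l' + 1)} {f : X ⊕ Fin k → X' ⊕ Fin k'}
    {F : X ⊕ Fin (k + 1) → X' ⊕ Fin (k' + 1)} {g : Y ⊕ Fin l → Y' ⊕ Fin l'}
    {F' : Y ⊕ Fin (l + 1) → Y' ⊕ Fin (l' + 1)}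
    (hF : ∀ x, F (skip i x) = skip i' (f x)) (hi : F (Sum.inr i) = Sum.inr i')
    (hF' : ∀ x, F' (skip j x) = skip j' (g x)) (hj : F' (Sum.inr j) = Sum.inr j')
    (h : ∀ x, ψ (F x) = F' (φ x)) (x : X ⊕ Fin k) :
    traceWire i' j' ψ (f x) = g (traceWire i j φ x) := by
  by_cases h' : φ (skip i x) = Sum.inr j
  · apply traceWire_eq_of_eq
    · rw [← hF, h, h', hj]
    · rw [← hi, h, ← hF', skip_traceWire_of_eq h']
  · apply traceWire_eq_of_skip
    rw [← hF, h, ← hF', skip_traceWire_of_ne h']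

theorem traceLoop_comm {φ : X ⊕ Fin (k + 1) ≃ Y ⊕ Fin (l + 1)}
    {ψ : X' ⊕ Fin (k' + 1) ≃ Y' ⊕ Fin (l' + 1)} {i : Fin (k + 1)} {j : Fin (l + 1)}
    {i' : Fin (k' + 1)} {j' : Fin (l' + 1)}
    {F : X ⊕ Fin (k + 1) → X' ⊕ Fin (k' + 1)} {g : Y ⊕ Fin l → Y' ⊕ Fin l'}
    {F' : Y ⊕ Fin (l + 1) → Y' ⊕ Fin (l' + 1)}
    (hi : F (Sum.inr i) = Sum.inr i')
    (hF' : ∀ x, F' (skip j x) = skip j' (g x)) (hj : F' (Sum.inr j) = Sum.inr j')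
    (h : ∀ x, ψ (F x) = F' (φ x)) :
    traceLoop i' j' ψ = traceLoop i j φ := by
  by_cases h' : φ (Sum.inr i) = Sum.inr j
  · rw [traceLoop_of_eq h', traceLoop_of_eq (by rw [← hi, h, h', hj])]
  · obtain ⟨y, hy⟩ := exists_skip_eq h'
    rw [traceLoop_of_ne h', traceLoop_of_ne (by rw [← hi, h, ← hy, hF']; exact skip_ne _ _)]

open Classical in
theorem skip_traceWire (i : Fin (k + 1)) (j : Fin (l + 1))
    (φ : X ⊕ Fin (k + 1) ≃ Y ⊕ Fin (l + 1)) (x : X ⊕ Fin k) :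
    skip j (traceWire i j φ x)
      = if φ (skip i x) = Sum.inr j then φ (Sum.inr i) else φ (skip i x) := by
  split_ifs with h
  exacts [skip_traceWire_of_eq h, skip_traceWire_of_ne h]

open Classical in
theorem traceLoop_eq (i : Fin (k + 1)) (j : Fin (l + 1))
    (φ : X ⊕ Fin (k + 1) ≃ Y ⊕ Fin (l + 1)) :
    traceLoop i j φ = if φ (Sum.inr i) = Sum.inr j then 1 else 0 := by
  split_ifs with h
  exacts [traceLoop_of_eq h, traceLoop_of_ne h]

/-- The points removed are the same on both sides, in opposite orders: `i'.predAbove i` is the name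
of `i` once `i.succAbove i'` has been removed. -/
theorem skip_skip (i : Fin (k + 2)) (i' : Fin (k + 1)) (x : X ⊕ Fin k) :
    skip (i.succAbove i') (skip (i'.predAbove i) x) = skip i (skip i' x) := by
  rcases x with x | x
  · rfl
  · simp only [skip_inr, Fin.succAbove_succAbove_succAbove_predAbove]

theorem skip_predAbove (i : Fin (k + 2)) (i' : Fin (k + 1)) :
    skip (X := X) (i.succAbove i') (Sum.inr (i'.predAbove i)) = Sum.inr i := by
  rw [skip_inr, Fin.succAbove_succAbove_predAbove]

open Classical in
theorem skip_skip_traceWire_traceWire (i : Fin (k + 2)) (j : Fin (l + 2)) (i' : Fin (k + 1))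
    (j' : Fin (l + 1)) (φ : X ⊕ Fin (k + 2) ≃ Y ⊕ Fin (l + 2)) (x : X ⊕ Fin k) :
    skip j (skip j' (traceWire i' j' (traceWire i j φ) x))
      = if (if φ (skip i (skip i' x)) = Sum.inr j then φ (Sum.inr i) else φ (skip i (skip i' x)))
          = skip j (Sum.inr j') then
        (if φ (skip i (Sum.inr i')) = Sum.inr j then φ (Sum.inr i) else φ (skip i (Sum.inr i')))
      else (if φ (skip i (skip i' x)) = Sum.inr j then φ (Sum.inr i)
        else φ (skip i (skip i' x))) := by
  rw [skip_traceWire, apply_ite (skip j)]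
  simp only [skip_traceWire, ← (skip_injective j).eq_iff]

/-- Seen in the original wiring, both sides follow the wire from `x` and jump from one glued end to
the matching start as long as such an end is met. The nested conditionals of
`skip_skip_traceWire_traceWire` record this path, and the two orders give the same path. -/
theorem traceWire_traceWire (i : Fin (k + 2)) (j : Fin (l + 2)) (i' : Fin (k + 1))
    (j' : Fin (l + 1)) (φ : X ⊕ Fin (k + 2) ≃ Y ⊕ Fin (l + 2)) (x : X ⊕ Fin k) :
    traceWire i' j' (traceWire i j φ) x
      = traceWire (i'.predAbove i) (j'.predAbove j)
        (traceWire (i.succAbove i') (j.succAbove j') φ) x := by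
  classical
  apply skip_injective j'
  apply skip_injective j
  rw [skip_skip_traceWire_traceWire, ← skip_skip j, skip_skip_traceWire_traceWire, skip_skip,
    skip_predAbove, skip_predAbove]
  -- The case analysis only needs that the three starts have distinct images and that the two glued
  -- ends are distinct.
  have h₁ : φ (skip i (skip i' x)) ≠ φ (Sum.inr i) := φ.injective.ne (skip_ne _ _)
  have h₂ : φ (skip i (skip i' x)) ≠ φ (skip i (Sum.inr i')) :=
    φ.injective.ne ((skip_injective i).ne (skip_ne _ _))
  have h₃ : φ (skip i (Sum.inr i')) ≠ φ (Sum.inr i) := φ.injective.ne (skip_ne _ _)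
  have h₄ : skip (X := Y) j (Sum.inr j') ≠ Sum.inr j := skip_ne _ _
  rw [skip_inr] at h₂ h₃ h₄ ⊢
  rw [skip_inr]
  grind

/-- Only the total is symmetric. When the wire from `i` ends at the second glued end and that from
`i'` at `j`, the two wires form one loop, which appears at the second gluing in either order. -/
theorem traceLoop_traceWire (i : Fin (k + 2)) (j : Fin (l + 2)) (i' : Fin (k + 1))
    (j' : Fin (l + 1)) (φ : X ⊕ Fin (k + 2) ≃ Y ⊕ Fin (l + 2)) :
    traceLoop i j φ + traceLoop i' j' (traceWire i j φ)
      = traceLoop (i.succAbove i') (j.succAbove j') φ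
        + traceLoop (i'.predAbove i) (j'.predAbove j)
          (traceWire (i.succAbove i') (j.succAbove j') φ) := by
  classical
  have h₃ : φ (skip i (Sum.inr i')) ≠ φ (Sum.inr i) := φ.injective.ne (skip_ne _ _)
  have h₄ : skip (X := Y) j (Sum.inr j') ≠ Sum.inr j := skip_ne _ _
  have h : traceWire i j φ (Sum.inr i') = Sum.inr j' ↔
      (if φ (skip i (Sum.inr i')) = Sum.inr j then φ (Sum.inr i) else φ (skip i (Sum.inr i')))
        = skip j (Sum.inr j') := by
    rw [← (skip_injective j).eq_iff, skip_traceWire]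
  have h' : traceWire (i.succAbove i') (j.succAbove j') φ (Sum.inr (i'.predAbove i))
      = Sum.inr (j'.predAbove j) ↔
      (if φ (Sum.inr i) = Sum.inr (j.succAbove j') then φ (Sum.inr (i.succAbove i'))
        else φ (Sum.inr i)) = Sum.inr j := by
    rw [← (skip_injective (j.succAbove j')).eq_iff, skip_traceWire, skip_predAbove,
      skip_predAbove]
  simp only [traceLoop_eq, h, h']
  rw [skip_inr] at h₃ h₄ ⊢
  rw [skip_inr]
  grind

theorem map_refl_wire {φ ψ : X ⊕ Fin k ≃ Y ⊕ Fin l} (h : ∀ x, ψ x = φ x) (x : X ⊕ Fin k) :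
    ψ (Sum.map (Equiv.refl X) id x) = Sum.map (Equiv.refl Y) id (φ x) := by
  rw [Equiv.coe_refl, Equiv.coe_refl, Sum.map_id_id, Sum.map_id_id, id, id, h]

end TraPs

namespace PortGraph

open TraPs

variable {k l k' l' : ℕ}

def trTr (i : Fin (k + 2)) (j : Fin (l + 2)) (i' : Fin (k + 1)) (j' : Fin (l + 1))
    (G : PortGraph (k + 2) (l + 2)) :
    Iso ((G.tr i j).tr i' j')
      ((G.tr (i.succAbove i') (j.succAbove j')).tr (i'.predAbove i) (j'.predAbove j)) where
  V := Equiv.refl _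
  A := Equiv.refl _
  B := Equiv.refl _
  target _ := rfl
  source _ := rfl
  wire := map_refl_wire fun x => (traceWire_traceWire i j i' j' G.wire x).symm
  loops := by
    have h := traceLoop_traceWire i j i' j' G.wire
    simp only [tr]
    omega

/-- Renumbering carries one gluing problem to the other, and `traceWire_comm` applies. The right
action precomposes the wiring, so starts are carried by `τ⁻¹` while ends are carried by `σ`. -/
def trAct (i : Fin (k + 1)) (j : Fin (l + 1)) (σ : Equiv.Perm (Fin (l + 1)))
    (τ : Equiv.Perm (Fin (k + 1))) (G : PortGraph (k + 1) (l + 1)) :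
    Iso (((G.tr (τ i) (σ⁻¹ j)).lact (permRemove σ j)).ract (permRemove τ (τ i)))
      (((G.lact σ).ract τ).tr i j) := by
  have hσ : ∀ x : G.A ⊕ Fin l, Sum.map id σ (skip (σ⁻¹ j) x)
      = skip j (Sum.map id (permRemove σ j) x) := by
    rintro (x | x)
    · rfl
    · exact congrArg Sum.inr (succAbove_permRemove σ j x).symm
  have hτ : ∀ x : G.B ⊕ Fin k, Sum.map id τ.symm (skip (τ i) x)
      = skip i (Sum.map id (permRemove τ (τ i)).symm x) := by
    rintro (x | x)
    · rfl
    · refine congrArg Sum.inr ?_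
      have h := succAbove_permRemove τ (τ i) ((permRemove τ (τ i)).symm x)
      rw [Equiv.apply_symm_apply, Equiv.symm_apply_apply] at h
      rw [Equiv.symm_apply_eq]
      exact h
  let ψ : G.B ⊕ Fin (k + 1) ≃ G.A ⊕ Fin (l + 1) := ((G.lact σ).ract τ).wire
  have hw : ∀ x : G.B ⊕ Fin (k + 1), ψ (Sum.map id τ.symm x) = Sum.map id σ (G.wire x) := by
    intro x
    change Sum.map id σ (G.wire (Sum.map id τ (Sum.map id τ.symm x))) = _
    rw [Sum.map_map]
    rcases x with x | x <;> simp
  have hi : Sum.map id τ.symm (Sum.inr (τ i) : G.B ⊕ Fin (k + 1)) = Sum.inr i := by simp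
  have hj : Sum.map id σ (Sum.inr (σ⁻¹ j) : G.A ⊕ Fin (l + 1)) = Sum.inr j := by simp
  have h : ∀ x : G.B ⊕ Fin k, traceWire i j ψ x = Sum.map id (permRemove σ j)
      (traceWire (τ i) (σ⁻¹ j) G.wire (Sum.map id (permRemove τ (τ i)) x)) := by
    intro x
    rw [← traceWire_comm hτ hi hσ hj hw]
    rcases x with x | x <;> simp
  exact {
    V := Equiv.refl _
    A := Equiv.refl _
    B := Equiv.refl _
    target := fun _ => rfl
    source := fun _ => rfl
    wire := map_refl_wire h
    loops := congrArg (G.loops + ·) (traceLoop_comm hi hσ hj hw) }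

end PortGraph

/-! ### Gluing in a disjoint union and with an isolated edge. -/

namespace TraPs

variable {X Y X' Y' : Type*} {k l k' l' : ℕ}

theorem skip_map_id (f : X → X') (p : Fin (k + 1)) (x : X ⊕ Fin k) :
    skip p (Sum.map f id x) = Sum.map f p.succAbove x := by
  rcases x with x | x <;> rfl

/-- Gluing an isolated edge, from `p` to `q`, after the end `j` of a wiring. -/
theorem traceWire_unit_left {Ψ : X' ⊕ Fin (k + 1) ≃ Y' ⊕ Fin (l + 2)}
    {φ : X ⊕ Fin k ≃ Y ⊕ Fin (l + 1)} {ξ : X → X'} {η : Y → Y'} {p : Fin (k + 1)}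
    {q : Fin (l + 2)} (hu : Ψ (Sum.inr p) = Sum.inr q)
    (hΨ : ∀ x, Ψ (Sum.map ξ p.succAbove x) = Sum.map η q.succAbove (φ x)) {j : Fin (l + 1)}
    {ρ : Equiv.Perm (Fin (l + 1))} (hρ : ρ j = j.predAbove q)
    (hρ' : ∀ m, ρ (j.succAbove m) = (j.predAbove q).succAbove m) (x : X ⊕ Fin k) :
    traceWire p (q.succAbove j) Ψ (Sum.map ξ id x) = Sum.map η ρ (φ x) := by
  rcases h : φ x with y | m
  · apply traceWire_eq_of_skip
    rw [skip_map_id, hΨ, h]; rfl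
  -- The wire ending at `j` continues through the isolated edge to `q`, which is numbered
  -- `j.predAbove q` among the remaining ends; the other ends keep their order. These two facts are
  -- `hρ` and `hρ'`.
  · rcases eq_or_ne m j with rfl | hm
    · apply traceWire_eq_of_eq
      · rw [skip_map_id, hΨ, h]; rfl
      · rw [hu, Sum.map_inr, hρ, skip_predAbove]
    · obtain ⟨m, rfl⟩ := Fin.exists_succAbove_eq hm
      apply traceWire_eq_of_skip
      rw [skip_map_id, hΨ, h, Sum.map_inr, Sum.map_inr, hρ', skip_inr,
        Fin.succAbove_succAbove_succAbove_predAbove]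

/-- Gluing an isolated edge, from `p` to `q`, before the start `i` of a wiring. -/
theorem traceWire_unit_right {Ψ : X' ⊕ Fin (k + 2) ≃ Y' ⊕ Fin (l + 1)}
    {φ : X ⊕ Fin (k + 1) ≃ Y ⊕ Fin l} {ξ : X → X'} {η : Y → Y'} {p : Fin (k + 2)}
    {q : Fin (l + 1)} (hu : Ψ (Sum.inr p) = Sum.inr q)
    (hΨ : ∀ x, Ψ (Sum.map ξ p.succAbove x) = Sum.map η q.succAbove (φ x)) {i : Fin (k + 1)}
    {ρ : Equiv.Perm (Fin (k + 1))} (hρ : ρ i = i.predAbove p)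
    (hρ' : ∀ m, ρ (i.succAbove m) = (i.predAbove p).succAbove m) (x : X ⊕ Fin (k + 1)) :
    traceWire (p.succAbove i) q Ψ (Sum.map ξ id x) = Sum.map η id (φ (Sum.map id ρ.symm x)) := by
  -- Writing the start as an image under `ρ` removes the inverse permutation, after which the cases
  -- are those of an isolated edge after an end.
  obtain ⟨x, rfl⟩ := (Equiv.sumCongr (Equiv.refl X) ρ).surjective x
  have hx : Sum.map id ρ.symm (Equiv.sumCongr (Equiv.refl X) ρ x) = x := by
    rcases x with x | x <;> simp
  rw [hx]
  rcases x with x | m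
  · apply traceWire_eq_of_skip
    rw [skip_map_id, skip_map_id, ← hΨ]; rfl
  · rw [Equiv.sumCongr_apply, Sum.map_inr, Sum.map_inr, id]
    rcases eq_or_ne m i with rfl | hm
    · apply traceWire_eq_of_eq
      · rw [hρ, skip_predAbove, hu]
      · rw [skip_map_id, ← hΨ]; rfl
    · obtain ⟨m, rfl⟩ := Fin.exists_succAbove_eq hm
      apply traceWire_eq_of_skip
      rw [skip_map_id, ← hΨ, hρ', skip_inr, Fin.succAbove_succAbove_succAbove_predAbove]
      rfl

theorem traceLoop_unit_left {Ψ : X' ⊕ Fin (k + 1) ≃ Y' ⊕ Fin (l + 1)} {p : Fin (k + 1)}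
    {q : Fin (l + 1)} (hu : Ψ (Sum.inr p) = Sum.inr q) {j : Fin l} :
    traceLoop p (q.succAbove j) Ψ = 0 :=
  traceLoop_of_ne (by rw [hu]; simp [(Fin.succAbove_ne q j).symm])

theorem traceLoop_unit_right {Ψ : X' ⊕ Fin (k + 1) ≃ Y' ⊕ Fin (l + 1)}
    {φ : X ⊕ Fin k ≃ Y ⊕ Fin l} {ξ : X → X'} {η : Y → Y'} {p : Fin (k + 1)} {q : Fin (l + 1)}
    (hΨ : ∀ x, Ψ (Sum.map ξ p.succAbove x) = Sum.map η q.succAbove (φ x)) {i : Fin k} :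
    traceLoop (p.succAbove i) q Ψ = 0 := by
  refine traceLoop_of_ne ?_
  have h := hΨ (Sum.inr i)
  rw [Sum.map_inr] at h
  rw [h, ← skip_map_id]
  exact skip_ne _ _

theorem succAbove_castAdd {m n : ℕ} (i : Fin (m + 1)) (a : Fin m) (h : m + 1 + n = m + n + 1) :
    (⟨i, by omega⟩ : Fin (m + n + 1)).succAbove (Fin.castAdd n a)
      = Fin.cast h (Fin.castAdd n (i.succAbove a)) := by
  ext
  simp only [Fin.succAbove, Fin.lt_def, Fin.val_castSucc, Fin.val_castAdd, Fin.val_cast]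
  split_ifs <;> rfl

theorem succAbove_natAdd_of_left {m n : ℕ} (i : Fin (m + 1)) (a : Fin n)
    (h : m + 1 + n = m + n + 1) :
    (⟨i, by omega⟩ : Fin (m + n + 1)).succAbove (Fin.natAdd m a)
      = Fin.cast h (Fin.natAdd (m + 1) a) := by
  ext
  simp only [Fin.succAbove, Fin.lt_def, Fin.val_castSucc, Fin.val_natAdd, Fin.val_cast]
  split_ifs
  · simp only [Fin.val_castSucc, Fin.val_natAdd]; omega
  · simp only [Fin.val_succ, Fin.val_natAdd]; omega

theorem succAbove_natAdd {m n : ℕ} (i : Fin (n + 1)) (a : Fin n) :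
    (Fin.natAdd m i : Fin (m + n + 1)).succAbove (Fin.natAdd m a)
      = Fin.natAdd m (i.succAbove a) := by
  ext
  simp only [Fin.succAbove, Fin.lt_def, Fin.val_castSucc, Fin.val_natAdd]
  split_ifs <;> first | omega | simp [Nat.add_assoc]

theorem succAbove_castAdd_of_right {m n : ℕ} (i : Fin (n + 1)) (a : Fin m) :
    (Fin.natAdd m i : Fin (m + n + 1)).succAbove (Fin.castAdd n a)
      = Fin.castAdd (n + 1) a := by
  ext
  simp only [Fin.succAbove, Fin.lt_def, Fin.val_castSucc, Fin.val_natAdd, Fin.val_castAdd]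
  split_ifs
  · rfl
  · omega

end TraPs

namespace PortGraph

open TraPs

variable {k l k' l' : ℕ}

theorem cast_wire (hk : k = k') (hl : l = l') (G : PortGraph k l) (x : G.B ⊕ Fin k) :
    (G.cast hk hl).wire (Sum.map id (Fin.cast hk) x) = Sum.map id (Fin.cast hl) (G.wire x) := by
  subst hk hl
  rcases x with x | x <;> rfl

theorem cast_hcomp_wire_inl {m n : ℕ} (hk : k + k' = m) (hl : l + l' = n) (G : PortGraph k l)
    (H : PortGraph k' l') (x : G.B ⊕ Fin k) :
    ((G.hcomp H).cast hk hl).wire (Sum.map Sum.inl (Fin.cast hk ∘ Fin.castAdd k') x)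
      = Sum.map Sum.inl (Fin.cast hl ∘ Fin.castAdd l') (G.wire x) := by
  have h := cast_wire hk hl (G.hcomp H) (Sum.map Sum.inl (Fin.castAdd k') x)
  have h' := sumWire_inl G.wire H.wire x
  refine Eq.trans ?_ ((h.trans (congrArg _ h')).trans ?_)
  · rcases x with x | x <;> rfl
  · rcases G.wire x with y | y <;> rfl

theorem cast_hcomp_wire_inr {m n : ℕ} (hk : k + k' = m) (hl : l + l' = n) (G : PortGraph k l)
    (H : PortGraph k' l') (x : H.B ⊕ Fin k') :
    ((G.hcomp H).cast hk hl).wire (Sum.map Sum.inr (Fin.cast hk ∘ Fin.natAdd k) x)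
      = Sum.map Sum.inr (Fin.cast hl ∘ Fin.natAdd l) (H.wire x) := by
  have h := cast_wire hk hl (G.hcomp H) (Sum.map Sum.inr (Fin.natAdd k) x)
  have h' := sumWire_inr G.wire H.wire x
  refine Eq.trans ?_ ((h.trans (congrArg _ h')).trans ?_)
  · rcases x with x | x <;> rfl
  · rcases H.wire x with y | y <;> rfl

def trHcompLeft (i : Fin (k + 1)) (j : Fin (l + 1)) (G : PortGraph (k + 1) (l + 1))
    (H : PortGraph k' l') :
    Iso ((G.tr i j).hcomp H)
      (((G.hcomp H).cast (Nat.add_right_comm k 1 k') (Nat.add_right_comm l 1 l')).tr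
        ⟨i, by omega⟩ ⟨j, by omega⟩) := by
  let hk := Nat.add_right_comm k 1 k'
  let hl := Nat.add_right_comm l 1 l'
  let ψ : (G.B ⊕ H.B) ⊕ Fin (k + k' + 1) ≃ (G.A ⊕ H.A) ⊕ Fin (l + l' + 1) :=
    ((G.hcomp H).cast hk hl).wire
  have hF : ∀ x : G.B ⊕ Fin k,
      Sum.map (Sum.inl : G.B → G.B ⊕ H.B) (Fin.cast hk ∘ Fin.castAdd k') (skip i x)
      = skip ⟨i, by omega⟩ (Sum.map Sum.inl (Fin.castAdd k') x) := by
    rintro (x | x)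
    · rfl
    · exact congrArg Sum.inr (succAbove_castAdd i x hk).symm
  have hF' : ∀ x : G.A ⊕ Fin l,
      Sum.map (Sum.inl : G.A → G.A ⊕ H.A) (Fin.cast hl ∘ Fin.castAdd l') (skip j x)
      = skip ⟨j, by omega⟩ (Sum.map Sum.inl (Fin.castAdd l') x) := by
    rintro (x | x)
    · rfl
    · exact congrArg Sum.inr (succAbove_castAdd j x hl).symm
  have hw : ∀ x, traceWire ⟨i, by omega⟩ ⟨j, by omega⟩ ψ x
      = sumWire (traceWire i j G.wire) H.wire x := by
    intro x
    induction x using sum_ind with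
    | h x =>
      rw [sumWire_inl]
      exact traceWire_comm hF rfl hF' rfl (cast_hcomp_wire_inl hk hl G H) x
    | h' x =>
      rw [sumWire_inr]
      apply traceWire_eq_of_skip
      refine Eq.trans (congrArg ψ ?_) ((cast_hcomp_wire_inr hk hl G H x).trans ?_)
      · rcases x with x | x
        · rfl
        · exact congrArg Sum.inr (succAbove_natAdd_of_left i x hk)
      · rcases H.wire x with y | y
        · rfl
        · exact congrArg Sum.inr (succAbove_natAdd_of_left j y hl).symm
  exact {
    V := Equiv.refl _
    A := Equiv.refl _
    B := Equiv.refl _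
    target := fun _ => rfl
    source := fun _ => rfl
    wire := map_refl_wire hw
    loops := by
      have h : traceLoop (k := k + k') (l := l + l') ⟨i, by omega⟩ ⟨j, by omega⟩ ψ
        = traceLoop i j G.wire := traceLoop_comm rfl hF' rfl (cast_hcomp_wire_inl hk hl G H)
      change G.loops + H.loops + traceLoop _ _ ψ = G.loops + traceLoop i j G.wire + H.loops
      rw [h]
      omega }

def trHcompRight (i : Fin (k' + 1)) (j : Fin (l' + 1)) (G : PortGraph k l)
    (H : PortGraph (k' + 1) (l' + 1)) :
    Iso (G.hcomp (H.tr i j))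
      ((G.hcomp H).tr (k := k + k') (l := l + l') (Fin.natAdd k i) (Fin.natAdd l j)) := by
  have hF : ∀ x : H.B ⊕ Fin k',
      Sum.map (Sum.inr : H.B → G.B ⊕ H.B) (Fin.natAdd k) (skip i x)
      = skip (k := k + k') (Fin.natAdd k i) (Sum.map Sum.inr (Fin.natAdd k) x) := by
    rintro (x | x)
    · rfl
    · exact congrArg Sum.inr (succAbove_natAdd i x).symm
  have hF' : ∀ x : H.A ⊕ Fin l',
      Sum.map (Sum.inr : H.A → G.A ⊕ H.A) (Fin.natAdd l) (skip j x)
      = skip (k := l + l') (Fin.natAdd l j) (Sum.map Sum.inr (Fin.natAdd l) x) := by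
    rintro (x | x)
    · rfl
    · exact congrArg Sum.inr (succAbove_natAdd j x).symm
  have hw : ∀ x, traceWire (k := k + k') (l := l + l') (Fin.natAdd k i) (Fin.natAdd l j)
      (sumWire (k' := k' + 1) (l' := l' + 1) G.wire H.wire) x = sumWire G.wire (traceWire i j H.wire) x := by
    intro x
    induction x using sum_ind with
    | h x =>
      rw [sumWire_inl]
      apply traceWire_eq_of_skip
      refine Eq.trans (congrArg _ ?_) ((sumWire_inl G.wire H.wire x).trans ?_)
      · rcases x with x | x
        · rfl
        · exact congrArg Sum.inr (succAbove_castAdd_of_right i x)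
      · rcases G.wire x with y | y
        · rfl
        · exact congrArg Sum.inr (succAbove_castAdd_of_right j y).symm
    | h' x =>
      rw [sumWire_inr]
      exact traceWire_comm hF rfl hF' rfl (sumWire_inr G.wire H.wire) x
  exact {
    V := Equiv.refl _
    A := Equiv.refl _
    B := Equiv.refl _
    target := fun _ => rfl
    source := fun _ => rfl
    wire := map_refl_wire hw
    loops := (congrArg (G.loops + H.loops + ·) (traceLoop_comm (k' := k + k') (l' := l + l')
      (ψ := (G.hcomp H).wire) rfl hF' rfl (sumWire_inr G.wire H.wire))).trans (Nat.add_assoc _ _ _) }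

/-- The graph reduced to a single edge without vertices. -/
def unit₁ : PortGraph 1 1 where
  V := Empty
  A := Empty
  B := Empty
  target := Empty.elim
  source := Empty.elim
  wire := Equiv.refl _
  loops := 0

/-- Placing the isolated edge before or after `G` is put in the common form `p.succAbove`, with `p =
0` or `p = Fin.last`. The four unit axioms then follow from `traceWire_unit_left` and
`traceWire_unit_right`. -/
theorem unit₁_hcomp_cast_wire (G : PortGraph k l) (x : G.B ⊕ Fin k) :
    ((unit₁.hcomp G).cast (Nat.add_comm 1 k) (Nat.add_comm 1 l)).wire
      (Sum.map Sum.inr (Fin.succAbove 0) x) = Sum.map Sum.inr (Fin.succAbove 0) (G.wire x) := by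
  have h : ∀ n, Fin.cast (Nat.add_comm 1 n) ∘ Fin.natAdd 1 = Fin.succAbove (n := n) 0 := by
    intro n
    ext a
    simp
  rw [← h, ← h]
  exact cast_hcomp_wire_inr _ _ unit₁ G x

theorem unit₁_hcomp_cast_wire_zero (G : PortGraph k l) :
    ((unit₁.hcomp G).cast (Nat.add_comm 1 k) (Nat.add_comm 1 l)).wire (Sum.inr 0)
      = Sum.inr 0 := by
  have h := cast_hcomp_wire_inl (Nat.add_comm 1 k) (Nat.add_comm 1 l) unit₁ G (Sum.inr 0)
  have h' : ∀ n, Fin.cast (Nat.add_comm 1 n) (Fin.castAdd n 0) = 0 := fun n => by ext; simp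
  refine Eq.trans ?_ (h.trans ?_)
  · exact congrArg _ (congrArg Sum.inr (h' k).symm)
  · exact congrArg Sum.inr (h' l)

theorem hcomp_unit₁_wire (G : PortGraph k l) (x : G.B ⊕ Fin k) :
    (G.hcomp unit₁).wire (Sum.map Sum.inl (Fin.last k).succAbove x)
      = Sum.map Sum.inl (Fin.last l).succAbove (G.wire x) := by
  rw [Fin.succAbove_last, Fin.succAbove_last]
  exact sumWire_inl G.wire unit₁.wire x

theorem hcomp_unit₁_wire_last (G : PortGraph k l) :
    (G.hcomp unit₁).wire (Sum.inr (Fin.last k)) = Sum.inr (Fin.last l) :=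
  sumWire_inr G.wire unit₁.wire (Sum.inr 0)

def trZeroSucc (j : Fin (l + 1)) (G : PortGraph k (l + 1)) :
    Iso (G.lact j.cycleRange)
      (((unit₁.hcomp G).cast (Nat.add_comm 1 k) (Nat.add_comm 1 (l + 1))).tr 0 j.succ) where
  V := (Equiv.emptySum Empty G.V).symm
  A := (Equiv.emptySum Empty G.A).symm
  B := (Equiv.emptySum Empty G.B).symm
  target _ := rfl
  source _ := rfl
  wire x := by
    have h := traceWire_unit_left (unit₁_hcomp_cast_wire_zero G) (unit₁_hcomp_cast_wire G)
      (ρ := j.cycleRange) (j := j) (by simp) (by simp) x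
    rw [Fin.succAbove_zero] at h
    refine h.trans ?_
    change _ = Sum.map Sum.inr id (Sum.map id j.cycleRange (G.wire x))
    rcases G.wire x with y | y <;> rfl
  loops := by
    have h := traceLoop_unit_left (unit₁_hcomp_cast_wire_zero G) (j := j)
    rw [Fin.succAbove_zero] at h
    exact (congrArg (0 + G.loops + ·) h).trans (Nat.zero_add _)

def trSuccZero (i : Fin (k + 1)) (G : PortGraph (k + 1) l) :
    Iso (G.ract i.cycleRange⁻¹)
      (((unit₁.hcomp G).cast (Nat.add_comm 1 (k + 1)) (Nat.add_comm 1 l)).tr i.succ 0) where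
  V := (Equiv.emptySum Empty G.V).symm
  A := (Equiv.emptySum Empty G.A).symm
  B := (Equiv.emptySum Empty G.B).symm
  target _ := rfl
  source _ := rfl
  wire x := by
    have h := traceWire_unit_right (unit₁_hcomp_cast_wire_zero G) (unit₁_hcomp_cast_wire G)
      (ρ := i.cycleRange) (i := i) (by simp) (by simp) x
    rw [Fin.succAbove_zero] at h
    exact h
  loops := by
    have h := traceLoop_unit_right (unit₁_hcomp_cast_wire G) (i := i)
    rw [Fin.succAbove_zero] at h
    exact (congrArg (0 + G.loops + ·) h).trans (Nat.zero_add _)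

/-- Together with `cycleIcc_last_inv_self` this provides the hypotheses `hρ'` and `hρ` on the
permutation `ρ`: the inverse cycle moves `j` to the last place and preserves the order of the rest.
-/
theorem cycleIcc_last_inv_succAbove (j : Fin (l + 1)) (m : Fin l) :
    (Fin.cycleIcc j (Fin.last l))⁻¹ (j.succAbove m) = (Fin.last l).succAbove m := by
  rw [Equiv.Perm.inv_eq_iff_eq]
  exact (congrFun (Fin.cycleIcc_comp_succAbove j (Fin.last l) (Fin.le_last j)) m).symm

theorem cycleIcc_last_inv_self (j : Fin (l + 1)) :
    (Fin.cycleIcc j (Fin.last l))⁻¹ j = Fin.last l := by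
  rw [Equiv.Perm.inv_eq_iff_eq, Fin.cycleIcc_of_last (Fin.le_last j)]

def trLastCastSucc (j : Fin (l + 1)) (G : PortGraph k (l + 1)) :
    Iso (G.lact (Fin.cycleIcc j (Fin.last l))⁻¹)
      ((G.hcomp unit₁).tr (Fin.last k) j.castSucc) where
  V := (Equiv.sumEmpty G.V Empty).symm
  A := (Equiv.sumEmpty G.A Empty).symm
  B := (Equiv.sumEmpty G.B Empty).symm
  target _ := rfl
  source _ := rfl
  wire x := by
    have h := traceWire_unit_left (hcomp_unit₁_wire_last G) (hcomp_unit₁_wire G)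
      (ρ := (Fin.cycleIcc j (Fin.last l))⁻¹) (j := j)
      (by rw [Fin.predAbove_right_last, cycleIcc_last_inv_self])
      (fun m => by rw [Fin.predAbove_right_last, cycleIcc_last_inv_succAbove]) x
    rw [Fin.succAbove_last] at h
    refine h.trans ?_
    suffices h : ∀ y : G.A ⊕ Fin (l + 1), Sum.map Sum.inl (Fin.cycleIcc j (Fin.last l))⁻¹.1 y
      = Sum.map Sum.inl id (Sum.map id (Fin.cycleIcc j (Fin.last l))⁻¹.1 y) from h _
    rintro (y | y) <;> rfl
  loops := by
    have h := traceLoop_unit_left (hcomp_unit₁_wire_last G) (j := j)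
    rw [Fin.succAbove_last] at h
    exact congrArg (G.loops + 0 + ·) h

def trCastSuccLast (i : Fin (k + 1)) (G : PortGraph (k + 1) l) :
    Iso (G.ract (Fin.cycleIcc i (Fin.last k)))
      ((G.hcomp unit₁).tr i.castSucc (Fin.last l)) where
  V := (Equiv.sumEmpty G.V Empty).symm
  A := (Equiv.sumEmpty G.A Empty).symm
  B := (Equiv.sumEmpty G.B Empty).symm
  target _ := rfl
  source _ := rfl
  wire x := by
    have h := traceWire_unit_right (hcomp_unit₁_wire_last G) (hcomp_unit₁_wire G)
      (ρ := (Fin.cycleIcc i (Fin.last k))⁻¹) (i := i)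
      (by rw [Fin.predAbove_right_last, cycleIcc_last_inv_self])
      (fun m => by rw [Fin.predAbove_right_last, cycleIcc_last_inv_succAbove]) x
    rw [Fin.succAbove_last] at h
    exact h
  loops := by
    have h := traceLoop_unit_right (hcomp_unit₁_wire G) (i := i)
    rw [Fin.succAbove_last] at h
    exact congrArg (G.loops + 0 + ·) h

end PortGraph

/-! ### The axioms of a TraP for graphs, up to isomorphism. -/

namespace TraPs

theorem permTensor_castAdd {m n : ℕ} (σ : Equiv.Perm (Fin m)) (σ' : Equiv.Perm (Fin n))
    (a : Fin m) : permTensor σ σ' (Fin.castAdd n a) = Fin.castAdd n (σ a) := by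
  simp [permTensor]

theorem permTensor_natAdd {m n : ℕ} (σ : Equiv.Perm (Fin m)) (σ' : Equiv.Perm (Fin n))
    (a : Fin n) : permTensor σ σ' (Fin.natAdd m a) = Fin.natAdd m (σ' a) := by
  simp [permTensor]

theorem blockSwap_castAdd (m n : ℕ) (a : Fin m) :
    blockSwap m n (Fin.castAdd n a) = Fin.cast (Nat.add_comm n m) (Fin.natAdd n a) := by
  ext; simp [blockSwap_val, Nat.add_comm]

theorem blockSwap_natAdd (m n : ℕ) (a : Fin n) :
    blockSwap m n (Fin.natAdd m a) = Fin.cast (Nat.add_comm n m) (Fin.castAdd m a) := by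
  ext; simp [blockSwap_val]

end TraPs

namespace InOutGraph

open TraPs

variable {k l k' l' k'' l'' : ℕ}

theorem one_lact_equiv (G : InOutGraph k l) : G.lact 1 ≈ G := ⟨Iso.refl G⟩

theorem ract_one_equiv (G : InOutGraph k l) : G.ract 1 ≈ G := ⟨Iso.refl G⟩

theorem hcomp_assoc_equiv (G : InOutGraph k l) (H : InOutGraph k' l') (K : InOutGraph k'' l'') :
    ((G.hcomp H).hcomp K).cast (Nat.add_assoc k k' k'') (Nat.add_assoc l l' l'')
      ≈ G.hcomp (H.hcomp K) :=
  ⟨{ V := Equiv.sumAssoc _ _ _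
     E := Equiv.sumAssoc _ _ _
     I := Equiv.sumAssoc _ _ _
     O := Equiv.sumAssoc _ _ _
     InOut := Equiv.sumAssoc _ _ _
     L := Equiv.sumAssoc _ _ _
     s_E := by rintro ((e | e) | e) <;> rfl
     s_O := by rintro ((e | e) | e) <;> rfl
     t_E := by rintro ((e | e) | e) <;> rfl
     t_I := by rintro ((e | e) | e) <;> rfl
     α_I := by
       rintro ((e | e) | e)
       exacts [Fin.ext rfl, Fin.ext rfl, Fin.ext (Nat.add_assoc _ _ _).symm]
     α_InOut := by
       rintro ((e | e) | e)
       exacts [Fin.ext rfl, Fin.ext rfl, Fin.ext (Nat.add_assoc _ _ _).symm]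
     β_O := by
       rintro ((e | e) | e)
       exacts [Fin.ext rfl, Fin.ext rfl, Fin.ext (Nat.add_assoc _ _ _).symm]
     β_InOut := by
       rintro ((e | e) | e)
       exacts [Fin.ext rfl, Fin.ext rfl, Fin.ext (Nat.add_assoc _ _ _).symm] }⟩

theorem unit₀_hcomp_equiv (G : InOutGraph k l) :
    (unit₀.hcomp G).cast (Nat.zero_add k) (Nat.zero_add l) ≈ G :=
  ⟨{ V := Equiv.emptySum Empty G.V
     E := Equiv.emptySum Empty G.E
     I := Equiv.emptySum Empty G.I
     O := Equiv.emptySum Empty G.O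
     InOut := Equiv.emptySum Empty G.InOut
     L := Equiv.emptySum Empty G.L
     s_E := by rintro (⟨⟨⟩⟩ | e); rfl
     s_O := by rintro (⟨⟨⟩⟩ | e); rfl
     t_E := by rintro (⟨⟨⟩⟩ | e); rfl
     t_I := by rintro (⟨⟨⟩⟩ | e); rfl
     α_I := by rintro (⟨⟨⟩⟩ | e); exact Fin.ext (Nat.zero_add _).symm
     α_InOut := by rintro (⟨⟨⟩⟩ | e); exact Fin.ext (Nat.zero_add _).symm
     β_O := by rintro (⟨⟨⟩⟩ | e); exact Fin.ext (Nat.zero_add _).symm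
     β_InOut := by rintro (⟨⟨⟩⟩ | e); exact Fin.ext (Nat.zero_add _).symm }⟩

theorem hcomp_unit₀_equiv (G : InOutGraph k l) : G.hcomp unit₀ ≈ G :=
  ⟨{ V := Equiv.sumEmpty G.V Empty
     E := Equiv.sumEmpty G.E Empty
     I := Equiv.sumEmpty G.I Empty
     O := Equiv.sumEmpty G.O Empty
     InOut := Equiv.sumEmpty G.InOut Empty
     L := Equiv.sumEmpty G.L Empty
     s_E := by rintro (e | ⟨⟨⟩⟩); rfl
     s_O := by rintro (e | ⟨⟨⟩⟩); rfl
     t_E := by rintro (e | ⟨⟨⟩⟩); rfl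
     t_I := by rintro (e | ⟨⟨⟩⟩); rfl
     α_I := by rintro (e | ⟨⟨⟩⟩); rfl
     α_InOut := by rintro (e | ⟨⟨⟩⟩); rfl
     β_O := by rintro (e | ⟨⟨⟩⟩); rfl
     β_InOut := by rintro (e | ⟨⟨⟩⟩); rfl }⟩

theorem hcomp_act_equiv (G : InOutGraph k l) (H : InOutGraph k' l')
    (σ : Equiv.Perm (Fin l)) (τ : Equiv.Perm (Fin k))
    (σ' : Equiv.Perm (Fin l')) (τ' : Equiv.Perm (Fin k')) :
    ((G.lact σ).ract τ).hcomp ((H.lact σ').ract τ')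
      ≈ ((G.hcomp H).lact (permTensor σ σ')).ract (permTensor τ τ') :=
  ⟨{ V := Equiv.refl _
     E := Equiv.refl _
     I := Equiv.refl _
     O := Equiv.refl _
     InOut := Equiv.refl _
     L := Equiv.refl _
     s_E := fun _ => rfl
     s_O := fun _ => rfl
     t_E := fun _ => rfl
     t_I := fun _ => rfl
     α_I := by
       rintro (e | e)
       exacts [permTensor_castAdd τ.symm τ'.symm _, permTensor_natAdd τ.symm τ'.symm _]
     α_InOut := by
       rintro (e | e)
       exacts [permTensor_castAdd τ.symm τ'.symm _, permTensor_natAdd τ.symm τ'.symm _]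
     β_O := by
       rintro (e | e)
       exacts [permTensor_castAdd σ σ' _, permTensor_natAdd σ σ' _]
     β_InOut := by
       rintro (e | e)
       exacts [permTensor_castAdd σ σ' _, permTensor_natAdd σ σ' _] }⟩

theorem hcomp_comm_equiv (G : InOutGraph k l) (H : InOutGraph k' l') :
    (G.hcomp H).lact (blockSwap l l')
      ≈ ((H.hcomp G).cast (Nat.add_comm k' k) (Nat.add_comm l' l)).ract (blockSwap k k') :=
  ⟨{ V := Equiv.sumComm _ _
     E := Equiv.sumComm _ _
     I := Equiv.sumComm _ _
     O := Equiv.sumComm _ _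
     InOut := Equiv.sumComm _ _
     L := Equiv.sumComm _ _
     s_E := by rintro (e | e) <;> rfl
     s_O := by rintro (e | e) <;> rfl
     t_E := by rintro (e | e) <;> rfl
     t_I := by rintro (e | e) <;> rfl
     α_I := by
       rintro (e | e)
       · exact (Equiv.symm_apply_eq _).2 (blockSwap_castAdd k k' _).symm
       · exact (Equiv.symm_apply_eq _).2 (blockSwap_natAdd k k' _).symm
     α_InOut := by
       rintro (e | e)
       · exact (Equiv.symm_apply_eq _).2 (blockSwap_castAdd k k' _).symm
       · exact (Equiv.symm_apply_eq _).2 (blockSwap_natAdd k k' _).symm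
     β_O := by
       rintro (e | e)
       exacts [(blockSwap_castAdd l l' _).symm, (blockSwap_natAdd l l' _).symm]
     β_InOut := by
       rintro (e | e)
       exacts [(blockSwap_castAdd l l' _).symm, (blockSwap_natAdd l l' _).symm] }⟩

def toPort_unit₁ : PortGraph.Iso unit₁.toPort PortGraph.unit₁ where
  V := Equiv.refl Empty
  A := Equiv.sumEmpty Empty Empty
  B := Equiv.sumEmpty Empty Empty
  target := by rintro (⟨⟨⟩⟩ | ⟨⟨⟩⟩)
  source := by rintro (⟨⟨⟩⟩ | ⟨⟨⟩⟩)
  wire := by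
    suffices h : ∀ x : (unit₁.E ⊕ unit₁.O) ⊕ Fin 1, Sum.map (Equiv.sumEmpty Empty Empty) id x
      = Sum.map (Equiv.sumEmpty Empty Empty) id (unit₁.wire x) from h
    intro x
    induction x using start_ind with
    | hE e => exact e.elim
    | hO e => exact e.elim
    | hI e => exact e.elim
    | hJ e => rw [wire_InOut]; rfl
  loops := (Nat.card_of_isEmpty (α := Empty)).symm

/-- The two graphs have isomorphic port descriptions, and `equiv_of_toPort` lifts the isomorphism.
The other axioms on partial traces are obtained in the same way. -/
theorem tr_tr_equiv (i : Fin (k + 2)) (j : Fin (l + 2)) (i' : Fin (k + 1)) (j' : Fin (l + 1))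
    (G : InOutGraph (k + 2) (l + 2)) :
    (G.tr i j).tr i' j'
      ≈ (G.tr (i.succAbove i') (j.succAbove j')).tr (i'.predAbove i) (j'.predAbove j) := by
  obtain ⟨f⟩ := toPort_tr i j G
  obtain ⟨g⟩ := toPort_tr i' j' (G.tr i j)
  obtain ⟨f'⟩ := toPort_tr (i.succAbove i') (j.succAbove j') G
  obtain ⟨g'⟩ := toPort_tr (i'.predAbove i) (j'.predAbove j)
    (G.tr (i.succAbove i') (j.succAbove j'))
  exact equiv_of_toPort (((g.trans (f.tr i' j')).trans (PortGraph.trTr i j i' j' _)).trans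
    (g'.trans (f'.tr _ _)).symm)

end InOutGraph

namespace PortGraph

variable {k l k' l' : ℕ}

def Iso.lact {G H : PortGraph k l} (f : Iso G H) (σ : Equiv.Perm (Fin l)) :
    Iso (G.lact σ) (H.lact σ) where
  V := f.V
  A := f.A
  B := f.B
  target := f.target
  source := f.source
  wire := by
    suffices h : ∀ x : G.B ⊕ Fin k, Sum.map id σ (H.wire (Sum.map f.B id x))
      = Sum.map f.A id (Sum.map id σ (G.wire x)) from h
    intro x
    rw [f.wire]
    rcases G.wire x with y | y <;> rfl
  loops := f.loops

def Iso.ract {G H : PortGraph k l} (f : Iso G H) (τ : Equiv.Perm (Fin k)) :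
    Iso (G.ract τ) (H.ract τ) where
  V := f.V
  A := f.A
  B := f.B
  target := f.target
  source := f.source
  wire := by
    suffices h : ∀ x : G.B ⊕ Fin k, H.wire (Sum.map id τ (Sum.map f.B id x))
      = Sum.map f.A id (G.wire (Sum.map id τ x)) from h
    intro x
    rw [← f.wire]
    rcases x with y | y <;> rfl
  loops := f.loops

end PortGraph

namespace InOutGraph

open TraPs

variable {k l k' l' : ℕ}

theorem tr_act_equiv (i : Fin (k + 1)) (j : Fin (l + 1)) (σ : Equiv.Perm (Fin (l + 1)))
    (τ : Equiv.Perm (Fin (k + 1))) (G : InOutGraph (k + 1) (l + 1)) :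
    ((G.lact σ).ract τ).tr i j
      ≈ ((G.tr (τ i) (σ⁻¹ j)).lact (permRemove σ j)).ract (permRemove τ (τ i)) := by
  obtain ⟨f⟩ := toPort_tr (τ i) (σ⁻¹ j) G
  obtain ⟨g⟩ := toPort_tr i j ((G.lact σ).ract τ)
  have h : PortGraph.Iso ((G.lact σ).ract τ).toPort ((G.toPort.lact σ).ract τ) :=
    (toPort_ract τ _).trans ((toPort_lact σ G).ract τ)
  have h' := (toPort_ract (permRemove τ (τ i)) ((G.tr (τ i) (σ⁻¹ j)).lact (permRemove σ j))).trans
    ((toPort_lact (permRemove σ j) (G.tr (τ i) (σ⁻¹ j))).ract _)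
  exact equiv_of_toPort ((g.trans (h.tr i j)).trans
    ((h'.trans ((f.lact _).ract _)).trans (PortGraph.trAct i j σ τ G.toPort)).symm)

theorem tr_hcomp_left_equiv (i : Fin (k + 1)) (j : Fin (l + 1)) (G : InOutGraph (k + 1) (l + 1))
    (H : InOutGraph k' l') :
    ((G.hcomp H).cast (Nat.add_right_comm k 1 k') (Nat.add_right_comm l 1 l')).tr
        ⟨i, by omega⟩ ⟨j, by omega⟩ ≈ (G.tr i j).hcomp H := by
  obtain ⟨f⟩ := toPort_tr i j G
  obtain ⟨g⟩ := toPort_tr (k := k + k') (l := l + l') ⟨i, by omega⟩ ⟨j, by omega⟩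
    ((G.hcomp H).cast (Nat.add_right_comm k 1 k') (Nat.add_right_comm l 1 l'))
  have h := (toPort_cast (Nat.add_right_comm k 1 k') (Nat.add_right_comm l 1 l')
    (G.hcomp H)).trans ((toPort_hcomp G H).cast _ _)
  have h' := (toPort_hcomp (G.tr i j) H).trans (f.hcomp
    (PortGraph.Iso.trans (H := H.toPort) (Iso.toPort (Iso.refl H)) (Iso.toPort (Iso.refl H))))
  exact equiv_of_toPort ((g.trans (h.tr _ _)).trans
    (h'.trans (PortGraph.trHcompLeft i j G.toPort H.toPort)).symm)

theorem tr_hcomp_right_equiv (i : Fin (k' + 1)) (j : Fin (l' + 1)) (G : InOutGraph k l)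
    (H : InOutGraph (k' + 1) (l' + 1)) :
    tr (k := k + k') (l := l + l') (Fin.natAdd k i) (Fin.natAdd l j) (G.hcomp H)
      ≈ G.hcomp (H.tr i j) := by
  obtain ⟨f⟩ := toPort_tr i j H
  obtain ⟨g⟩ := toPort_tr (k := k + k') (l := l + l') (Fin.natAdd k i) (Fin.natAdd l j)
    (G.hcomp H)
  have h' := (toPort_hcomp G (H.tr i j)).trans ((Iso.toPort (Iso.refl G)).hcomp f)
  exact equiv_of_toPort ((g.trans ((toPort_hcomp G H).tr (k := k + k') (l := l + l') _ _)).trans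
    (h'.trans (PortGraph.trHcompRight i j G.toPort H.toPort)).symm)

theorem tr_zero_succ_equiv (j : Fin l) (G : InOutGraph k l) :
    ((unit₁.hcomp G).cast (Nat.add_comm 1 k) (Nat.add_comm 1 l)).tr 0 j.succ
      ≈ G.lact j.cycleRange := by
  obtain _ | l := l
  · exact j.elim0
  obtain ⟨g⟩ := toPort_tr 0 j.succ ((unit₁.hcomp G).cast (Nat.add_comm 1 k) (Nat.add_comm 1 _))
  have h := (toPort_cast (Nat.add_comm 1 k) (Nat.add_comm 1 (l + 1)) (unit₁.hcomp G)).trans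
    (((toPort_hcomp unit₁ G).trans (toPort_unit₁.hcomp (Iso.toPort (Iso.refl G)))).cast _ _)
  exact equiv_of_toPort ((g.trans (h.tr _ _)).trans
    ((toPort_lact _ G).trans (PortGraph.trZeroSucc j G.toPort)).symm)

theorem tr_succ_zero_equiv (i : Fin k) (G : InOutGraph k l) :
    ((unit₁.hcomp G).cast (Nat.add_comm 1 k) (Nat.add_comm 1 l)).tr i.succ 0
      ≈ G.ract i.cycleRange⁻¹ := by
  obtain _ | k := k
  · exact i.elim0
  obtain ⟨g⟩ := toPort_tr i.succ 0 ((unit₁.hcomp G).cast (Nat.add_comm 1 _) (Nat.add_comm 1 l))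
  have h := (toPort_cast (Nat.add_comm 1 (k + 1)) (Nat.add_comm 1 l) (unit₁.hcomp G)).trans
    (((toPort_hcomp unit₁ G).trans (toPort_unit₁.hcomp (Iso.toPort (Iso.refl G)))).cast _ _)
  exact equiv_of_toPort ((g.trans (h.tr _ _)).trans
    ((toPort_ract _ G).trans (PortGraph.trSuccZero i G.toPort)).symm)

theorem tr_last_castSucc_equiv (j : Fin (l + 1)) (G : InOutGraph k (l + 1)) :
    (G.hcomp unit₁).tr (Fin.last k) j.castSucc
      ≈ G.lact (Fin.cycleIcc j (Fin.last l))⁻¹ := by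
  obtain ⟨g⟩ := toPort_tr (Fin.last k) j.castSucc (G.hcomp unit₁)
  have h := (toPort_hcomp G unit₁).trans ((Iso.toPort (Iso.refl G)).hcomp toPort_unit₁)
  exact equiv_of_toPort ((g.trans (h.tr _ _)).trans
    ((toPort_lact _ G).trans (PortGraph.trLastCastSucc j G.toPort)).symm)

theorem tr_castSucc_last_equiv (i : Fin (k + 1)) (G : InOutGraph (k + 1) l) :
    (G.hcomp unit₁).tr i.castSucc (Fin.last l)
      ≈ G.ract (Fin.cycleIcc i (Fin.last k)) := by
  obtain ⟨g⟩ := toPort_tr i.castSucc (Fin.last l) (G.hcomp unit₁)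
  have h := (toPort_hcomp G unit₁).trans ((Iso.toPort (Iso.refl G)).hcomp toPort_unit₁)
  exact equiv_of_toPort ((g.trans (h.tr _ _)).trans
    ((toPort_ract _ G).trans (PortGraph.trCastSuccLast i G.toPort)).symm)

/-- A permutation of the numbers is undone by a permutation of the edges, since all edges of a
corolla have the same vertex as extremity. -/
theorem corolla_act_equiv (σ : Equiv.Perm (Fin l)) (τ : Equiv.Perm (Fin k)) :
    ((corolla k l).ract τ).lact σ ≈ corolla k l :=
  ⟨{ V := Equiv.refl _
     E := Equiv.refl _
     I := τ.symm
     O := σ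
     InOut := Equiv.refl _
     L := Equiv.refl _
     s_E := fun _ => rfl
     s_O := fun _ => rfl
     t_E := fun _ => rfl
     t_I := fun _ => rfl
     α_I := fun _ => rfl
     α_InOut := fun e => e.elim
     β_O := fun _ => rfl
     β_InOut := fun e => e.elim }⟩

end InOutGraph

/-! ### The TraP structure on the linear span of graphs. -/

namespace TraPData

variable {𝕂 : Type u} [Field 𝕂] (P : TraPData.{u, v} 𝕂) {k l k' l' : ℕ}

@[simp] theorem reindex_zero (hk : k = k') (hl : l = l') :
    P.reindex hk hl (0 : P.carrier k l) = 0 := by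
  subst hk hl; rfl

@[simp] theorem reindex_add (hk : k = k') (hl : l = l') (p q : P.carrier k l) :
    P.reindex hk hl (p + q) = P.reindex hk hl p + P.reindex hk hl q := by
  subst hk hl; rfl

@[simp] theorem reindex_smul (hk : k = k') (hl : l = l') (c : 𝕂) (p : P.carrier k l) :
    P.reindex hk hl (c • p) = c • P.reindex hk hl p := by
  subst hk hl; rfl

end TraPData

namespace graphTraP

open TraPs

variable {𝕂 : Type u} [Field 𝕂] {k l k' l' : ℕ}

/-- The basis element given by a graph. -/
noncomputable def basis (G : InOutGraph k l) : (graphTraP 𝕂).carrier k l :=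
  Finsupp.single (Quotient.mk _ G) (1 : 𝕂)

theorem basis_eq {G H : InOutGraph k l} (h : G ≈ H) : basis (𝕂 := 𝕂) G = basis H :=
  congrArg (fun x : InOutGraphClass k l => Finsupp.single x (1 : 𝕂)) (Quotient.sound h)

theorem lact_basis (σ : Equiv.Perm (Fin l)) (G : InOutGraph k l) :
    (graphTraP 𝕂).lact σ (basis G) = basis (G.lact σ) :=
  Finsupp.mapDomain_single

theorem ract_basis (τ : Equiv.Perm (Fin k)) (G : InOutGraph k l) :
    (graphTraP 𝕂).ract τ (basis G) = basis (G.ract τ) :=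
  Finsupp.mapDomain_single

theorem tr_basis (i : Fin (k + 1)) (j : Fin (l + 1)) (G : InOutGraph (k + 1) (l + 1)) :
    (graphTraP 𝕂).tr i j (basis G) = basis (G.tr i j) :=
  Finsupp.mapDomain_single

theorem hcomp_basis (G : InOutGraph k l) (H : InOutGraph k' l') :
    (graphTraP 𝕂).hcomp (basis G) (basis H) = basis (G.hcomp H) := by
  have h : Finsupp.linearCombination 𝕂
      (fun G : InOutGraphClass k l =>
        Finsupp.lmapDomain 𝕂 𝕂 (InOutGraphClass.hcomp (k' := k') (l' := l') G))
      (Finsupp.single (Quotient.mk _ G) (1 : 𝕂))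
      = Finsupp.lmapDomain 𝕂 𝕂 (InOutGraphClass.hcomp (Quotient.mk _ G)) := by
    rw [Finsupp.linearCombination_single, one_smul]
  exact (LinearMap.congr_fun h _).trans Finsupp.mapDomain_single

theorem reindex_basis (hk : k = k') (hl : l = l') (G : InOutGraph k l) :
    (graphTraP 𝕂).reindex hk hl (basis G) = basis (G.cast hk hl) := by
  subst hk hl; rfl

/-- The axioms are linear in each argument, hence need only be checked on classes of graphs. -/
theorem induction {p : (graphTraP 𝕂).carrier k l → Prop}
    (zero : p 0) (add : ∀ x y, p x → p y → p (x + y)) (smul : ∀ (c : 𝕂) x, p x → p (c • x))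
    (basis : ∀ G, p (basis G)) (x) : p x := by
  refine Finsupp.induction_linear (motive := p) x zero add fun G c => ?_
  induction G using Quotient.inductionOn with
  | h G =>
    have h := smul c _ (basis G)
    have h' : c • graphTraP.basis (𝕂 := 𝕂) G = Finsupp.single (Quotient.mk _ G) c :=
      (Finsupp.smul_single c _ _).trans (by rw [smul_eq_mul, mul_one])
    rwa [h'] at h

theorem isTraP : (graphTraP 𝕂).IsTraP where
  one_lact p := by
    induction p using induction with
    | zero => simp
    | add x y hx hy => simp [hx, hy]
    | smul c x hx => simp [hx]
    | basis G => rw [lact_basis]; exact basis_eq G.one_lact_equiv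
  ract_one p := by
    induction p using induction with
    | zero => simp
    | add x y hx hy => simp [hx, hy]
    | smul c x hx => simp [hx]
    | basis G => rw [ract_basis]; exact basis_eq G.ract_one_equiv
  mul_lact σ σ' p := by
    induction p using induction with
    | zero => simp
    | add x y hx hy => simp [hx, hy]
    | smul c x hx => simp [hx]
    | basis G => rw [lact_basis, lact_basis, lact_basis]; rfl
  ract_mul τ τ' p := by
    induction p using induction with
    | zero => simp
    | add x y hx hy => simp [hx, hy]
    | smul c x hx => simp [hx]
    | basis G => rw [ract_basis, ract_basis, ract_basis]; rfl
  lact_ract σ τ p := by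
    induction p using induction with
    | zero => simp
    | add x y hx hy => simp [hx, hy]
    | smul c x hx => simp [hx]
    | basis G => rw [ract_basis, lact_basis, lact_basis, ract_basis]; rfl
  hcomp_assoc p p' p'' := by
    induction p using induction with
    | zero => simp
    | add x y hx hy => simp [hx, hy]
    | smul c x hx => simp [hx]
    | basis G =>
    induction p' using induction with
    | zero => simp
    | add x y hx hy => simp [hx, hy]
    | smul c x hx => simp [hx]
    | basis G' =>
    induction p'' using induction with
    | zero => simp
    | add x y hx hy => simp [hx, hy]
    | smul c x hx => simp [hx]
    | basis G'' =>
      simp only [hcomp_basis, reindex_basis]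
      exact basis_eq (G.hcomp_assoc_equiv G' G'')
  unit₀_hcomp p := by
    induction p using induction with
    | zero => simp
    | add x y hx hy => simp [hx, hy]
    | smul c x hx => simp [hx]
    | basis G =>
      refine (congrArg _ (hcomp_basis InOutGraph.unit₀ G)).trans ?_
      rw [reindex_basis]
      exact basis_eq G.unit₀_hcomp_equiv
  hcomp_unit₀ p := by
    induction p using induction with
    | zero => simp
    | add x y hx hy => simp [hx, hy]
    | smul c x hx => simp [hx]
    | basis G => exact (hcomp_basis G InOutGraph.unit₀).trans (basis_eq G.hcomp_unit₀_equiv)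
  hcomp_act p p' σ τ σ' τ' := by
    induction p using induction with
    | zero => simp
    | add x y hx hy => simp [hx, hy]
    | smul c x hx => simp [hx]
    | basis G =>
    induction p' using induction with
    | zero => simp
    | add x y hx hy => simp [hx, hy]
    | smul c x hx => simp [hx]
    | basis G' =>
      simp only [lact_basis, ract_basis, hcomp_basis]
      exact basis_eq (G.hcomp_act_equiv G' σ τ σ' τ')
  hcomp_comm p p' := by
    induction p using induction with
    | zero => simp
    | add x y hx hy => simp [hx, hy]
    | smul c x hx => simp [hx]
    | basis G =>
    induction p' using induction with
    | zero => simp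
    | add x y hx hy => simp [hx, hy]
    | smul c x hx => simp [hx]
    | basis G' =>
      simp only [hcomp_basis, lact_basis, reindex_basis, ract_basis]
      exact basis_eq (G.hcomp_comm_equiv G')
  tr_tr i j i' j' p := by
    induction p using induction with
    | zero => simp
    | add x y hx hy => simp [hx, hy]
    | smul c x hx => simp [hx]
    | basis G =>
      simp only [tr_basis]
      exact basis_eq (G.tr_tr_equiv i j i' j')
  tr_act i j σ τ p := by
    induction p using induction with
    | zero => simp
    | add x y hx hy => simp [hx, hy]
    | smul c x hx => simp [hx]
    | basis G =>
      simp only [lact_basis, ract_basis, tr_basis]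
      exact basis_eq (G.tr_act_equiv i j σ τ)
  tr_hcomp_left i j p p' := by
    induction p using induction with
    | zero => simp
    | add x y hx hy => simp [hx, hy]
    | smul c x hx => simp [hx]
    | basis G =>
    induction p' using induction with
    | zero => simp
    | add x y hx hy => simp [hx, hy]
    | smul c x hx => simp [hx]
    | basis G' =>
      simp only [hcomp_basis, reindex_basis, tr_basis]
      exact basis_eq (G.tr_hcomp_left_equiv i j G')
  tr_hcomp_right {k l k' l'} i j p p' := by
    induction p using induction with
    | zero => simp
    | add x y hx hy => simp [hx, hy]
    | smul c x hx => simp [hx]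
    | basis G =>
    induction p' using induction with
    | zero => simp
    | add x y hx hy => simp_all
    | smul c x hx => simp_all
    | basis G' =>
      rw [tr_basis, hcomp_basis, hcomp_basis]
      exact (tr_basis (k := k + k') (l := l + l') _ _ _).trans
        (basis_eq (G.tr_hcomp_right_equiv i j G'))
  tr_zero_succ_unit₁_hcomp j p := by
    induction p using induction with
    | zero => simp
    | add x y hx hy => simp [hx, hy]
    | smul c x hx => simp [hx]
    | basis G =>
      refine (congrArg _ (congrArg _ (hcomp_basis InOutGraph.unit₁ G))).trans ?_
      rw [reindex_basis, tr_basis, lact_basis]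
      exact basis_eq (G.tr_zero_succ_equiv j)
  tr_succ_zero_unit₁_hcomp i p := by
    induction p using induction with
    | zero => simp
    | add x y hx hy => simp [hx, hy]
    | smul c x hx => simp [hx]
    | basis G =>
      refine (congrArg _ (congrArg _ (hcomp_basis InOutGraph.unit₁ G))).trans ?_
      rw [reindex_basis, tr_basis, ract_basis]
      exact basis_eq (G.tr_succ_zero_equiv i)
  tr_last_castSucc_hcomp_unit₁ j p := by
    induction p using induction with
    | zero => simp
    | add x y hx hy => simp [hx, hy]
    | smul c x hx => simp [hx]
    | basis G =>
      refine (congrArg _ (hcomp_basis G InOutGraph.unit₁)).trans ?_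
      rw [tr_basis, lact_basis]
      exact basis_eq (G.tr_last_castSucc_equiv j)
  tr_castSucc_last_hcomp_unit₁ i p := by
    induction p using induction with
    | zero => simp
    | add x y hx hy => simp [hx, hy]
    | smul c x hx => simp [hx]
    | basis G =>
      refine (congrArg _ (hcomp_basis G InOutGraph.unit₁)).trans ?_
      rw [tr_basis, ract_basis]
      exact basis_eq (G.tr_castSucc_last_equiv i)

theorem corolla_invariant (σ : Equiv.Perm (Fin l)) (τ : Equiv.Perm (Fin k)) :
    (graphTraP 𝕂).lact σ ((graphTraP 𝕂).ract τ (corolla 𝕂 k l)) = corolla 𝕂 k l := by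
  refine (congrArg _ (ract_basis τ (InOutGraph.corolla k l))).trans ?_
  rw [lact_basis]
  exact basis_eq (InOutGraph.corolla_act_equiv σ τ)

end graphTraP

/-! ### Labelled elements of a TraP and their commutative product. -/

namespace TraPs

/-- An element of `P(k,l)` whose inputs are labelled by `A` and whose outputs are labelled by
`B`. -/
structure PreLabelled {𝕂 : Type u} [Field 𝕂] (P : TraPData.{u, v} 𝕂) (A B : Type) where
  k : ℕ
  l : ℕ
  p : P.carrier k l
  a : Fin k → A
  b : Fin l → B

variable {𝕂 : Type u} [Field 𝕂] {P : TraPData.{u, v} 𝕂}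

/-- The labelled elements are considered up to renumbering. -/
def PreLabelled.rel {A B : Type} (x y : PreLabelled P A B) : Prop :=
  ∃ (hk : x.k = y.k) (hl : x.l = y.l) (σ : Equiv.Perm (Fin x.l)) (τ : Equiv.Perm (Fin x.k)),
    y.p = P.reindex hk hl (P.lact σ (P.ract τ x.p)) ∧
    (∀ i, y.a (Fin.cast hk i) = x.a (τ i)) ∧ ∀ j, y.b (Fin.cast hl (σ j)) = x.b j

/-- Renumbering is an equivalence relation. -/
def PreLabelled.setoid (h : P.IsTraP) (A B : Type) : Setoid (PreLabelled P A B) where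
  r := PreLabelled.rel
  iseqv := {
    refl := fun x => ⟨rfl, rfl, 1, 1, by rw [h.one_lact, h.ract_one]; rfl, fun _ => rfl,
      fun _ => rfl⟩
    symm := by
      rintro ⟨k, l, p, a, b⟩ ⟨k', l', p', a', b'⟩ ⟨hk, hl, σ, τ, hp, ha, hb⟩
      dsimp only at hk hl σ τ hp ha hb
      subst hk hl
      refine ⟨rfl, rfl, σ⁻¹, τ⁻¹, ?_, fun i => ?_, fun j => ?_⟩
      · change p = P.lact σ⁻¹ (P.ract τ⁻¹ p')
        rw [hp]
        change p = P.lact σ⁻¹ (P.ract τ⁻¹ (P.lact σ (P.ract τ p)))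
        rw [h.lact_ract, h.mul_lact, inv_mul_cancel, h.one_lact, h.ract_mul, mul_inv_cancel,
          h.ract_one]
      · have := ha (τ⁻¹ i)
        simpa using this.symm
      · have := hb (σ⁻¹ j)
        simpa using this.symm
    trans := by
      rintro ⟨k, l, p, a, b⟩ ⟨k', l', p', a', b'⟩ ⟨k'', l'', p'', a'', b''⟩
        ⟨hk, hl, σ, τ, hp, ha, hb⟩ ⟨hk', hl', σ', τ', hp', ha', hb'⟩
      dsimp only at hk hl σ τ hp ha hb hk' hl' σ' τ' hp' ha' hb'
      subst hk hl hk' hl'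
      refine ⟨rfl, rfl, σ' * σ, τ * τ', ?_, fun i => ?_, fun j => ?_⟩
      · change p'' = P.lact (σ' * σ) (P.ract (τ * τ') p)
        rw [hp', hp]
        change P.lact σ' (P.ract τ' (P.lact σ (P.ract τ p))) = _
        rw [← h.lact_ract, h.mul_lact, h.ract_mul]
      · exact (ha' i).trans (ha (τ' i))
      · exact (hb' (σ j)).trans (hb j) }

/-- The elements of a TraP whose inputs are labelled by `A` and whose outputs are labelled
by `B`. -/
def Labelled (h : P.IsTraP) (A B : Type) : Type v :=
  Quotient (PreLabelled.setoid h A B)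

namespace Labelled

variable {h : P.IsTraP} {A B A' B' A'' B'' : Type} {k l k' l' : ℕ}

/-- The class of a labelled element. -/
def mk (h : P.IsTraP) (p : P.carrier k l) (a : Fin k → A) (b : Fin l → B) : Labelled h A B :=
  Quotient.mk (PreLabelled.setoid h A B) ⟨k, l, p, a, b⟩

theorem ind {motive : Labelled h A B → Prop}
    (H : ∀ k l (p : P.carrier k l) (a : Fin k → A) (b : Fin l → B), motive (mk h p a b))
    (m : Labelled h A B) : motive m :=
  Quotient.ind (fun _ => H _ _ _ _ _) m

theorem mk_eq_mk_iff {p : P.carrier k l} {a : Fin k → A} {b : Fin l → B}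
    {p' : P.carrier k' l'} {a' : Fin k' → A} {b' : Fin l' → B} :
    mk h p a b = mk h p' a' b' ↔ ∃ (hk : k = k') (hl : l = l') (σ : Equiv.Perm (Fin l))
      (τ : Equiv.Perm (Fin k)), p' = P.reindex hk hl (P.lact σ (P.ract τ p)) ∧
      (∀ i, a' (Fin.cast hk i) = a (τ i)) ∧ ∀ j, b' (Fin.cast hl (σ j)) = b j :=
  Quotient.eq (r := PreLabelled.setoid h A B)

theorem mk_reindex (hk : k = k') (hl : l = l') (p : P.carrier k l) (a : Fin k' → A)
    (b : Fin l' → B) :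
    mk h (P.reindex hk hl p) a b = mk h p (a ∘ Fin.cast hk) (b ∘ Fin.cast hl) := by
  subst hk hl; rfl

theorem mk_lact (σ : Equiv.Perm (Fin l)) (p : P.carrier k l) (a : Fin k → A) (b : Fin l → B) :
    mk h (P.lact σ p) a b = mk h p a (b ∘ σ) :=
  (mk_eq_mk_iff.2 ⟨rfl, rfl, σ, 1, by rw [h.ract_one]; rfl, fun _ => rfl, fun _ => rfl⟩).symm

/-- Input `i` of `p · τ` is input `τ i` of `p`. With `mk_lact`, this lets labels absorb both
actions, so permutations disappear from what follows. -/
theorem mk_ract (τ : Equiv.Perm (Fin k)) (p : P.carrier k l) (a : Fin k → A) (b : Fin l → B) :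
    mk h (P.ract τ p) a b = mk h p (a ∘ τ.symm) b :=
  (mk_eq_mk_iff.2 ⟨rfl, rfl, 1, τ, by rw [h.one_lact]; rfl, fun _ => by simp, fun _ => rfl⟩).symm

/-- Elements with injective labellings are determined by their class. -/
theorem mk_injective {p p' : P.carrier k l} {a : Fin k → A} {b : Fin l → B}
    (ha : Function.Injective a) (hb : Function.Injective b) (H : mk h p a b = mk h p' a b) :
    p = p' := by
  obtain ⟨hk, hl, σ, τ, hp, ha', hb'⟩ := mk_eq_mk_iff.1 H
  have hτ : τ = 1 := Equiv.ext fun i => (ha (ha' i)).symm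
  have hσ : σ = 1 := Equiv.ext fun j => hb (hb' j)
  rw [hp, hτ, hσ, h.one_lact, h.ract_one]
  rfl

/-- Change of labels. -/
def map (f : A → A') (g : B → B') : Labelled h A B → Labelled h A' B' :=
  Quotient.map' (s₁ := PreLabelled.setoid h A B) (s₂ := PreLabelled.setoid h A' B')
    (fun x => ⟨x.k, x.l, x.p, f ∘ x.a, g ∘ x.b⟩) <| by
    rintro x y ⟨hk, hl, σ, τ, hp, ha, hb⟩
    exact ⟨hk, hl, σ, τ, hp, fun i => congrArg f (ha i), fun j => congrArg g (hb j)⟩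

theorem map_mk (f : A → A') (g : B → B') (p : P.carrier k l) (a : Fin k → A) (b : Fin l → B) :
    map f g (mk h p a b) = mk h p (f ∘ a) (g ∘ b) := rfl

theorem map_map (f : A → A') (g : B → B') (f' : A' → A'') (g' : B' → B'')
    (m : Labelled h A B) : map f' g' (map f g m) = map (f' ∘ f) (g' ∘ g) m := by
  induction m using ind
  rfl

theorem append_permTensor {X : Type} (a : Fin k → X) (a' : Fin k' → X) (τ : Equiv.Perm (Fin k))
    (τ' : Equiv.Perm (Fin k')) (i : Fin (k + k')) :
    Fin.append a a' (permTensor τ τ' i) = Fin.append (a ∘ τ) (a' ∘ τ') i := by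
  refine Fin.addCases (fun i => ?_) (fun i => ?_) i
  · rw [permTensor_castAdd, Fin.append_left, Fin.append_left]; rfl
  · rw [permTensor_natAdd, Fin.append_right, Fin.append_right]; rfl

/-- The product of labelled elements. -/
def mul : Labelled h A B → Labelled h A B → Labelled h A B :=
  Quotient.map₂ (sa := PreLabelled.setoid h A B) (sb := PreLabelled.setoid h A B)
    (sc := PreLabelled.setoid h A B)
    (fun x y => ⟨x.k + y.k, x.l + y.l, P.hcomp x.p y.p, Fin.append x.a y.a, Fin.append x.b y.b⟩) <| by
    rintro ⟨k, l, p, a, b⟩ ⟨k', l', p', a', b'⟩ ⟨hk, hl, σ, τ, hp, ha, hb⟩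
      ⟨k₁, l₁, p₁, a₁, b₁⟩ ⟨k₁', l₁', p₁', a₁', b₁'⟩ ⟨hk₁, hl₁, σ₁, τ₁, hp₁, ha₁, hb₁⟩
    dsimp only at hk hl σ τ hp ha hb hk₁ hl₁ σ₁ τ₁ hp₁ ha₁ hb₁
    subst hk hl hk₁ hl₁
    refine ⟨rfl, rfl, permTensor σ σ₁, permTensor τ τ₁, ?_, fun i => ?_, fun i => ?_⟩
    · change P.hcomp p' p₁' = P.lact (permTensor σ σ₁) (P.ract (permTensor τ τ₁) (P.hcomp p p₁))
      rw [hp, hp₁, h.lact_ract (permTensor σ σ₁), ← h.hcomp_act, ← h.lact_ract, ← h.lact_ract]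
      rfl
    · change Fin.append a' a₁' i = Fin.append a a₁ (permTensor τ τ₁ i)
      rw [append_permTensor]
      congr 1
      · exact funext ha
      · exact funext ha₁
    · change Fin.append b' b₁' (permTensor σ σ₁ i) = Fin.append b b₁ i
      rw [append_permTensor]
      congr 1
      · exact funext hb
      · exact funext hb₁

theorem append_blockSwap {X : Type} (a : Fin k → X) (a' : Fin k' → X) (i : Fin (k + k')) :
    Fin.append a' a (Fin.cast (Nat.add_comm k k') (blockSwap k k' i)) = Fin.append a a' i := by
  refine Fin.addCases (fun i => ?_) (fun i => ?_) i
  · rw [blockSwap_castAdd, Fin.append_left]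
    exact Fin.append_right _ _ _
  · rw [blockSwap_natAdd, Fin.append_right]
    exact Fin.append_left _ _ _

/-- The product of a TraP commutes only up to block permutations, which the labels absorb. Products
over the unordered vertices and inputs of a graph thereby make sense. -/
instance : CommMonoid (Labelled h A B) where
  mul := mul
  one := mk h P.unit₀ Fin.elim0 Fin.elim0
  mul_assoc x y z := by
    induction x using ind with | H k l p a b =>
    induction y using ind with | H k' l' p' a' b' =>
    induction z using ind with | H k'' l'' p'' a'' b'' =>
    change mk h (P.hcomp (P.hcomp p p') p'') _ _ = mk h (P.hcomp p (P.hcomp p' p'')) _ _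
    rw [← h.hcomp_assoc, mk_reindex, ← Fin.append_assoc, ← Fin.append_assoc]
  one_mul x := by
    induction x using ind with | H k l p a b =>
    change mk h (P.hcomp P.unit₀ p) _ _ = _
    conv_rhs => rw [← h.unit₀_hcomp p, mk_reindex]
    rw [Fin.elim0_append, Fin.elim0_append]
  mul_one x := by
    induction x using ind with | H k l p a b =>
    change mk h (P.hcomp p P.unit₀) _ _ = _
    rw [h.hcomp_unit₀, Fin.append_elim0, Fin.append_elim0]
    rfl
  mul_comm x y := by
    induction x using ind with | H k l p a b =>
    induction y using ind with | H k' l' p' a' b' =>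
    change mk h (P.hcomp p p') _ _ = mk h (P.hcomp p' p) _ _
    -- The axiom `hcomp_comm` is read with labels chosen so that the block permutations on the two
    -- sides turn into reorderings of the appended labels.
    have h₁ := congrArg (fun q => mk h q (Fin.append a a')
      (Fin.append b' b ∘ Fin.cast (Nat.add_comm l l'))) (h.hcomp_comm p p')
    simp only [mk_lact, mk_ract, mk_reindex] at h₁
    convert h₁ using 2
    · exact funext fun i => (append_blockSwap b b' i).symm
    rotate_left
    · rfl
    · funext i
      obtain ⟨i, rfl⟩ := (finCongr (Nat.add_comm k k')).surjective i
      obtain ⟨i, rfl⟩ := (blockSwap k k').surjective i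
      simp [append_blockSwap]

theorem mk_mul_mk (p : P.carrier k l) (a : Fin k → A) (b : Fin l → B)
    (p' : P.carrier k' l') (a' : Fin k' → A) (b' : Fin l' → B) :
    mk h p a b * mk h p' a' b' = mk h (P.hcomp p p') (Fin.append a a') (Fin.append b b') := rfl

theorem one_eq (a : Fin 0 → A) (b : Fin 0 → B) : (1 : Labelled h A B) = mk h P.unit₀ a b := by
  rw [Subsingleton.elim a Fin.elim0, Subsingleton.elim b Fin.elim0]; rfl

theorem comp_append {X Y : Type} (f : X → Y) (a : Fin k → X) (a' : Fin k' → X) :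
    f ∘ Fin.append a a' = Fin.append (f ∘ a) (f ∘ a') := by
  funext i
  refine Fin.addCases (fun i => ?_) (fun i => ?_) i <;> simp

/-- Change of labels is multiplicative. -/
def mapHom (f : A → A') (g : B → B') : Labelled h A B →* Labelled h A' B' where
  toFun := map f g
  map_one' := by rw [one_eq Fin.elim0 Fin.elim0, map_mk, ← one_eq]
  map_mul' x y := by
    induction x using ind with | H k l p a b =>
    induction y using ind with | H k' l' p' a' b' =>
    rw [mk_mul_mk, map_mk, map_mk, map_mk, mk_mul_mk]
    rw [comp_append, comp_append]

theorem map_mul (f : A → A') (g : B → B') (m n : Labelled h A B) :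
    map f g (m * n) = map f g m * map f g n := (mapHom f g).map_mul m n

theorem map_one (f : A → A') (g : B → B') : map f g (1 : Labelled h A B) = 1 :=
  (mapHom f g).map_one

theorem map_prod {ι : Type} [Fintype ι] (f : A → A') (g : B → B') (m : ι → Labelled h A B) :
    map f g (∏ i, m i) = ∏ i, map f g (m i) := _root_.map_prod (mapHom f g) m _

theorem map_pow (f : A → A') (g : B → B') (m : Labelled h A B) (n : ℕ) :
    map f g (m ^ n) = map f g m ^ n := (mapHom f g).map_pow m n

theorem map_id (m : Labelled h A B) : map id id m = m := by
  induction m using ind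
  rfl

/-- The labels of the inputs. -/
def inLabels : Labelled h A B → Multiset A :=
  Quotient.lift (s := PreLabelled.setoid h A B) (fun x => Finset.univ.val.map x.a) <| by
    rintro ⟨k, l, p, a, b⟩ ⟨k', l', p', a', b'⟩ ⟨hk, hl, σ, τ, hp, ha, hb⟩
    dsimp only at hk hl σ τ hp ha hb
    subst hk hl
    have : a' = a ∘ τ := funext ha
    subst this
    change Finset.univ.val.map a = Finset.univ.val.map (a ∘ τ)
    rw [← Multiset.map_map, ← Equiv.coe_toEmbedding, ← Finset.map_val, Finset.map_univ_equiv]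

/-- The labels of the outputs. -/
def outLabels : Labelled h A B → Multiset B :=
  Quotient.lift (s := PreLabelled.setoid h A B) (fun x => Finset.univ.val.map x.b) <| by
    rintro ⟨k, l, p, a, b⟩ ⟨k', l', p', a', b'⟩ ⟨hk, hl, σ, τ, hp, ha, hb⟩
    dsimp only at hk hl σ τ hp ha hb
    subst hk hl
    have : b = b' ∘ σ := funext fun j => (hb j).symm
    subst this
    change Finset.univ.val.map (b' ∘ σ) = Finset.univ.val.map b'
    rw [← Multiset.map_map, ← Equiv.coe_toEmbedding, ← Finset.map_val, Finset.map_univ_equiv]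

theorem inLabels_mk (p : P.carrier k l) (a : Fin k → A) (b : Fin l → B) :
    inLabels (mk h p a b) = Finset.univ.val.map a := rfl

theorem outLabels_mk (p : P.carrier k l) (a : Fin k → A) (b : Fin l → B) :
    outLabels (mk h p a b) = Finset.univ.val.map b := rfl

theorem map_append {X : Type} (a : Fin k → X) (a' : Fin k' → X) :
    (Finset.univ.val.map (Fin.append a a') : Multiset X)
      = Finset.univ.val.map a + Finset.univ.val.map a' := by
  rw [← Finset.map_univ_equiv (finSumFinEquiv (m := k) (n := k')), Finset.map_val,
    Multiset.map_map, ← Finset.univ_disjSum_univ, Finset.val_disjSum, Multiset.disjSum,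
    Multiset.map_add, Multiset.map_map, Multiset.map_map]
  congr 2 <;> funext i <;> simp

theorem inLabels_mul (m n : Labelled h A B) : inLabels (m * n) = inLabels m + inLabels n := by
  induction m using ind
  induction n using ind
  exact map_append _ _

theorem outLabels_mul (m n : Labelled h A B) : outLabels (m * n) = outLabels m + outLabels n := by
  induction m using ind
  induction n using ind
  exact map_append _ _

theorem inLabels_one : inLabels (1 : Labelled h A B) = 0 := rfl

theorem outLabels_one : outLabels (1 : Labelled h A B) = 0 := rfl

theorem inLabels_map (f : A → A') (g : B → B') (m : Labelled h A B) :
    inLabels (map f g m) = (inLabels m).map f := by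
  induction m using ind with | H k l p a b =>
  rw [map_mk, inLabels_mk, inLabels_mk, Multiset.map_map]

theorem outLabels_map (f : A → A') (g : B → B') (m : Labelled h A B) :
    outLabels (map f g m) = (outLabels m).map g := by
  induction m using ind with | H k l p a b =>
  rw [map_mk, outLabels_mk, outLabels_mk, Multiset.map_map]

theorem inLabels_prod {ι : Type} [Fintype ι] (m : ι → Labelled h A B) :
    inLabels (∏ i, m i) = ∑ i, inLabels (m i) :=
  _root_.map_prod (G := Labelled h A B →* Multiplicative (Multiset A))
    ⟨⟨inLabels, inLabels_one⟩, inLabels_mul⟩ m Finset.univ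

theorem outLabels_prod {ι : Type} [Fintype ι] (m : ι → Labelled h A B) :
    outLabels (∏ i, m i) = ∑ i, outLabels (m i) :=
  _root_.map_prod (G := Labelled h A B →* Multiplicative (Multiset B))
    ⟨⟨outLabels, outLabels_one⟩, outLabels_mul⟩ m Finset.univ

/-- A single edge. -/
def edge (h : P.IsTraP) (a : A) (b : B) : Labelled h A B :=
  mk h P.unit₁ (fun _ => a) fun _ => b

/-- A loop. -/
def loop (h : P.IsTraP) (A B : Type) : Labelled h A B :=
  mk h (P.tr 0 0 P.unit₁) Fin.elim0 Fin.elim0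

theorem map_edge (f : A → A') (g : B → B') (a : A) (b : B) :
    map f g (edge h a b) = edge h (f a) (g b) := rfl

theorem map_loop (f : A → A') (g : B → B') : map f g (loop h A B) = loop h A' B' := by
  rw [loop, map_mk, Subsingleton.elim (f ∘ _) Fin.elim0, Subsingleton.elim (g ∘ _) Fin.elim0]
  rfl

theorem inLabels_edge (a : A) (b : B) : inLabels (edge h a b) = {a} := rfl

theorem outLabels_edge (a : A) (b : B) : outLabels (edge h a b) = {b} := rfl

end Labelled

end TraPs

/-! ### Contraction of labelled elements. -/

namespace TraPs

namespace Labelled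

variable {𝕂 : Type u} [Field 𝕂] {P : TraPData.{u, v} 𝕂}
  {h : P.IsTraP} {A B A' B' : Type} {k l k' l' : ℕ}

/-- `m'` is obtained from `m` by gluing the unique input labelled by `x` to the unique output
labelled by `y`. -/
def Contract (x : A) (y : B) (m m' : Labelled h A B) : Prop :=
  ∃ (k l : ℕ) (p : P.carrier (k + 1) (l + 1)) (a : Fin (k + 1) → A) (b : Fin (l + 1) → B)
    (i : Fin (k + 1)) (j : Fin (l + 1)), m = mk h p a b ∧
    (a i = x ∧ ∀ z, a (i.succAbove z) ≠ x) ∧ (b j = y ∧ ∀ z, b (j.succAbove z) ≠ y) ∧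
    m' = mk h (P.tr i j p) (a ∘ i.succAbove) (b ∘ j.succAbove)

/-- A contraction is defined through one representative; any other representative can serve. This
independence is exactly the axiom `tr_act`. -/
theorem Contract.of_mk {x : A} {y : B} {p : P.carrier k l} {a : Fin k → A} {b : Fin l → B}
    {m' : Labelled h A B} (H : Contract x y (mk h p a b) m') :
    ∃ (k' l' : ℕ) (hk : k = k' + 1) (hl : l = l' + 1) (i : Fin (k' + 1)) (j : Fin (l' + 1)),
      (a (i.cast hk.symm) = x ∧ ∀ z, a ((i.succAbove z).cast hk.symm) ≠ x) ∧
      (b (j.cast hl.symm) = y ∧ ∀ z, b ((j.succAbove z).cast hl.symm) ≠ y) ∧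
      m' = mk h (P.tr i j (P.reindex hk hl p)) (a ∘ Fin.cast hk.symm ∘ i.succAbove)
        (b ∘ Fin.cast hl.symm ∘ j.succAbove) := by
  obtain ⟨k', l', q, c, d, i, j, hm, ⟨hx, hx'⟩, ⟨hy, hy'⟩, rfl⟩ := H
  obtain ⟨hk, hl, σ, τ, hq, hc, hd⟩ := mk_eq_mk_iff.1 hm
  subst hk hl
  replace hq : q = P.ract τ (P.lact σ p) := by rw [hq, h.lact_ract]; rfl
  replace hc : ∀ i, c i = a (τ i) := hc
  replace hd : ∀ j, d (σ j) = b j := hd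
  have hτ : ∀ z, (τ i).succAbove z = τ (i.succAbove ((permRemove τ (τ i)).symm z)) := fun z => by
    have := succAbove_permRemove τ (τ i) ((permRemove τ (τ i)).symm z)
    rwa [Equiv.apply_symm_apply, Equiv.symm_apply_apply] at this
  have hσ : ∀ z, σ ((σ⁻¹ j).succAbove z) = j.succAbove (permRemove σ j z) := fun z =>
    (succAbove_permRemove σ j z).symm
  refine ⟨k', l', rfl, rfl, τ i, σ⁻¹ j, ⟨?_, fun z => ?_⟩, ⟨?_, fun z => ?_⟩, ?_⟩
  · exact (hc i).symm.trans hx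
  · rw [Fin.cast_eq_self, hτ, ← hc]
    exact hx' _
  · rw [Fin.cast_eq_self, ← hd, Equiv.Perm.inv_def, Equiv.apply_symm_apply, hy]
  · rw [Fin.cast_eq_self, ← hd, hσ]
    exact hy' _
  · rw [hq, h.tr_act, mk_ract, mk_lact]
    congr 1
    · funext z
      exact (hc _).trans (congrArg a (hτ z).symm)
    · funext z
      exact (congrArg d (hσ z).symm).trans (hd _)

/-- On a common representative, the labels `x` and `y` occur at one place each, so the positions `i`
and `j` are determined. -/
theorem Contract.unique {x : A} {y : B} {m m₁ m₂ : Labelled h A B} (H₁ : Contract x y m m₁)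
    (H₂ : Contract x y m m₂) : m₁ = m₂ := by
  obtain ⟨k, l, p, a, b, i, j, rfl, ⟨hx, hx'⟩, ⟨hy, hy'⟩, rfl⟩ := H₁
  obtain ⟨k', l', hk, hl, i', j', ⟨hx₂, -⟩, ⟨hy₂, -⟩, rfl⟩ := H₂.of_mk
  obtain rfl : k = k' := by omega
  obtain rfl : l = l' := by omega
  rw [Fin.cast_eq_self] at hx₂ hy₂
  obtain rfl : i' = i := by
    by_contra hi
    obtain ⟨z, rfl⟩ := Fin.exists_succAbove_eq hi
    exact hx' z hx₂
  obtain rfl : j' = j := by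
    by_contra hj
    obtain ⟨z, rfl⟩ := Fin.exists_succAbove_eq hj
    exact hy' z hy₂
  rfl

/-- The axiom `tr_tr` freed from its index shifts: two pairs of labels may be contracted in either
order. -/
theorem Contract.commute {x x' : A} {y y' : B} {m m₁ m₂ : Labelled h A B}
    (H₁ : Contract x y m m₁) (H₂ : Contract x' y' m₁ m₂) :
    ∃ n, Contract x' y' m n ∧ Contract x y n m₂ := by
  obtain ⟨k, l, p, a, b, i, j, rfl, ⟨hx, hx'⟩, ⟨hy, hy'⟩, rfl⟩ := H₁
  obtain ⟨k, l, rfl, rfl, i', j', ⟨hx₂, hx₂'⟩, ⟨hy₂, hy₂'⟩, rfl⟩ := H₂.of_mk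
  simp only [Fin.cast_eq_self, Function.comp_apply] at hx₂ hx₂' hy₂ hy₂'
  refine ⟨_, ⟨_, _, p, a, b, i.succAbove i', j.succAbove j', rfl, ⟨hx₂, fun z => ?_⟩,
    ⟨hy₂, fun z => ?_⟩, rfl⟩, ⟨_, _, _, _, _, i'.predAbove i, j'.predAbove j, rfl,
      ⟨?_, fun z => ?_⟩, ⟨?_, fun z => ?_⟩, ?_⟩⟩
  -- To contract `x'` first, it must already occur once in `m`. The only input of `m` absent from
  -- `m₁` bears `x`, and `x ≠ x'` because the input bearing `x'` is another one.
  · rcases eq_or_ne z (i'.predAbove i) with rfl | hz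
    · rw [Fin.succAbove_succAbove_predAbove, hx, ← hx₂]
      exact (hx' i').symm
    · obtain ⟨z, rfl⟩ := Fin.exists_succAbove_eq hz
      rw [Fin.succAbove_succAbove_succAbove_predAbove]
      exact hx₂' z
  · rcases eq_or_ne z (j'.predAbove j) with rfl | hz
    · rw [Fin.succAbove_succAbove_predAbove, hy, ← hy₂]
      exact (hy' j').symm
    · obtain ⟨z, rfl⟩ := Fin.exists_succAbove_eq hz
      rw [Fin.succAbove_succAbove_succAbove_predAbove]
      exact hy₂' z
  · rw [Function.comp_apply, Fin.succAbove_succAbove_predAbove, hx]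
  · rw [Function.comp_apply, Fin.succAbove_succAbove_succAbove_predAbove]
    exact hx' _
  · rw [Function.comp_apply, Fin.succAbove_succAbove_predAbove, hy]
  · rw [Function.comp_apply, Fin.succAbove_succAbove_succAbove_predAbove]
    exact hy' _
  · rw [← h.tr_tr]
    congr 1
    · funext z
      exact (congrArg a (Fin.succAbove_succAbove_succAbove_predAbove i i' z)).symm
    · funext z
      exact (congrArg b (Fin.succAbove_succAbove_succAbove_predAbove j j' z)).symm

theorem map_succAbove {X : Type} (a : Fin (k + 1) → X) (i : Fin (k + 1)) :
    (Finset.univ.val.map a : Multiset X) = a i ::ₘ Finset.univ.val.map (a ∘ i.succAbove) := by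
  rw [Fin.univ_succAbove k i, Finset.cons_val, Multiset.map_cons, Finset.map_val,
    Multiset.map_map]
  rfl

theorem Contract.inLabels_eq {x : A} {y : B} {m m' : Labelled h A B} (H : Contract x y m m') :
    inLabels m = x ::ₘ inLabels m' := by
  obtain ⟨k, l, p, a, b, i, j, rfl, ⟨rfl, -⟩, ⟨rfl, -⟩, rfl⟩ := H
  exact map_succAbove a i

theorem Contract.outLabels_eq {x : A} {y : B} {m m' : Labelled h A B} (H : Contract x y m m') :
    outLabels m = y ::ₘ outLabels m' := by
  obtain ⟨k, l, p, a, b, i, j, rfl, ⟨rfl, -⟩, ⟨rfl, -⟩, rfl⟩ := H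
  exact map_succAbove b j

theorem injective_of_nodup {X : Type} {a : Fin k → X}
    (ha : (Finset.univ.val.map a : Multiset X).Nodup) : Function.Injective a :=
  fun _ _ hij => Multiset.inj_on_of_nodup_map ha _ (Finset.mem_univ_val _) _ (Finset.mem_univ_val _) hij

theorem exists_contract {x : A} {y : B} {m : Labelled h A B} (hm : (inLabels m).Nodup)
    (hm' : (outLabels m).Nodup) (hx : x ∈ inLabels m) (hy : y ∈ outLabels m) :
    ∃ m', Contract x y m m' := by
  induction m using ind with | H k l p a b =>
  rw [inLabels_mk] at hm hx
  rw [outLabels_mk] at hm' hy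
  have ha := injective_of_nodup hm
  have hb := injective_of_nodup hm'
  obtain ⟨i, -, rfl⟩ := Multiset.mem_map.1 hx
  obtain ⟨j, -, rfl⟩ := Multiset.mem_map.1 hy
  obtain _ | k := k
  · exact i.elim0
  obtain _ | l := l
  · exact j.elim0
  exact ⟨_, k, l, p, a, b, i, j, rfl, ⟨rfl, fun z => ha.ne (Fin.succAbove_ne i z)⟩,
    ⟨rfl, fun z => hb.ne (Fin.succAbove_ne j z)⟩, rfl⟩

theorem append_comp_cast_comp_succAbove {X : Type} (a : Fin (k + 1) → X) (a' : Fin k' → X)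
    (i : Fin (k + 1)) (hk : k + 1 + k' = k + k' + 1) :
    (Fin.append a a' ∘ Fin.cast hk.symm) ∘ (⟨i, by omega⟩ : Fin (k + k' + 1)).succAbove
      = Fin.append (a ∘ i.succAbove) a' := by
  funext z
  refine Fin.addCases (fun z => ?_) (fun z => ?_) z
  · rw [Function.comp_apply, Function.comp_apply, succAbove_castAdd i z hk, Fin.append_left,
      Fin.cast_cast, Fin.cast_eq_self, Fin.append_left]
    rfl
  · rw [Function.comp_apply, Function.comp_apply, succAbove_natAdd_of_left i z hk,
      Fin.append_right, Fin.cast_cast, Fin.cast_eq_self, Fin.append_right]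

/-- The axiom `tr_hcomp_left`. The labels of `n` must avoid `x` and `y`, which have to stay unique.
Commutativity of the product gives the version for a left factor. -/
theorem Contract.mul_right {x : A} {y : B} {m m' : Labelled h A B} (H : Contract x y m m')
    {n : Labelled h A B} (hx : x ∉ inLabels n) (hy : y ∉ outLabels n) :
    Contract x y (m * n) (m' * n) := by
  obtain ⟨k, l, p, a, b, i, j, rfl, ⟨ha, ha'⟩, ⟨hb, hb'⟩, rfl⟩ := H
  induction n using ind with | H k' l' p' a' b' =>
  have hk := Nat.add_right_comm k 1 k'
  have hl := Nat.add_right_comm l 1 l'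
  have hx' : ∀ z, a' z ≠ x := fun z hz => hx (Multiset.mem_map.2 ⟨z, Finset.mem_univ _, hz⟩)
  have hy' : ∀ z, b' z ≠ y := fun z hz => hy (Multiset.mem_map.2 ⟨z, Finset.mem_univ _, hz⟩)
  refine ⟨k + k', l + l', P.reindex hk hl (P.hcomp p p'), Fin.append a a' ∘ Fin.cast hk.symm,
    Fin.append b b' ∘ Fin.cast hl.symm, ⟨i, by omega⟩, ⟨j, by omega⟩, ?_, ⟨?_, fun z => ?_⟩,
    ⟨?_, fun z => ?_⟩, ?_⟩
  · rw [mk_reindex]; rfl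
  · exact (Fin.append_left a a' i).trans ha
  · have := congrFun (append_comp_cast_comp_succAbove a a' i hk) z
    rw [Function.comp_apply] at this
    rw [this]
    refine Fin.addCases (fun z => ?_) (fun z => ?_) z
    · rw [Fin.append_left]; exact ha' z
    · rw [Fin.append_right]; exact hx' z
  · exact (Fin.append_left b b' j).trans hb
  · have := congrFun (append_comp_cast_comp_succAbove b b' j hl) z
    rw [Function.comp_apply] at this
    rw [this]
    refine Fin.addCases (fun z => ?_) (fun z => ?_) z
    · rw [Fin.append_left]; exact hb' z
    · rw [Fin.append_right]; exact hy' z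
  · rw [h.tr_hcomp_left, append_comp_cast_comp_succAbove a a' i hk,
      append_comp_cast_comp_succAbove b b' j hl]
    rfl

theorem Contract.map {x : A} {y : B} {m m' : Labelled h A B} (H : Contract x y m m')
    {f : A → A'} {g : B → B'} (hf : Function.Injective f) (hg : Function.Injective g) :
    Contract (f x) (g y) (map f g m) (map f g m') := by
  obtain ⟨k, l, p, a, b, i, j, rfl, ⟨ha, ha'⟩, ⟨hb, hb'⟩, rfl⟩ := H
  exact ⟨k, l, p, f ∘ a, g ∘ b, i, j, rfl, ⟨congrArg f ha, fun z => hf.ne (ha' z)⟩,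
    ⟨congrArg g hb, fun z => hg.ne (hb' z)⟩, rfl⟩

theorem contract_edge (x : A) (y : B) : Contract x y (edge h x y) (loop h A B) :=
  ⟨0, 0, P.unit₁, _, _, 0, 0, rfl, ⟨rfl, fun z => z.elim0⟩, ⟨rfl, fun z => z.elim0⟩, by
    rw [loop, Subsingleton.elim (_ ∘ _) Fin.elim0]
    congr 1
    exact Subsingleton.elim _ _⟩

theorem edge_mul_mk (x : A) (y : B) (p : P.carrier k l) (a : Fin k → A) (b : Fin l → B) :
    edge h x y * mk h p a b
      = mk h (P.reindex (Nat.add_comm 1 k) (Nat.add_comm 1 l) (P.hcomp P.unit₁ p))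
        (Fin.cons x a) (Fin.cons y b) := by
  rw [edge, mk_mul_mk, mk_reindex, Fin.append_left_eq_cons, Fin.append_left_eq_cons]

/-- A unit axiom in terms of labels: an edge glued after the output `y` only renames it `y'`. The
case `y' = y` is excluded because the label `y` would occur twice. -/
theorem contract_edge_mul_of_out {x : A} {y y' : B} {p : P.carrier k l} {a : Fin k → A}
    {b : Fin l → B} {j : Fin l} (hx : ∀ i, a i ≠ x) (hy : y' ≠ y) (hj : b j = y)
    (hj' : ∀ z, b z = y → z = j) :
    Contract x y (edge h x y' * mk h p a b) (mk h p a (Function.update b j y')) := by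
  refine ⟨k, l, _, _, _, 0, j.succ, edge_mul_mk x y' p a b, ⟨rfl, fun z => ?_⟩,
    ⟨hj, fun z hz => ?_⟩, ?_⟩
  · rw [Fin.succAbove_zero]
    exact hx z
  · rcases eq_or_ne (j.succ.succAbove z) 0 with h0 | h0
    · rw [h0] at hz
      exact hy hz
    · obtain ⟨w, hw⟩ := Fin.exists_succ_eq.2 h0
      rw [← hw, Fin.cons_succ] at hz
      rw [hj' w hz] at hw
      exact Fin.succAbove_ne _ _ hw.symm
  -- The cycle sends `j` to `0`, the place of the new label `y'`, and matches the other positions in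
  -- order.
  · rw [h.tr_zero_succ_unit₁_hcomp, mk_lact]
    congr 1
    funext z
    obtain _ | l := l
    · exact j.elim0
    rcases eq_or_ne z j with rfl | hz
    · simp
    · rw [Function.update_of_ne hz, Function.comp_apply, Function.comp_apply]
      obtain ⟨w, rfl⟩ := Fin.exists_succAbove_eq hz
      rw [Fin.cycleRange_succAbove, Fin.succ_succAbove_succ, Fin.cons_succ]

theorem contract_edge_mul_of_in {x x' : A} {y : B} {p : P.carrier k l} {a : Fin k → A}
    {b : Fin l → B} {i : Fin k} (hy : ∀ j, b j ≠ y) (hx : x' ≠ x) (hi : a i = x)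
    (hi' : ∀ z, a z = x → z = i) :
    Contract x y (edge h x' y * mk h p a b) (mk h p (Function.update a i x') b) := by
  refine ⟨k, l, _, _, _, i.succ, 0, edge_mul_mk x' y p a b, ⟨hi, fun z hz => ?_⟩,
    ⟨rfl, fun z => ?_⟩, ?_⟩
  · rcases eq_or_ne (i.succ.succAbove z) 0 with h0 | h0
    · rw [h0] at hz
      exact hx hz
    · obtain ⟨w, hw⟩ := Fin.exists_succ_eq.2 h0
      rw [← hw, Fin.cons_succ] at hz
      rw [hi' w hz] at hw
      exact Fin.succAbove_ne _ _ hw.symm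
  · rw [Fin.succAbove_zero]
    exact hy z
  · rw [h.tr_succ_zero_unit₁_hcomp, mk_ract]
    congr 1
    funext z
    obtain _ | k := k
    · exact i.elim0
    rcases eq_or_ne z i with rfl | hz
    · rw [Equiv.Perm.inv_def, Equiv.symm_symm, Function.update_self, Function.comp_apply,
        Fin.cycleRange_self]
      rfl
    · rw [Function.update_of_ne hz, Function.comp_apply, Function.comp_apply]
      obtain ⟨w, rfl⟩ := Fin.exists_succAbove_eq hz
      rw [Equiv.Perm.inv_def, Equiv.symm_symm, Fin.cycleRange_succAbove, Fin.succ_succAbove_succ,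
        Fin.cons_succ]

/-- `m'` is obtained from `m` by the contraction of the pairs of labels of a list. -/
def Contracts : List (A × B) → Labelled h A B → Labelled h A B → Prop
  | [], m, m' => m = m'
  | q :: L, m, m' => ∃ n, Contract q.1 q.2 m n ∧ Contracts L n m'

theorem Contracts.unique {L : List (A × B)} {m m₁ m₂ : Labelled h A B} (H₁ : Contracts L m m₁)
    (H₂ : Contracts L m m₂) : m₁ = m₂ := by
  induction L generalizing m with
  | nil => exact H₁.symm.trans H₂
  | cons q L ih =>
    obtain ⟨n₁, h₁, h₁'⟩ := H₁
    obtain ⟨n₂, h₂, h₂'⟩ := H₂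
    obtain rfl := h₁.unique h₂
    exact ih h₁' h₂'

/-- Adjacent transpositions suffice, and these are `Contract.commute`. A list of wires may therefore
be contracted in any order. -/
theorem Contracts.perm {L L' : List (A × B)} (hL : L.Perm L') {m m' : Labelled h A B}
    (H : Contracts L m m') : Contracts L' m m' := by
  induction hL generalizing m with
  | nil => exact H
  | cons q _ ih =>
    obtain ⟨n, h₁, h₂⟩ := H
    exact ⟨n, h₁, ih h₂⟩
  | swap q q' L =>
    obtain ⟨n, h₁, n', h₂, h₃⟩ := H
    obtain ⟨n'', h₄, h₅⟩ := h₁.commute h₂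
    exact ⟨n'', h₄, n', h₅, h₃⟩
  | trans _ _ ih ih' => exact ih' (ih H)

theorem contracts_append {L L' : List (A × B)} {m m' : Labelled h A B} :
    Contracts (L ++ L') m m' ↔ ∃ n, Contracts L m n ∧ Contracts L' n m' := by
  induction L generalizing m with
  | nil => exact ⟨fun H => ⟨m, rfl, H⟩, fun ⟨n, hn, H⟩ => by cases hn; exact H⟩
  | cons q L ih =>
    constructor
    · rintro ⟨n, h₁, h₂⟩
      obtain ⟨n', h₃, h₄⟩ := ih.1 h₂
      exact ⟨n', ⟨n, h₁, h₃⟩, h₄⟩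
    · rintro ⟨n', ⟨n, h₁, h₃⟩, h₄⟩
      exact ⟨n, h₁, ih.2 ⟨n', h₃, h₄⟩⟩

theorem Contracts.map {L : List (A × B)} {m m' : Labelled h A B} (H : Contracts L m m')
    {f : A → A'} {g : B → B'} (hf : Function.Injective f) (hg : Function.Injective g) :
    Contracts (L.map (Prod.map f g)) (map f g m) (map f g m') := by
  induction L generalizing m with
  | nil => exact congrArg _ H
  | cons q L ih =>
    obtain ⟨n, h₁, h₂⟩ := H
    exact ⟨_, h₁.map hf hg, ih h₂⟩

theorem Contracts.mul_right {L : List (A × B)} {m m' : Labelled h A B} (H : Contracts L m m')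
    {n : Labelled h A B} (hx : ∀ q ∈ L, q.1 ∉ inLabels n) (hy : ∀ q ∈ L, q.2 ∉ outLabels n) :
    Contracts L (m * n) (m' * n) := by
  induction L generalizing m with
  | nil => exact congrArg (· * n) H
  | cons q L ih =>
    obtain ⟨m₁, h₁, h₂⟩ := H
    rw [List.forall_mem_cons] at hx hy
    exact ⟨_, h₁.mul_right hx.1 hy.1, ih h₂ hx.2 hy.2⟩

/-- Contraction removes one occurrence of each label, so absence of repetitions persists and the
next pair can always be contracted. -/
theorem exists_contracts {L : List (A × B)} {m : Labelled h A B} {S : Multiset A}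
    {S' : Multiset B} (hS : inLabels m = (L.map Prod.fst : Multiset A) + S)
    (hS' : outLabels m = (L.map Prod.snd : Multiset B) + S')
    (hm : (inLabels m).Nodup) (hm' : (outLabels m).Nodup) :
    ∃ m', Contracts L m m' ∧ inLabels m' = S ∧ outLabels m' = S' := by
  induction L generalizing m with
  | nil => exact ⟨m, rfl, by simpa using hS, by simpa using hS'⟩
  | cons q L ih =>
    rw [List.map_cons, ← Multiset.cons_coe, Multiset.cons_add] at hS hS'
    obtain ⟨n, hn⟩ := exists_contract (x := q.1) (y := q.2) hm hm' (by simp [hS]) (by simp [hS'])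
    rw [hn.inLabels_eq] at hS hm
    rw [hn.outLabels_eq] at hS' hm'
    obtain ⟨m', h₁, h₂⟩ := ih ((Multiset.cons_inj_right _).1 hS) ((Multiset.cons_inj_right _).1 hS')
      (Multiset.nodup_cons.1 hm).2 (Multiset.nodup_cons.1 hm').2
    exact ⟨m', ⟨n, hn, h₁⟩, h₂⟩

theorem exists_perm_of_map_eq {X : Type} {a : Fin k → X} {c : Fin k' → X}
    (hc : Function.Injective c)
    (H : (Finset.univ.val.map a : Multiset X) = Finset.univ.val.map c) :
    ∃ e : Fin k ≃ Fin k', ∀ i, c (e i) = a i := by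
  have ha : Function.Injective a := injective_of_nodup (H ▸ Finset.univ.nodup.map hc)
  have h₁ : ∀ i, ∃ i', c i' = a i := fun i => by
    have : a i ∈ Finset.univ.val.map c := H ▸ Multiset.mem_map_of_mem a (Finset.mem_univ i)
    obtain ⟨i', -, hi'⟩ := Multiset.mem_map.1 this
    exact ⟨i', hi'⟩
  have h₂ : ∀ i', ∃ i, a i = c i' := fun i => by
    have : c i ∈ Finset.univ.val.map a := H ▸ Multiset.mem_map_of_mem c (Finset.mem_univ i)
    obtain ⟨i', -, hi'⟩ := Multiset.mem_map.1 this
    exact ⟨i', hi'⟩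
  choose e he using h₁
  refine ⟨Equiv.ofBijective e ⟨fun i j hij => ha ?_, fun i' => ?_⟩, he⟩
  · rw [← he, hij, he]
  · obtain ⟨i, hi⟩ := h₂ i'
    exact ⟨i, hc ((he i).trans hi)⟩

/-- With `mk_injective`, this identifies the classes whose labels are those of given injective
families with `P(k,l)`: it is how a contracted product becomes an element of the TraP again. -/
theorem exists_eq_mk {a : Fin k → A} {b : Fin l → B} (ha : Function.Injective a)
    (hb : Function.Injective b) {m : Labelled h A B} (hm : inLabels m = Finset.univ.val.map a)
    (hm' : outLabels m = Finset.univ.val.map b) : ∃ p : P.carrier k l, m = mk h p a b := by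
  induction m using ind with | H k' l' q c d =>
  obtain ⟨e, he⟩ := exists_perm_of_map_eq ha hm
  obtain ⟨f, hf⟩ := exists_perm_of_map_eq hb hm'
  obtain rfl : k' = k := by simpa using Fintype.card_congr e
  obtain rfl : l' = l := by simpa using Fintype.card_congr f
  refine ⟨P.lact f (P.ract e.symm q), ?_⟩
  rw [mk_lact, mk_ract]
  congr 1
  · funext i
    exact (he i).symm
  · funext i
    exact (hf i).symm

end Labelled

end TraPs

/-! ### Products of generators, loops and edges. -/

namespace TraPs

namespace Labelled

variable {𝕂 : Type u} [Field 𝕂] {P : TraPData.{u, v} 𝕂}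
  {h : P.IsTraP} {A B A' B' X Y X' Y' V V' : Type} {k l k' l' : ℕ}

/-- The form of `contract_edge_mul_of_out` that does not mention a representative: absorbing an edge
is a change of labels. -/
theorem contract_edge_mul_left [DecidableEq B] {x : A} {y y' : B} {m : Labelled h A B}
    (hx : x ∉ inLabels m) (hy : y ∈ outLabels m) (hm : (outLabels m).Nodup) (hy' : y' ≠ y) :
    Contract x y (edge h x y' * m) (map id (Function.update id y y') m) := by
  induction m using ind with | H k l p a b =>
  rw [inLabels_mk] at hx
  rw [outLabels_mk] at hy hm
  obtain ⟨j, -, rfl⟩ := Multiset.mem_map.1 hy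
  have hb := injective_of_nodup hm
  convert contract_edge_mul_of_out (h := h) (x := x) (p := p)
    (fun i hi => hx (Multiset.mem_map.2 ⟨i, Finset.mem_univ_val i, hi⟩)) hy' rfl
    (fun z hz => hb hz) using 1
  rw [map_mk]
  congr 1
  funext z
  rcases eq_or_ne z j with rfl | hz
  · simp
  · rw [Function.update_of_ne hz, Function.comp_apply, Function.update_of_ne (hb.ne hz), id]

variable {x : ∀ k l : ℕ, P.carrier k l}

/-- The element `x_{k,l}` where the inputs are labelled by a finite set of cardinality `k` and
the outputs by a finite set of cardinality `l`. -/
noncomputable def star (h : P.IsTraP) (x : ∀ k l : ℕ, P.carrier k l) [Fintype X] [Fintype Y]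
    (a : X → A) (b : Y → B) : Labelled h A B :=
  mk h (x (Fintype.card X) (Fintype.card Y)) (a ∘ (Fintype.equivFin X).symm)
    (b ∘ (Fintype.equivFin Y).symm)

/-- The elements `x_{k,l}` are invariant under the symmetric groups. -/
def Invariant (x : ∀ k l : ℕ, P.carrier k l) : Prop :=
  ∀ (k l : ℕ) (σ : Equiv.Perm (Fin l)) (τ : Equiv.Perm (Fin k)),
    P.lact σ (P.ract τ (x k l)) = x k l

/-- Two enumerations of the ports of a vertex differ by permutations, which fix `x k l`. The
invariance of the chosen elements enters the construction only through this lemma. -/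
theorem star_eq (hx : Invariant x) {_ : Fintype X} {_ : Fintype Y} (a : X → A) (b : Y → B)
    (e : X ≃ Fin k) (f : Y ≃ Fin l) :
    star h x a b = mk h (x k l) (a ∘ e.symm) (b ∘ f.symm) := by
  obtain rfl : Fintype.card X = k := by simpa using Fintype.card_congr e
  obtain rfl : Fintype.card Y = l := by simpa using Fintype.card_congr f
  refine mk_eq_mk_iff.2 ⟨rfl, rfl, (Fintype.equivFin Y).symm.trans f,
    e.symm.trans (Fintype.equivFin X), ?_, fun i => ?_, fun j => ?_⟩
  · rw [hx]; rfl
  · simp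
  · simp

theorem star_comp_equiv (hx : Invariant x) {_ : Fintype X} {_ : Fintype Y} {_ : Fintype X'}
    {_ : Fintype Y'}
    (a : X → A) (b : Y → B) (e : X' ≃ X) (f : Y' ≃ Y) {a' : X' → A} {b' : Y' → B}
    (ha : ∀ z, a' z = a (e z)) (hb : ∀ z, b' z = b (f z)) : star h x a' b' = star h x a b := by
  rw [star_eq hx a' b' (e.trans (Fintype.equivFin X)) (f.trans (Fintype.equivFin Y)), star]
  congr 1
  · funext z; simp [ha]
  · funext z; simp [hb]

theorem map_star [Fintype X] [Fintype Y] (f : A → A') (g : B → B') (a : X → A) (b : Y → B) :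
    map f g (star h x a b) = star h x (f ∘ a) (g ∘ b) := rfl

theorem val_map_eq_sum [Fintype X] (a : X → A) :
    (Finset.univ.val.map a : Multiset A) = ∑ i, {a i} := by
  rw [← Finset.sum_multiset_singleton Finset.univ]
  exact map_sum (Multiset.mapAddMonoidHom a) _ _

theorem map_equivFin_symm [Fintype X] (a : X → A) :
    (Finset.univ.val.map (a ∘ (Fintype.equivFin X).symm) : Multiset A) = ∑ i, {a i} := by
  rw [val_map_eq_sum]
  exact Equiv.sum_comp (Fintype.equivFin X).symm fun i => ({a i} : Multiset A)

theorem inLabels_star [Fintype X] [Fintype Y] (a : X → A) (b : Y → B) :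
    inLabels (star h x a b) = ∑ i, {a i} := map_equivFin_symm a

theorem outLabels_star [Fintype X] [Fintype Y] (a : X → A) (b : Y → B) :
    outLabels (star h x a b) = ∑ i, {b i} := map_equivFin_symm b

open Classical in
/-- The product of the elements `x_{k,l}` corresponding to the vertices of a graph. -/
noncomputable def stars (h : P.IsTraP) (x : ∀ k l : ℕ, P.carrier k l) [Fintype V] [Fintype A]
    [Fintype B] (t : A → V) (s : B → V) : Labelled h A B :=
  ∏ v, star h x (fun a : {a // t a = v} => a.1) fun b : {b // s b = v} => b.1

theorem inLabels_stars [Fintype V] [Fintype A] [Fintype B] (t : A → V) (s : B → V) :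
    inLabels (stars h x t s) = ∑ a, {a} := by
  classical
  rw [stars, inLabels_prod]
  simp only [inLabels_star]
  exact Fintype.sum_fiberwise t fun a => ({a} : Multiset A)

theorem outLabels_stars [Fintype V] [Fintype A] [Fintype B] (t : A → V) (s : B → V) :
    outLabels (stars h x t s) = ∑ a, {a} := by
  classical
  rw [stars, outLabels_prod]
  simp only [outLabels_star]
  exact Fintype.sum_fiberwise s fun a => ({a} : Multiset B)

theorem stars_equiv (hx : Invariant x) [Fintype V] [Fintype A] [Fintype B] [Fintype V']
    [Fintype A'] [Fintype B'] {t : A → V} {s : B → V} {t' : A' → V'} {s' : B' → V'}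
    (fV : V ≃ V') (fA : A ≃ A') (fB : B ≃ B') (ht : ∀ a, t' (fA a) = fV (t a))
    (hs : ∀ b, s' (fB b) = fV (s b)) :
    stars h x t' s' = map fA fB (stars h x t s) := by
  classical
  rw [stars, stars, map_prod, ← Equiv.prod_comp fV]
  refine Finset.prod_congr rfl fun v _ => ?_
  rw [map_star]
  exact (star_comp_equiv hx _ _ (fA.subtypeEquiv fun a => by rw [ht, fV.apply_eq_iff_eq])
    (fB.subtypeEquiv fun b => by rw [hs, fV.apply_eq_iff_eq]) (fun _ => rfl) fun _ => rfl).symm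

/-- The ports above a vertex of one summand all come from that summand, so the product over the
vertices splits. -/
theorem stars_sum (hx : Invariant x) [Fintype V] [Fintype A] [Fintype B] [Fintype V']
    [Fintype A'] [Fintype B'] (t : A → V) (s : B → V) (t' : A' → V') (s' : B' → V') :
    stars h x (Sum.map t t') (Sum.map s s')
      = map Sum.inl Sum.inl (stars h x t s) * map Sum.inr Sum.inr (stars h x t' s') := by
  classical
  rw [stars, stars, stars, map_prod, map_prod, Fintype.prod_sum_type]
  have h₁ : ∀ {X X' Y Y' : Type} (f : X → Y) (f' : X' → Y') (y : Y),
      ∃ e : {a : X // f a = y} ≃ {a : X ⊕ X' // Sum.map f f' a = Sum.inl y},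
        ∀ a, (e a).1 = Sum.inl a.1 := fun f f' y =>
    ⟨Equiv.ofBijective (fun a => ⟨Sum.inl a.1, congrArg Sum.inl a.2⟩) ⟨fun a b hab => by
      simpa [Subtype.ext_iff] using hab, by rintro ⟨a | a, ha⟩ <;> simp at ha ⊢; exact ⟨a, ha, rfl⟩⟩,
      fun _ => rfl⟩
  have h₂ : ∀ {X X' Y Y' : Type} (f : X → Y) (f' : X' → Y') (y : Y'),
      ∃ e : {a : X' // f' a = y} ≃ {a : X ⊕ X' // Sum.map f f' a = Sum.inr y},
        ∀ a, (e a).1 = Sum.inr a.1 := fun f f' y =>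
    ⟨Equiv.ofBijective (fun a => ⟨Sum.inr a.1, congrArg Sum.inr a.2⟩) ⟨fun a b hab => by
      simpa [Subtype.ext_iff] using hab, by rintro ⟨a | a, ha⟩ <;> simp at ha ⊢; exact ⟨a, ha, rfl⟩⟩,
      fun _ => rfl⟩
  congr 1
  · refine Finset.prod_congr rfl fun v _ => ?_
    obtain ⟨e, he⟩ := h₁ t t' v
    obtain ⟨f, hf⟩ := h₁ s s' v
    rw [map_star]
    exact (star_comp_equiv hx _ _ e f (fun a => (he a).symm) fun b => (hf b).symm).symm
  · refine Finset.prod_congr rfl fun v _ => ?_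
    obtain ⟨e, he⟩ := h₂ t t' v
    obtain ⟨f, hf⟩ := h₂ s s' v
    rw [map_star]
    exact (star_comp_equiv hx _ _ e f (fun a => (he a).symm) fun b => (hf b).symm).symm

/-- The product of `n` loops, of `m`, and of edges labelled by the elements of `[k]`; the new labels
of the outputs are given by `φ`. -/
noncomputable def assemble {C : Type} (n : ℕ) (m : Labelled h A B) (φ : B ⊕ Fin k → C) :
    Labelled h (A ⊕ Fin k) C :=
  loop h _ _ ^ n * map Sum.inl (φ ∘ Sum.inl) m * ∏ i, edge h (Sum.inr i) (φ (Sum.inr i))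

theorem inLabels_assemble {C : Type} (n : ℕ) (m : Labelled h A B) (φ : B ⊕ Fin k → C) :
    inLabels (assemble n m φ)
      = (inLabels m).map Sum.inl + Finset.univ.val.map Sum.inr := by
  have h₁ : ∀ n : ℕ, inLabels (loop h (A ⊕ Fin k) C ^ n) = 0 := fun n => by
    induction n with
    | zero => rfl
    | succ n ih => rw [pow_succ, inLabels_mul, ih]; rfl
  rw [assemble, inLabels_mul, inLabels_mul, h₁, inLabels_map, inLabels_prod, zero_add,
    val_map_eq_sum]
  rfl

theorem outLabels_assemble {C : Type} (n : ℕ) (m : Labelled h A B) (φ : B ⊕ Fin k → C) :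
    outLabels (assemble n m φ)
      = ((outLabels m).map Sum.inl + Finset.univ.val.map Sum.inr).map φ := by
  have h₁ : ∀ n : ℕ, outLabels (loop h (A ⊕ Fin k) C ^ n) = 0 := fun n => by
    induction n with
    | zero => rfl
    | succ n ih => rw [pow_succ, outLabels_mul, ih]; rfl
  rw [assemble, outLabels_mul, outLabels_mul, h₁, outLabels_map, outLabels_prod, zero_add,
    Multiset.map_add, Multiset.map_map, Multiset.map_map, val_map_eq_sum]
  rfl

theorem map_assemble {C C' : Type} {n : ℕ} {m : Labelled h A B} {φ : B ⊕ Fin k → C}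
    {φ' : B' ⊕ Fin k → C'} {f : A → A'} {f' : B → B'} {g : C → C'}
    (H : ∀ z, g (φ z) = φ' (Sum.map f' id z)) :
    map (Sum.map f id) g (assemble n m φ) = assemble n (map f f' m) φ' := by
  rw [assemble, assemble, map_mul, map_mul, map_pow, map_prod, map_loop, map_map, map_map]
  congr 1
  · congr 2
    exact funext fun z => H (Sum.inl z)
  · exact Finset.prod_congr rfl fun i _ => by
      rw [map_edge, H]; rfl

theorem map_id_assemble {C C' : Type} (n : ℕ) (m : Labelled h A B) (φ : B ⊕ Fin k → C)
    (f : A ⊕ Fin k → A') (g : C → C') :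
    map f g (assemble n m φ) = map f id (assemble n m (g ∘ φ)) := by
  have H := map_assemble (n := n) (m := m) (φ := φ) (φ' := g ∘ φ) (f := id) (f' := id) (g := g)
    (fun z => by rw [Sum.map_id_id]; rfl)
  rw [map_id, Sum.map_id_id] at H
  rw [← H, map_map]
  rfl

theorem assemble_add {C : Type} (n n' : ℕ) (m : Labelled h A B) (φ : B ⊕ Fin k → C) :
    assemble (n + n') m φ = loop h _ _ ^ n' * assemble n m φ := by
  rw [assemble, assemble, add_comm, pow_add, mul_assoc, mul_assoc, mul_assoc]

theorem assemble_perm {C : Type} (n : ℕ) (m : Labelled h A B) (φ : B ⊕ Fin k → C)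
    (τ : Equiv.Perm (Fin k)) :
    assemble n m (φ ∘ Sum.map id τ) = map (Sum.map id τ.symm) id (assemble n m φ) := by
  rw [assemble, assemble, map_mul, map_mul, map_pow, map_prod, map_loop, map_map,
    ← Equiv.prod_comp τ.symm]
  congr 1
  refine Finset.prod_congr rfl fun i _ => ?_
  rw [map_edge, Function.comp_apply, Sum.map_inr, Equiv.apply_symm_apply]
  rfl

/-- Isolates the edge of the graph input `i`, the one that a gluing at `i` contracts or absorbs. -/
theorem assemble_succAbove {C : Type} (n : ℕ) (m : Labelled h A B) (φ : B ⊕ Fin (k + 1) → C)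
    (i : Fin (k + 1)) :
    assemble n m φ
      = edge h (Sum.inr i) (φ (Sum.inr i)) * map (skip i) id (assemble n m (φ ∘ skip i)) := by
  rw [assemble, assemble, map_mul, map_mul, map_pow, map_prod, map_loop, map_map,
    Fin.prod_univ_succAbove _ i, mul_left_comm]
  rfl

theorem assemble_mul {C : Type} (n n' : ℕ) (m : Labelled h A B) (m' : Labelled h A' B')
    (φ : (B ⊕ B') ⊕ Fin (k + k') → C) :
    assemble (n + n') (map Sum.inl Sum.inl m * map Sum.inr Sum.inr m') φ
      = map (Sum.map Sum.inl (Fin.castAdd k')) id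
          (assemble n m (φ ∘ Sum.map Sum.inl (Fin.castAdd k')))
        * map (Sum.map Sum.inr (Fin.natAdd k)) id
          (assemble n' m' (φ ∘ Sum.map Sum.inr (Fin.natAdd k))) := by
  rw [assemble, assemble, assemble]
  simp only [map_mul, map_pow, map_prod, map_loop, map_map]
  rw [Fin.prod_univ_add, pow_add, mul_mul_mul_comm (loop h _ _ ^ n), mul_mul_mul_comm]
  rfl

/-- The input labelled `i` belongs to the isolated edge of that graph input. If this edge also bears
the output label `j`, contracting it yields a loop. Otherwise it is absorbed by the factor with
output `j`, whose label becomes `φ (Sum.inr i)`; that is precisely the rerouting performed by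
`traceWire`. The hypotheses on `m` say that each element of `B` labels exactly one output, so that
`j` labels exactly one output of the product. -/
theorem contract_assemble {A : Type} (n : ℕ) (m : Labelled h A B) (hm : (outLabels m).Nodup)
    (hm' : ∀ b, b ∈ outLabels m)
    (φ : B ⊕ Fin (k + 1) ≃ A ⊕ Fin (l + 1)) (i : Fin (k + 1)) (j : Fin (l + 1)) :
    Contract (Sum.inr i) (Sum.inr j) (assemble n m φ)
      (map (skip i) (skip j) (assemble (n + traceLoop i j φ) m (traceWire i j φ))) := by
  classical
  have hx : (Sum.inr i : A ⊕ Fin (k + 1))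
      ∉ inLabels (map (skip i) id (assemble n m (φ ∘ skip i))) := by
    rw [inLabels_map]
    intro hi
    obtain ⟨z, -, hz⟩ := Multiset.mem_map.1 hi
    exact skip_ne i z hz
  have hm₁ : ((outLabels m).map Sum.inl
      + (Finset.univ.val.map Sum.inr : Multiset (B ⊕ Fin k))).Nodup := by
    refine Multiset.nodup_add.2 ⟨hm.map Sum.inl_injective,
      Finset.univ.nodup.map Sum.inr_injective, ?_⟩
    rw [Multiset.disjoint_left]
    intro z hz hz'
    obtain ⟨b, -, rfl⟩ := Multiset.mem_map.1 hz
    obtain ⟨b, -, hb⟩ := Multiset.mem_map.1 hz'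
    cases hb
  have hm₂ : ∀ z, z ∈ (outLabels m).map Sum.inl
      + (Finset.univ.val.map Sum.inr : Multiset (B ⊕ Fin k)) := by
    rintro (z | z) <;> simp [hm']
  rw [assemble_succAbove n m φ i]
  by_cases h₁ : φ (Sum.inr i) = Sum.inr j
  · have h₂ : ∀ z, φ (skip i z) ≠ Sum.inr j := fun z => by
      rw [← h₁]
      exact φ.injective.ne (skip_ne i z)
    rw [traceLoop_of_eq h₁, h₁, assemble_add, map_mul, pow_one, map_loop]
    have h₃ : skip j ∘ traceWire i j φ = φ ∘ skip i :=
      funext fun z => skip_traceWire_of_ne (h₂ z)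
    rw [map_id_assemble (g := skip j), h₃]
    refine (contract_edge _ _).mul_right hx ?_
    rw [outLabels_map, outLabels_assemble, Multiset.map_id]
    intro hj
    obtain ⟨z, -, hz⟩ := Multiset.mem_map.1 hj
    exact h₂ z hz
  · rw [traceLoop_of_ne h₁, add_zero]
    -- Rerouting the wires amounts to replacing the label `j` by the end of the wire leaving `i`.
    have h₃ : skip j ∘ traceWire i j φ
        = Function.update id (Sum.inr j) (φ (Sum.inr i)) ∘ φ ∘ skip i := funext fun z => by
      rw [Function.comp_apply, Function.comp_apply, Function.comp_apply]
      by_cases hz : φ (skip i z) = Sum.inr j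
      · rw [hz, Function.update_self, skip_traceWire_of_eq hz]
      · rw [Function.update_of_ne hz, skip_traceWire_of_ne hz]; rfl
    have h₄ : map (skip i) (skip j) (assemble n m (traceWire i j φ))
        = map id (Function.update id (Sum.inr j) (φ (Sum.inr i)))
          (map (skip i) id (assemble n m (φ ∘ skip i))) := by
      rw [map_id_assemble, h₃, ← map_id_assemble, map_map]
      rfl
    rw [h₄]
    refine contract_edge_mul_left hx ?_ ?_ h₁
    · rw [outLabels_map, outLabels_assemble, Multiset.map_id]
      obtain ⟨z, hz⟩ := φ.surjective (Sum.inr j)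
      obtain ⟨z, rfl⟩ := exists_skip_eq (y := z) (i := i) (fun h => h₁ (h ▸ hz))
      exact Multiset.mem_map.2 ⟨z, hm₂ z, hz⟩
    · rw [outLabels_map, outLabels_assemble, Multiset.map_id]
      exact hm₁.map (φ.injective.comp (skip_injective i))

end Labelled

end TraPs

/-! ### The value of a port graph in a TraP. -/

namespace PortGraph

open TraPs Labelled

variable {𝕂 : Type u} [Field 𝕂] {P : TraPData.{u, v} 𝕂} {h : P.IsTraP}
  {x : ∀ k l : ℕ, P.carrier k l} {k l k' l' : ℕ}

/-- The vertices and the inputs of a graph; the labels indicate how they are wired. -/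
noncomputable def unwired (h : P.IsTraP) (x : ∀ k l : ℕ, P.carrier k l) (G : PortGraph k l) :
    Labelled h (G.A ⊕ Fin k) (G.A ⊕ Fin l) :=
  assemble G.loops (stars h x G.target G.source) G.wire

theorem univ_val_sum {A B : Type} [Fintype A] [Fintype B] :
    (Finset.univ : Finset (A ⊕ B)).val
      = Finset.univ.val.map Sum.inl + Finset.univ.val.map Sum.inr := by
  rw [← Finset.univ_disjSum_univ, Finset.val_disjSum]; rfl

theorem inLabels_unwired (G : PortGraph k l) : inLabels (G.unwired h x) = Finset.univ.val := by
  rw [unwired, inLabels_assemble, inLabels_stars, Finset.sum_multiset_singleton, univ_val_sum]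

theorem outLabels_unwired (G : PortGraph k l) : outLabels (G.unwired h x) = Finset.univ.val := by
  rw [unwired, outLabels_assemble, outLabels_stars, Finset.sum_multiset_singleton,
    ← univ_val_sum, ← Finset.map_univ_equiv G.wire, Finset.map_val]
  rfl

/-- The wires to the inputs of the vertices. -/
noncomputable def wires (k l : ℕ) (A : Type) [Fintype A] : List ((A ⊕ Fin k) × (A ⊕ Fin l)) :=
  Finset.univ.toList.map fun a => (Sum.inl a, Sum.inl a)

theorem mem_wires {A : Type} [Fintype A] {q : (A ⊕ Fin k) × (A ⊕ Fin l)} :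
    q ∈ wires k l A ↔ ∃ a, q = (Sum.inl a, Sum.inl a) := by
  simp [wires, eq_comm]

theorem wires_map_equiv {A A' : Type} [Fintype A] [Fintype A'] (e : A ≃ A') :
    ((wires k l A).map (Prod.map (Sum.map e id) (Sum.map e id))).Perm (wires k l A') := by
  rw [wires, wires, List.map_map]
  rw [← Multiset.coe_eq_coe, ← Multiset.map_coe, ← Multiset.map_coe, Finset.coe_toList,
    Finset.coe_toList, ← Finset.map_univ_equiv e, Finset.map_val, Multiset.map_map]
  rfl

/-- The wiring is a bijection, so each name labels one input and one output and all contractions are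
possible. The remaining labels are the numbers of the inputs and outputs, in the right summands, and
`exists_eq_mk` applies. -/
theorem exists_contracts_unwired (h : P.IsTraP) (x : ∀ k l : ℕ, P.carrier k l)
    (G : PortGraph k l) :
    ∃ p : P.carrier k l, Contracts (wires k l G.A) (G.unwired h x) (Labelled.mk h p Sum.inr Sum.inr) := by
  obtain ⟨m, hm, h₁, h₂⟩ := exists_contracts (L := wires k l G.A) (m := G.unwired h x)
    (S := Finset.univ.val.map Sum.inr) (S' := Finset.univ.val.map Sum.inr)
    (by rw [inLabels_unwired, wires, List.map_map, ← Multiset.map_coe, Finset.coe_toList,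
      univ_val_sum]; rfl)
    (by rw [outLabels_unwired, wires, List.map_map, ← Multiset.map_coe, Finset.coe_toList,
      univ_val_sum]; rfl)
    (by rw [inLabels_unwired]; exact Finset.univ.nodup)
    (by rw [outLabels_unwired]; exact Finset.univ.nodup)
  obtain ⟨p, rfl⟩ := exists_eq_mk Sum.inr_injective Sum.inr_injective h₁ h₂
  exact ⟨p, hm⟩

/-- The value of a graph in a TraP, when each vertex with `k` inputs and `l` outputs is replaced
by `x_{k,l}`. -/
noncomputable def val (h : P.IsTraP) (x : ∀ k l : ℕ, P.carrier k l) (G : PortGraph k l) :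
    P.carrier k l :=
  (exists_contracts_unwired h x G).choose

theorem contracts_val (h : P.IsTraP) (x : ∀ k l : ℕ, P.carrier k l) (G : PortGraph k l) :
    Contracts (wires k l G.A) (G.unwired h x) (Labelled.mk h (G.val h x) Sum.inr Sum.inr) :=
  (exists_contracts_unwired h x G).choose_spec

/-- The value is characterised by the contraction, so each compatibility below is proved by
contracting the product in a convenient way. -/
theorem val_eq {G : PortGraph k l} {p : P.carrier k l}
    (H : Contracts (wires k l G.A) (G.unwired h x) (Labelled.mk h p Sum.inr Sum.inr)) : G.val h x = p :=
  mk_injective Sum.inr_injective Sum.inr_injective ((contracts_val h x G).unique H)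

theorem Iso.val_eq (hx : Invariant x) {G H : PortGraph k l} (f : Iso G H) :
    H.val h x = G.val h x := by
  apply PortGraph.val_eq
  have h₁ : H.unwired h x = map (Sum.map f.A id) (Sum.map f.A id) (G.unwired h x) := by
    rw [unwired, unwired, stars_equiv hx f.V f.A f.B f.target f.source, f.loops]
    exact (map_assemble fun z => (f.wire z).symm).symm
  rw [h₁]
  exact ((contracts_val h x G).map (Sum.map_injective.2 ⟨f.A.injective, Function.injective_id⟩)
    (Sum.map_injective.2 ⟨f.A.injective, Function.injective_id⟩)).perm (wires_map_equiv f.A)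

/-- Renumbering changes only the labels that survive the contraction; the contracted pairs stay the
same. -/
theorem val_lact (σ : Equiv.Perm (Fin l)) (G : PortGraph k l) :
    (G.lact σ).val h x = P.lact σ (G.val h x) := by
  apply PortGraph.val_eq
  have h₁ : (G.lact σ).unwired h x = map id (Sum.map id σ) (G.unwired h x) := by
    rw [unwired, unwired, map_id_assemble, map_id]
    rfl
  rw [h₁, mk_lact]
  have h₂ := (contracts_val h x G).map Function.injective_id
    (Sum.map_injective.2 ⟨Function.injective_id, σ.injective⟩)
  rw [wires, List.map_map] at h₂
  exact h₂

theorem val_ract (τ : Equiv.Perm (Fin k)) (G : PortGraph k l) :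
    (G.ract τ).val h x = P.ract τ (G.val h x) := by
  apply PortGraph.val_eq
  have h₁ : (G.ract τ).unwired h x = map (Sum.map id τ.symm) id (G.unwired h x) :=
    assemble_perm _ _ _ _
  rw [h₁, mk_ract]
  have h₂ := (contracts_val h x G).map
    (Sum.map_injective.2 ⟨Function.injective_id, τ.symm.injective⟩) Function.injective_id
  rw [wires, List.map_map] at h₂
  exact h₂

/-- Compute one contraction of `unwired G` in two orders. Contracting `(i, j)` first gives the
product of the glued graph, by `contract_assemble`, and then its value; contracting it last gives
the trace of the value of `G`. -/
theorem val_tr (i : Fin (k + 1)) (j : Fin (l + 1)) (G : PortGraph (k + 1) (l + 1)) :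
    (G.tr i j).val h x = P.tr i j (G.val h x) := by
  have h₁ : Contract (Sum.inr i) (Sum.inr j) (G.unwired h x)
      (map (skip i) (skip j) ((G.tr i j).unwired h x)) :=
    contract_assemble _ _
      (by rw [outLabels_stars, Finset.sum_multiset_singleton]; exact Finset.univ.nodup)
      (fun b => by rw [outLabels_stars, Finset.sum_multiset_singleton]; exact Finset.mem_univ_val b)
      _ _ _
  have h₂ := (contracts_val h x (G.tr i j)).map (skip_injective i) (skip_injective j)
  have h₃ : Contracts ((Sum.inr i, Sum.inr j) :: wires (k + 1) (l + 1) G.A) (G.unwired h x)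
      (Labelled.mk h ((G.tr i j).val h x) (Sum.inr ∘ i.succAbove) (Sum.inr ∘ j.succAbove)) := by
    refine ⟨_, h₁, ?_⟩
    rw [wires, List.map_map] at h₂
    exact h₂
  have h₄ : Contracts (wires (k + 1) (l + 1) G.A ++ [(Sum.inr i, Sum.inr j)]) (G.unwired h x)
      (Labelled.mk h (P.tr i j (G.val h x)) (Sum.inr ∘ i.succAbove) (Sum.inr ∘ j.succAbove)) :=
    contracts_append.2 ⟨_, contracts_val h x G, _, ⟨_, _, _, _, _, i, j, rfl,
      ⟨rfl, fun z hz => Fin.succAbove_ne i z (Sum.inr_injective hz)⟩,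
      ⟨rfl, fun z hz => Fin.succAbove_ne j z (Sum.inr_injective hz)⟩, rfl⟩, rfl⟩
  exact mk_injective (Sum.inr_injective.comp Fin.succAbove_right_injective)
    (Sum.inr_injective.comp Fin.succAbove_right_injective)
    ((h₃.perm (List.perm_append_singleton _ _).symm).unique h₄)

end PortGraph

/-! ### Values of corollas, units and disjoint unions. -/

namespace TraPs

namespace Labelled

variable {𝕂 : Type u} [Field 𝕂] {P : TraPData.{u, v} 𝕂} {h : P.IsTraP} {k l : ℕ}

/-- Each edge renames one input of `p` from `Sum.inl i` to `Sum.inr i`. The list `L` consists of the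
inputs not yet renamed, whence the conditional labels. -/
theorem contracts_edges (p : P.carrier k l) {L : List (Fin k)} (hL : L.Nodup) :
    Contracts (L.map fun i => ((Sum.inl i : Fin k ⊕ Fin k), (Sum.inl i : Fin k ⊕ Fin l)))
      ((L.map fun i => edge h (Sum.inr i : Fin k ⊕ Fin k) (Sum.inl i : Fin k ⊕ Fin l)).prod
        * mk h p (fun i => if i ∈ L then Sum.inl i else Sum.inr i) Sum.inr)
      (mk h p Sum.inr Sum.inr) := by
  induction L with
  | nil => simp [Contracts]
  | cons i L ih =>
    rw [List.nodup_cons] at hL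
    refine ⟨_, ?_, ih hL.2⟩
    have h₁ := contract_edge_mul_of_in (h := h) (x := (Sum.inl i : Fin k ⊕ Fin k))
      (x' := Sum.inr i) (y := (Sum.inl i : Fin k ⊕ Fin l)) (p := p) (b := Sum.inr)
      (a := fun z => if z ∈ i :: L then Sum.inl z else Sum.inr z) (i := i)
      (fun j hj => by cases hj) (by simp) (by simp) (fun z hz => by
        by_contra hzi
        split_ifs at hz with hz'
        exact hzi (Sum.inl_injective hz))
    -- The edges that are still to be absorbed are spectators of this contraction.
    have h₂ := h₁.mul_right
      (n := (L.map fun i => edge h (Sum.inr i : Fin k ⊕ Fin k) (Sum.inl i : Fin k ⊕ Fin l)).prod)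
      (by
        clear h₁ ih hL
        induction L with
        | nil => simp [inLabels_one]
        | cons j L ih =>
          rw [List.map_cons, List.prod_cons, inLabels_mul, Multiset.mem_add, inLabels_edge]
          rintro (hi | hi)
          · simp at hi
          · exact ih hi)
      (by
        replace hL := hL.1
        clear h₁ ih
        induction L with
        | nil => simp [outLabels_one]
        | cons j L ih =>
          rw [List.map_cons, List.prod_cons, outLabels_mul, Multiset.mem_add, outLabels_edge]
          rw [List.mem_cons, not_or] at hL
          rintro (hi | hi)
          · exact hL.1 (by simpa using hi)
          · exact ih hL.2 hi)
    convert h₂ using 1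
    · rw [List.map_cons, List.prod_cons, mul_right_comm]
    · rw [mul_comm]
      congr 2
      funext z
      rcases eq_or_ne z i with rfl | hz
      · simp [hL.1]
      · simp [hz]

theorem stars_of_isEmpty {A B V : Type} [Fintype V] [Fintype A] [Fintype B] [IsEmpty V]
    (x : ∀ k l : ℕ, P.carrier k l) (t : A → V) (s : B → V) : stars h x t s = 1 :=
  Fintype.prod_empty _

theorem assemble_zero_one {A B C : Type} (φ : B ⊕ Fin k → C) :
    assemble 0 (1 : Labelled h A B) φ = ∏ i, edge h (Sum.inr i) (φ (Sum.inr i)) := by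
  rw [assemble, Labelled.map_one, pow_zero, mul_one, one_mul]

end Labelled

end TraPs

namespace PortGraph

open TraPs Labelled

variable {𝕂 : Type u} [Field 𝕂] {P : TraPData.{u, v} 𝕂} {h : P.IsTraP}
  {x : ∀ k l : ℕ, P.carrier k l} {k l k' l' : ℕ}

theorem unwired_hcomp (hx : Invariant x) (G : PortGraph k l) (H : PortGraph k' l') :
    (G.hcomp H).unwired h x
      = map (Sum.map Sum.inl (Fin.castAdd k')) (Sum.map Sum.inl (Fin.castAdd l')) (G.unwired h x)
        * map (Sum.map Sum.inr (Fin.natAdd k)) (Sum.map Sum.inr (Fin.natAdd l))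
          (H.unwired h x) := by
  have h₁ : sumWire G.wire H.wire ∘ Sum.map Sum.inl (Fin.castAdd k')
      = Sum.map Sum.inl (Fin.castAdd l') ∘ G.wire := funext fun z => sumWire_inl _ _ z
  have h₂ : sumWire G.wire H.wire ∘ Sum.map Sum.inr (Fin.natAdd k)
      = Sum.map Sum.inr (Fin.natAdd l) ∘ H.wire := funext fun z => sumWire_inr _ _ z
  have h₃ := assemble_mul G.loops H.loops (stars h x G.target G.source)
    (stars h x H.target H.source) (sumWire G.wire H.wire)
  rw [← stars_sum hx, h₁, h₂, ← map_id_assemble, ← map_id_assemble] at h₃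
  exact h₃

theorem wires_sum (k l k' l' : ℕ) (A A' : Type) [Fintype A] [Fintype A'] :
    ((wires k l A).map (Prod.map (Sum.map Sum.inl (Fin.castAdd k'))
        (Sum.map Sum.inl (Fin.castAdd l')))
      ++ (wires k' l' A').map (Prod.map (Sum.map Sum.inr (Fin.natAdd k))
        (Sum.map Sum.inr (Fin.natAdd l)))).Perm (wires (k + k') (l + l') (A ⊕ A')) := by
  rw [wires, wires, wires, List.map_map, List.map_map, ← Multiset.coe_eq_coe,
    ← Multiset.coe_add, ← Multiset.map_coe, ← Multiset.map_coe, ← Multiset.map_coe,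
    Finset.coe_toList, Finset.coe_toList, Finset.coe_toList, univ_val_sum, Multiset.map_add,
    Multiset.map_map, Multiset.map_map]
  rfl

/-- The wires of `G` are contracted with the product of `H` as spectator, then those of `H` with the
value of `G` as spectator. The names coming from the two graphs are disjoint. -/
theorem val_hcomp (hx : Invariant x) (G : PortGraph k l) (H : PortGraph k' l') :
    (G.hcomp H).val h x = P.hcomp (G.val h x) (H.val h x) := by
  apply PortGraph.val_eq
  rw [unwired_hcomp hx]
  have i₁ : ∀ {X Y : Type} (m n : ℕ),
      Function.Injective (Sum.map (Sum.inl : X → X ⊕ Y) (Fin.castAdd (n := m) n)) := fun m n =>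
    Sum.map_injective.2 ⟨Sum.inl_injective, Fin.castAdd_injective m n⟩
  have i₂ : ∀ {X Y : Type} (m n : ℕ),
      Function.Injective (Sum.map (Sum.inr : Y → X ⊕ Y) (Fin.natAdd n (m := m))) := fun m n =>
    Sum.map_injective.2 ⟨Sum.inr_injective, Fin.natAdd_injective m n⟩
  have h₁ := ((contracts_val h x G).map (i₁ (Y := H.A) k k') (i₁ (Y := H.A) l l')).mul_right
    (n := map (Sum.map Sum.inr (Fin.natAdd k)) (Sum.map Sum.inr (Fin.natAdd l)) (H.unwired h x))
    (fun q hq hq' => by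
      rw [inLabels_map] at hq'
      obtain ⟨r, hr, rfl⟩ := List.mem_map.1 hq
      obtain ⟨a, rfl⟩ := mem_wires.1 hr
      obtain ⟨z | z, -, hz⟩ := Multiset.mem_map.1 hq' <;> simp at hz)
    (fun q hq hq' => by
      rw [outLabels_map] at hq'
      obtain ⟨r, hr, rfl⟩ := List.mem_map.1 hq
      obtain ⟨a, rfl⟩ := mem_wires.1 hr
      obtain ⟨z | z, -, hz⟩ := Multiset.mem_map.1 hq' <;> simp at hz)
  have h₂ := ((contracts_val h x H).map (i₂ (X := G.A) k' k) (i₂ (X := G.A) l' l)).mul_right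
    (n := map (Sum.map Sum.inl (Fin.castAdd k')) (Sum.map Sum.inl (Fin.castAdd l'))
      (Labelled.mk h (G.val h x) Sum.inr Sum.inr))
    (fun q hq hq' => by
      rw [inLabels_map, inLabels_mk] at hq'
      obtain ⟨r, hr, rfl⟩ := List.mem_map.1 hq
      obtain ⟨a, rfl⟩ := mem_wires.1 hr
      obtain ⟨z | z, -, hz⟩ := Multiset.mem_map.1 hq' <;> simp at hz)
    (fun q hq hq' => by
      rw [outLabels_map, outLabels_mk] at hq'
      obtain ⟨r, hr, rfl⟩ := List.mem_map.1 hq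
      obtain ⟨a, rfl⟩ := mem_wires.1 hr
      obtain ⟨z | z, -, hz⟩ := Multiset.mem_map.1 hq' <;> simp at hz)
  rw [mul_comm] at h₂
  have h₃ := contracts_append.2 ⟨_, h₁, h₂⟩
  have h₄ : map (Sum.map Sum.inr (Fin.natAdd k)) (Sum.map Sum.inr (Fin.natAdd l))
      (Labelled.mk h (H.val h x) (Sum.inr : _ → H.A ⊕ Fin k')
        (Sum.inr : _ → H.A ⊕ Fin l'))
      * map (Sum.map Sum.inl (Fin.castAdd k')) (Sum.map Sum.inl (Fin.castAdd l'))
        (Labelled.mk h (G.val h x) (Sum.inr : _ → G.A ⊕ Fin k)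
          (Sum.inr : _ → G.A ⊕ Fin l))
      = Labelled.mk h (P.hcomp (G.val h x) (H.val h x)) Sum.inr Sum.inr := by
    rw [mul_comm, map_mk, map_mk, mk_mul_mk]
    congr 1
    · funext i
      refine Fin.addCases (fun i => ?_) (fun i => ?_) i
      · rw [Fin.append_left]; rfl
      · rw [Fin.append_right]; rfl
    · funext i
      refine Fin.addCases (fun i => ?_) (fun i => ?_) i
      · rw [Fin.append_left]; rfl
      · rw [Fin.append_right]; rfl
  rw [h₄] at h₃
  exact h₃.perm (wires_sum k l k' l' G.A H.A)

/-- The empty graph. -/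
def unit₀ : PortGraph 0 0 where
  V := Empty
  A := Empty
  B := Empty
  target := Empty.elim
  source := Empty.elim
  wire := Equiv.equivOfIsEmpty _ _
  loops := 0

theorem val_unit₀ : unit₀.val h x = P.unit₀ := by
  apply PortGraph.val_eq
  -- The wiring is kept abstract, with all ports in `Empty`: the products over vertices and inputs
  -- are empty whatever it is.
  obtain ⟨φ, hφ⟩ : ∃ φ : Empty ⊕ Fin 0 → Empty ⊕ Fin 0, unit₀.unwired h x
      = assemble 0 (stars h x (Empty.elim : Empty → Empty) (Empty.elim : Empty → Empty)) φ :=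
    ⟨unit₀.wire, rfl⟩
  have h₁ : unit₀.unwired h x = 1 := by
    rw [hφ, stars_of_isEmpty, assemble_zero_one]
    exact Fintype.prod_empty _
  rw [h₁, one_eq Sum.inr Sum.inr]
  have h₂ : wires 0 0 unit₀.A = [] := by
    change wires 0 0 Empty = []
    simp [wires]
  rw [h₂]
  rfl

theorem val_unit₁ : unit₁.val h x = P.unit₁ := by
  apply PortGraph.val_eq
  obtain ⟨φ, hφ⟩ : ∃ φ : Empty ⊕ Fin 1 → Empty ⊕ Fin 1, unit₁.unwired h x
      = assemble 0 (stars h x (Empty.elim : Empty → Empty) (Empty.elim : Empty → Empty)) φ :=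
    ⟨unit₁.wire, rfl⟩
  have h₁ : unit₁.unwired h x
      = Labelled.mk h P.unit₁ (Sum.inr : Fin 1 → Empty ⊕ Fin 1) Sum.inr := by
    rw [hφ, stars_of_isEmpty, assemble_zero_one, Fin.prod_univ_one, edge]
    have h₂ : ∀ a b : Empty ⊕ Fin 1, a = b := by
      rintro (a | a) (b | b)
      exacts [a.elim, a.elim, b.elim, congrArg _ (Subsingleton.elim a b)]
    congr 1 <;> exact funext fun _ => h₂ _ _
  rw [h₁]
  have h₂ : wires 1 1 unit₁.A = [] := by
    change wires 1 1 Empty = []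
    simp [wires]
  rw [h₂]
  rfl

/-- The graph with one vertex, `k` input edges and `l` output edges. -/
def corolla (k l : ℕ) : PortGraph k l where
  V := Unit
  A := Fin k
  B := Fin l
  target _ := ()
  source _ := ()
  wire := Equiv.sumComm _ _
  loops := 0

/-- The product consists of `x k l` and of one edge into each of its inputs; absorbing these edges
only renames the inputs. -/
theorem val_corolla (hx : Invariant x) (k l : ℕ) : (corolla k l).val h x = x k l := by
  apply PortGraph.val_eq
  have h₁ : (corolla k l).unwired h x = (∏ i, edge h (Sum.inr i) (Sum.inl i))
      * Labelled.mk h (x k l) Sum.inl Sum.inr := by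
    have h₂ : stars h x (fun _ : Fin k => ()) (fun _ : Fin l => ())
        = Labelled.mk h (x k l) id id := by
      rw [stars, Fintype.prod_unique]
      exact star_eq hx _ _ (Equiv.subtypeUnivEquiv fun _ => rfl)
        (Equiv.subtypeUnivEquiv fun _ => rfl)
    change assemble 0 (stars h x (fun _ : Fin k => ()) (fun _ : Fin l => ()))
      (Equiv.sumComm (Fin l) (Fin k)) = _
    rw [h₂, assemble, pow_zero, one_mul, mul_comm]
    rfl
  have h₂ := contracts_edges (h := h) (x k l) (L := Finset.univ.toList) (Finset.nodup_toList _)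
  simp only [Finset.mem_toList, Finset.mem_univ, if_true] at h₂
  rw [Finset.prod_map_toList] at h₂
  rw [h₁]
  exact h₂

end PortGraph

/-! ### Generation of all graphs by the corollas. -/

namespace InOutGraph

open TraPs

variable {k l k' l' : ℕ}

/-- Isomorphisms which do not respect the indexations of the inputs and outputs. -/
structure WeakIso (G : InOutGraph k l) (H : InOutGraph k' l') where
  V : G.V ≃ H.V
  E : G.E ≃ H.E
  I : G.I ≃ H.I
  O : G.O ≃ H.O
  InOut : G.InOut ≃ H.InOut
  L : G.L ≃ H.L
  s_E : ∀ e, H.s (Sum.inl (E e)) = V (G.s (Sum.inl e))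
  s_O : ∀ e, H.s (Sum.inr (O e)) = V (G.s (Sum.inr e))
  t_E : ∀ e, H.t (Sum.inl (E e)) = V (G.t (Sum.inl e))
  t_I : ∀ e, H.t (Sum.inr (I e)) = V (G.t (Sum.inr e))

/-- The graphs which are obtained from the graphs `G_{k,l}` by the operations of `Gr^↻`. -/
inductive Generated : ∀ {k l : ℕ}, InOutGraph k l → Prop
  | unit₀ : Generated unit₀
  | unit₁ : Generated unit₁
  | corolla (k l : ℕ) : Generated (corolla k l)
  | lact {k l : ℕ} (σ : Equiv.Perm (Fin l)) {G : InOutGraph k l} :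
    Generated G → Generated (G.lact σ)
  | ract {k l : ℕ} (τ : Equiv.Perm (Fin k)) {G : InOutGraph k l} :
    Generated G → Generated (G.ract τ)
  | hcomp {k l k' l' : ℕ} {G : InOutGraph k l} {H : InOutGraph k' l'} :
    Generated G → Generated H → Generated (G.hcomp H)
  | tr {k l : ℕ} (i : Fin (k + 1)) (j : Fin (l + 1)) {G : InOutGraph (k + 1) (l + 1)} :
    Generated G → Generated (G.tr i j)
  | congr {k l : ℕ} {G H : InOutGraph k l} : G ≈ H → Generated G → Generated H

/-- The actions realise every renumbering, so indexations may be ignored and chosen arbitrarily when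
a graph is decomposed. The numbers of inputs and outputs are forced by cardinality. -/
theorem Generated.of_weakIso {G : InOutGraph k l} {H : InOutGraph k' l'} (hG : Generated G)
    (f : WeakIso G H) : Generated H := by
  obtain rfl : k = k' := by
    simpa using Nat.card_congr ((G.α.symm.trans (Equiv.sumCongr f.I f.InOut)).trans H.α)
  obtain rfl : l = l' := by
    simpa using Nat.card_congr ((G.β.symm.trans (Equiv.sumCongr f.O f.InOut)).trans H.β)
  refine Generated.congr ?_
    ((hG.lact ((G.β.symm.trans (Equiv.sumCongr f.O f.InOut)).trans H.β)).ract
      ((H.α.symm.trans (Equiv.sumCongr f.I f.InOut).symm).trans G.α))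
  exact ⟨{ f with
    α_I := fun e => (congrArg (fun z => H.α (Sum.map f.I f.InOut z))
      (G.α.symm_apply_apply (Sum.inl e))).symm
    α_InOut := fun e => (congrArg (fun z => H.α (Sum.map f.I f.InOut z))
      (G.α.symm_apply_apply (Sum.inr e))).symm
    β_O := fun e => (congrArg (fun z => H.β (Sum.map f.O f.InOut z))
      (G.β.symm_apply_apply (Sum.inl e))).symm
    β_InOut := fun e => (congrArg (fun z => H.β (Sum.map f.O f.InOut z))
      (G.β.symm_apply_apply (Sum.inr e))).symm }⟩

/-- The graph reduced to a loop. -/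
def loopGraph : InOutGraph 0 0 where
  V := Empty
  E := Empty
  I := Empty
  O := Empty
  InOut := Empty
  L := Unit
  finite_V := inferInstance
  finite_E := inferInstance
  finite_I := inferInstance
  finite_O := inferInstance
  finite_InOut := inferInstance
  finite_L := inferInstance
  s := Sum.elim Empty.elim Empty.elim
  t := Sum.elim Empty.elim Empty.elim
  α := Equiv.equivOfIsEmpty _ _
  β := Equiv.equivOfIsEmpty _ _

theorem generated_loopGraph : Generated loopGraph := by
  have h₁ : unit₁.tr 0 0 = unit₁.glueLoop (0 : Fin 1) := dif_pos rfl
  have h₂ := Generated.unit₁.tr 0 0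
  rw [h₁] at h₂
  refine h₂.of_weakIso
    { V := Equiv.refl Empty
      E := Equiv.refl Empty
      I := Equiv.refl Empty
      O := Equiv.refl Empty
      InOut := ?_
      L := ?_
      s_E := fun e => e.elim
      s_O := fun e => e.elim
      t_E := fun e => e.elim
      t_I := fun e => e.elim }
  · change {a : Fin 1 // a ≠ 0} ≃ Empty
    exact ⟨fun a => (a.2 (Subsingleton.elim _ _)).elim, Empty.elim,
      fun a => (a.2 (Subsingleton.elim _ _)).elim, fun a => a.elim⟩
  · change Option Empty ≃ Unit
    exact ⟨fun _ => (), fun _ => none, by rintro (_ | ⟨⟨⟩⟩); rfl, fun _ => rfl⟩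

/-- The disjoint union of a subset and of its complement. -/
noncomputable def splitEquiv {X Y : Type} (p : X → Prop) (f : Y ≃ {x // ¬ p x}) :
    {x // p x} ⊕ Y ≃ X :=
  haveI := Classical.decPred p
  (Equiv.sumCongr (Equiv.refl _) f).trans (Equiv.sumCompl p)

/-- A point is the complement of its complement. -/
noncomputable def pointEquiv {X : Type} (x : X) : Unit ≃ {y // ¬ y ≠ x} where
  toFun _ := ⟨x, fun h => h rfl⟩
  invFun _ := ()
  left_inv _ := rfl
  right_inv y := Subtype.ext (not_not.1 y.2).symm

/-- The number of edges (other than the input and output edges) and vertices. -/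
noncomputable def size (G : InOutGraph k l) : ℕ :=
  Nat.card G.E + Nat.card G.V + Nat.card G.L + Nat.card G.InOut

theorem card_ne_lt {X : Type} [Finite X] (x : X) : Nat.card {y // y ≠ x} < Nat.card X :=
  Finite.card_subtype_lt (p := (· ≠ x)) (x := x) (by simp)

/-- The internal edge `e` is cut into an input edge and an output edge, both called `none`; gluing
them back restores `G`. -/
theorem exists_weakIso_tr (G : InOutGraph k l) (e : G.E) :
    ∃ (H : InOutGraph (k + 1) (l + 1)) (i : Fin (k + 1)) (j : Fin (l + 1)),
      H.size < G.size ∧ Nonempty (WeakIso (H.tr i j) G) := by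
  classical
  have hα : Nat.card (Option G.I ⊕ G.InOut) = k + 1 := by
    have := Nat.card_congr G.α
    rw [Nat.card_sum, Nat.card_fin] at this
    rw [Nat.card_sum, Finite.card_option]
    omega
  have hβ : Nat.card (Option G.O ⊕ G.InOut) = l + 1 := by
    have := Nat.card_congr G.β
    rw [Nat.card_sum, Nat.card_fin] at this
    rw [Nat.card_sum, Finite.card_option]
    omega
  let H : InOutGraph (k + 1) (l + 1) :=
    { V := G.V
      E := {a : G.E // a ≠ e}
      I := Option G.I
      O := Option G.O
      InOut := G.InOut
      L := G.L
      finite_V := inferInstance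
      finite_E := inferInstance
      finite_I := inferInstance
      finite_O := inferInstance
      finite_InOut := inferInstance
      finite_L := inferInstance
      s := Sum.elim (fun a => G.s (Sum.inl a.1))
        fun a => a.elim (G.s (Sum.inl e)) fun a => G.s (Sum.inr a)
      t := Sum.elim (fun a => G.t (Sum.inl a.1))
        fun a => a.elim (G.t (Sum.inl e)) fun a => G.t (Sum.inr a)
      α := Finite.equivFinOfCardEq hα
      β := Finite.equivFinOfCardEq hβ }
  refine ⟨H, H.α (Sum.inl none), H.β (Sum.inl none), ?_, ?_⟩
  · have : Nat.card {a : G.E // a ≠ e} < Nat.card G.E := card_ne_lt e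
    change Nat.card {a : G.E // a ≠ e} + Nat.card G.V + Nat.card G.L + Nat.card G.InOut < _
    rw [size]
    omega
  · have h₁ : H.tr (H.α (Sum.inl none)) (H.β (Sum.inl none)) = H.glueEdge none none := by
      rw [InOutGraph.tr, Equiv.symm_apply_apply, Equiv.symm_apply_apply]
      rfl
    have h₂ : ∀ X : Type, ∃ f : {a : Option X // a ≠ none} ≃ X, ∀ a, a.1 = some (f a) := fun X =>
      ⟨⟨fun a => a.1.get (Option.ne_none_iff_isSome.1 a.2), fun a => ⟨some a, by simp⟩,
        fun a => by simp, fun a => by simp⟩, fun a => by simp⟩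
    rw [h₁]
    obtain ⟨fI, hI⟩ := h₂ G.I
    obtain ⟨fO, hO⟩ := h₂ G.O
    exact ⟨{
      V := Equiv.refl _
      E := Equiv.optionSubtypeNe e
      I := fI
      O := fO
      InOut := Equiv.refl _
      L := Equiv.refl _
      s_E := by
        rintro (_ | a) <;> rfl
      s_O := fun a => (congrArg
        (fun z : Option G.O => z.elim (G.s (Sum.inl e)) fun a => G.s (Sum.inr a)) (hO a)).symm
      t_E := by
        rintro (_ | a) <;> rfl
      t_I := fun a => (congrArg
        (fun z : Option G.I => z.elim (G.t (Sum.inl e)) fun a => G.t (Sum.inr a)) (hI a)).symm }⟩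

theorem exists_weakIso_hcomp_loopGraph (G : InOutGraph k l) (e : G.L) :
    ∃ H : InOutGraph k l, H.size < G.size ∧ Nonempty (WeakIso (H.hcomp loopGraph) G) := by
  refine ⟨{ G with L := {a // a ≠ e}, finite_L := inferInstance }, ?_, ⟨{
    V := Equiv.sumEmpty G.V Empty
    E := Equiv.sumEmpty G.E Empty
    I := Equiv.sumEmpty G.I Empty
    O := Equiv.sumEmpty G.O Empty
    InOut := Equiv.sumEmpty G.InOut Empty
    L := splitEquiv (· ≠ e) (pointEquiv e)
    s_E := ?_
    s_O := ?_
    t_E := ?_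
    t_I := ?_ }⟩⟩
  · have : Nat.card {a : G.L // a ≠ e} < Nat.card G.L := card_ne_lt e
    change Nat.card G.E + Nat.card G.V + Nat.card {a : G.L // a ≠ e} + Nat.card G.InOut < _
    rw [size]
    omega
  all_goals
    rintro (a | ⟨⟨⟩⟩)
    rfl

theorem exists_weakIso_hcomp_unit₁ (G : InOutGraph k l) (e : G.InOut) :
    ∃ (k' l' : ℕ) (H : InOutGraph k' l'), H.size < G.size ∧
      Nonempty (WeakIso (H.hcomp unit₁) G) := by
  refine ⟨_, _, { G with
    InOut := {a // a ≠ e}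
    finite_InOut := inferInstance
    α := Finite.equivFin (G.I ⊕ {a // a ≠ e})
    β := Finite.equivFin (G.O ⊕ {a // a ≠ e}) }, ?_, ⟨{
    V := Equiv.sumEmpty G.V Empty
    E := Equiv.sumEmpty G.E Empty
    I := Equiv.sumEmpty G.I Empty
    O := Equiv.sumEmpty G.O Empty
    InOut := splitEquiv (Y := Fin 1) (· ≠ e) (finOneEquiv.trans (pointEquiv e))
    L := Equiv.sumEmpty G.L Empty
    s_E := ?_
    s_O := ?_
    t_E := ?_
    t_I := ?_ }⟩⟩
  · have : Nat.card {a : G.InOut // a ≠ e} < Nat.card G.InOut := card_ne_lt e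
    change Nat.card G.E + Nat.card G.V + Nat.card G.L + Nat.card {a : G.InOut // a ≠ e} < _
    rw [size]
    omega
  all_goals
    rintro (a | ⟨⟨⟩⟩)
    rfl

/-- Without internal edges, the edges at `v` are not attached to any other vertex, so `v` and its
edges split off as a corolla. -/
theorem exists_weakIso_hcomp_corolla (G : InOutGraph k l) [IsEmpty G.E] (v : G.V) :
    ∃ (k' l' m n : ℕ) (H : InOutGraph k' l'), H.size < G.size ∧
      Nonempty (WeakIso (H.hcomp (corolla m n)) G) := by
  let H : InOutGraph (Nat.card ({a // G.t (Sum.inr a) ≠ v} ⊕ G.InOut))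
      (Nat.card ({a // G.s (Sum.inr a) ≠ v} ⊕ G.InOut)) :=
    { V := {a // a ≠ v}
      E := Empty
      I := {a // G.t (Sum.inr a) ≠ v}
      O := {a // G.s (Sum.inr a) ≠ v}
      InOut := G.InOut
      L := G.L
      finite_V := inferInstance
      finite_E := inferInstance
      finite_I := inferInstance
      finite_O := inferInstance
      finite_InOut := inferInstance
      finite_L := inferInstance
      s := Sum.elim Empty.elim fun a => ⟨_, a.2⟩
      t := Sum.elim Empty.elim fun a => ⟨_, a.2⟩
      α := Finite.equivFin _
      β := Finite.equivFin _ }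
  refine ⟨_, _, Nat.card {a // ¬ G.t (Sum.inr a) ≠ v}, Nat.card {a // ¬ G.s (Sum.inr a) ≠ v},
    H, ?_, ⟨{
    V := splitEquiv (· ≠ v) (pointEquiv v)
    E := (Equiv.sumEmpty Empty Empty).trans (Equiv.equivOfIsEmpty _ _)
    I := splitEquiv (Y := Fin _) (fun a => G.t (Sum.inr a) ≠ v) (Finite.equivFin _).symm
    O := splitEquiv (Y := Fin _) (fun a => G.s (Sum.inr a) ≠ v) (Finite.equivFin _).symm
    InOut := Equiv.sumEmpty G.InOut Empty
    L := Equiv.sumEmpty G.L Empty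
    s_E := by rintro (⟨⟨⟩⟩ | ⟨⟨⟩⟩)
    s_O := ?_
    t_E := by rintro (⟨⟨⟩⟩ | ⟨⟨⟩⟩)
    t_I := ?_ }⟩⟩
  · have : Nat.card {a : G.V // a ≠ v} < Nat.card G.V := card_ne_lt v
    change Nat.card Empty + Nat.card {a : G.V // a ≠ v} + Nat.card G.L + Nat.card G.InOut < _
    rw [size, Nat.card_of_isEmpty (α := Empty)]
    omega
  · rintro (a | a)
    · rfl
    · exact not_not.1 ((Finite.equivFin {a // ¬ G.s (Sum.inr a) ≠ v}).symm a).2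
  · rintro (a | a)
    · rfl
    · exact not_not.1 ((Finite.equivFin {a // ¬ G.t (Sum.inr a) ≠ v}).symm a).2

/-- Each reduction decreases `size`. Internal edges are cut before vertices are detached. The cut
adds an input edge and an output edge, which is why `size` does not count these. -/
theorem generated (G : InOutGraph k l) : Generated G := by
  induction h : G.size using Nat.strong_induction_on generalizing k l with
  | _ n ih =>
  subst h
  rcases isEmpty_or_nonempty G.E with hE | ⟨⟨e⟩⟩
  swap
  · obtain ⟨H, i, j, hH, ⟨f⟩⟩ := G.exists_weakIso_tr e
    exact ((ih _ hH H rfl).tr i j).of_weakIso f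
  rcases isEmpty_or_nonempty G.V with hV | ⟨⟨v⟩⟩
  swap
  · obtain ⟨k', l', m, n, H, hH, ⟨f⟩⟩ := G.exists_weakIso_hcomp_corolla v
    exact ((ih _ hH H rfl).hcomp (Generated.corolla m n)).of_weakIso f
  rcases isEmpty_or_nonempty G.L with hL | ⟨⟨e⟩⟩
  swap
  · obtain ⟨H, hH, ⟨f⟩⟩ := G.exists_weakIso_hcomp_loopGraph e
    exact ((ih _ hH H rfl).hcomp generated_loopGraph).of_weakIso f
  rcases isEmpty_or_nonempty G.InOut with hJ | ⟨⟨e⟩⟩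
  swap
  · obtain ⟨k', l', H, hH, ⟨f⟩⟩ := G.exists_weakIso_hcomp_unit₁ e
    exact ((ih _ hH H rfl).hcomp Generated.unit₁).of_weakIso f
  -- Input and output edges have a vertex as extremity, so none is left and the graph is empty.
  have hI : IsEmpty G.I := ⟨fun a => hV.false (G.t (Sum.inr a))⟩
  have hO : IsEmpty G.O := ⟨fun a => hV.false (G.s (Sum.inr a))⟩
  exact Generated.unit₀.of_weakIso
    { V := Equiv.equivOfIsEmpty Empty _
      E := Equiv.equivOfIsEmpty Empty _
      I := Equiv.equivOfIsEmpty Empty _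
      O := Equiv.equivOfIsEmpty Empty _
      InOut := Equiv.equivOfIsEmpty Empty _
      L := Equiv.equivOfIsEmpty Empty _
      s_E := fun e => e.elim
      s_O := fun e => e.elim
      t_E := fun e => e.elim
      t_I := fun e => e.elim }

end InOutGraph

/-! ### The universal property. -/

namespace graphTraP

open TraPs Labelled

variable {𝕂 : Type u} [Field 𝕂] {P : TraPData.{u, v} 𝕂} {k l k' l' : ℕ}

/-- A morphism on `Gr^↻` is determined by its values on the graphs `G_{k,l}`. -/
theorem hom_ext {Φ Ψ : TraPHom (graphTraP 𝕂) P}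
    (h : ∀ k l, Φ.toFun k l (corolla 𝕂 k l) = Ψ.toFun k l (corolla 𝕂 k l)) : Φ = Ψ := by
  have H : ∀ {k l : ℕ} (G : InOutGraph k l), G.Generated →
      Φ.toFun k l (basis G) = Ψ.toFun k l (basis G) := by
    intro k l G hG
    induction hG with
    | unit₀ => exact Φ.map_unit₀.trans Ψ.map_unit₀.symm
    | unit₁ => exact Φ.map_unit₁.trans Ψ.map_unit₁.symm
    | corolla k l => exact h k l
    | lact σ _ ih => rw [← lact_basis, Φ.map_lact, Ψ.map_lact, ih]
    | ract τ _ ih => rw [← ract_basis, Φ.map_ract, Ψ.map_ract, ih]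
    | hcomp _ _ ih ih' => rw [← hcomp_basis, Φ.map_hcomp, Ψ.map_hcomp, ih, ih']
    | tr i j _ ih => rw [← tr_basis, Φ.map_tr, Ψ.map_tr, ih]
    | congr hGH _ ih => rw [← basis_eq hGH, ih]
  refine TraPHom.ext (funext fun k => funext fun l => LinearMap.ext fun p => ?_)
  induction p using induction with
  | zero => simp
  | add x y hx hy => simp [hx, hy]
  | smul c x hx => simp [hx]
  | basis G => exact H G G.generated

/-- The linear map which sends each graph to its value. -/
noncomputable def valMap (h : P.IsTraP) {x : ∀ k l : ℕ, P.carrier k l} (hx : Invariant x)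
    (k l : ℕ) : (graphTraP 𝕂).carrier k l →ₗ[𝕂] P.carrier k l :=
  Finsupp.linearCombination 𝕂 (Quotient.lift (s := InOutGraph.setoid k l)
    (fun G => G.toPort.val h x) fun _ _ ⟨f⟩ => (f.toPort.val_eq hx).symm)

theorem valMap_basis (h : P.IsTraP) {x : ∀ k l : ℕ, P.carrier k l} (hx : Invariant x)
    (G : InOutGraph k l) : valMap h hx k l (basis G) = G.toPort.val h x :=
  (Finsupp.linearCombination_single _ _ _).trans (one_smul _ _)

/-- The morphism which sends `G_{k,l}` to `x_{k,l}`. -/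
noncomputable def lift (h : P.IsTraP) {x : ∀ k l : ℕ, P.carrier k l} (hx : Invariant x) :
    TraPHom (graphTraP 𝕂) P where
  toFun := valMap h hx
  map_hcomp p p' := by
    induction p using induction with
    | zero => simp
    | add x y hx hy => simp [hx, hy]
    | smul c x hx => simp [hx]
    | basis G =>
    induction p' using induction with
    | zero => simp
    | add x y hx hy => simp [hx, hy]
    | smul c x hx => simp [hx]
    | basis G' =>
      rw [hcomp_basis, valMap_basis, valMap_basis, valMap_basis, ← PortGraph.val_hcomp hx]
      exact ((G.toPort_hcomp G').val_eq hx).symm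
  map_lact σ p := by
    induction p using induction with
    | zero => simp
    | add x y hx hy => simp [hx, hy]
    | smul c x hx => simp [hx]
    | basis G =>
      rw [lact_basis, valMap_basis, valMap_basis, ← PortGraph.val_lact]
      exact ((G.toPort_lact σ).val_eq hx).symm
  map_ract τ p := by
    induction p using induction with
    | zero => simp
    | add x y hx hy => simp [hx, hy]
    | smul c x hx => simp [hx]
    | basis G =>
      rw [ract_basis, valMap_basis, valMap_basis, ← PortGraph.val_ract]
      exact ((G.toPort_ract τ).val_eq hx).symm
  map_tr i j p := by
    induction p using induction with
    | zero => simp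
    | add x y hx hy => simp [hx, hy]
    | smul c x hx => simp [hx]
    | basis G =>
      rw [tr_basis, valMap_basis, valMap_basis, ← PortGraph.val_tr]
      obtain ⟨f⟩ := InOutGraph.toPort_tr i j G
      exact (f.val_eq hx).symm
  map_unit₀ := by
    refine (valMap_basis h hx InOutGraph.unit₀).trans ?_
    rw [← PortGraph.val_unit₀ (h := h) (x := x)]
    refine (PortGraph.Iso.val_eq hx
      { V := Equiv.refl Empty
        A := Equiv.sumEmpty Empty Empty
        B := Equiv.sumEmpty Empty Empty
        target := by rintro (⟨⟨⟩⟩ | ⟨⟨⟩⟩)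
        source := by rintro (⟨⟨⟩⟩ | ⟨⟨⟩⟩)
        wire := by rintro ((⟨⟨⟩⟩ | ⟨⟨⟩⟩) | i); exact i.elim0
        loops := (Nat.card_of_isEmpty (α := Empty)).symm }).symm
  map_unit₁ := by
    refine (valMap_basis h hx InOutGraph.unit₁).trans ?_
    rw [← PortGraph.val_unit₁ (h := h) (x := x)]
    exact (InOutGraph.toPort_unit₁.val_eq hx).symm

theorem lift_corolla (h : P.IsTraP) {x : ∀ k l : ℕ, P.carrier k l} (hx : Invariant x) (k l : ℕ) :
    (lift h hx).toFun k l (corolla 𝕂 k l) = x k l := by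
  refine (valMap_basis h hx (InOutGraph.corolla k l)).trans ?_
  rw [← PortGraph.val_corolla (h := h) hx k l]
  -- The translation `toPort` presents the ports as `Empty ⊕ Fin k` and `Empty ⊕ Fin l`; the
  -- isomorphism drops the empty set of internal edges.
  exact (PortGraph.Iso.val_eq hx
    { V := Equiv.refl Unit
      A := Equiv.emptySum Empty (Fin k)
      B := Equiv.emptySum Empty (Fin l)
      target := fun _ => rfl
      source := fun _ => rfl
      wire := by rintro ((⟨⟨⟩⟩ | i) | i) <;> rfl
      loops := (Nat.card_of_isEmpty (α := Empty)).symm }).symm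

end graphTraP

theorem mainTheorem2 (𝕂 : Type u) [Field 𝕂] :
    (graphTraP 𝕂).IsTraP ∧
    (∀ (k l : ℕ) (σ : Equiv.Perm (Fin l)) (τ : Equiv.Perm (Fin k)),
      (graphTraP 𝕂).lact σ ((graphTraP 𝕂).ract τ (graphTraP.corolla 𝕂 k l))
        = graphTraP.corolla 𝕂 k l) ∧
    ∀ (P : TraPData.{u, v} 𝕂), P.IsTraP →
      ∀ x : (k l : ℕ) → P.carrier k l,
        (∀ (k l : ℕ) (σ : Equiv.Perm (Fin l)) (τ : Equiv.Perm (Fin k)),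
          P.lact σ (P.ract τ (x k l)) = x k l) →
        ∃! Φ : TraPHom (graphTraP 𝕂) P,
          ∀ k l : ℕ, Φ.toFun k l (graphTraP.corolla 𝕂 k l) = x k l := by
  refine ⟨graphTraP.isTraP, fun k l σ τ => graphTraP.corolla_invariant σ τ, fun P h x hx =>
    ⟨graphTraP.lift h hx, graphTraP.lift_corolla h hx, fun Ψ hΨ => ?_⟩⟩
  exact graphTraP.hom_ext fun k l => (hΨ k l).trans (graphTraP.lift_corolla h hx k l).symm
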